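/- Let $\mathrm{CAT}$ be the $2$-category of small categories, let $\mathcal I$ be a small filtered category and $\mathcal J$ a finite category. "$2$-functor" means pseudofunctor, "$2$-natural transformation" means pseudonatural transformation (with invertible constraints), and a category is identified with the corresponding constant $2$-functor. For a $2$-functor $\mathfrak b:\mathcal K\to\mathrm{CAT}$ on a small category $\mathcal K$, a $2$-natural transformation $\sigma:\mathfrak b\to P$ to a category $P$ exhibits $P$ as a $2$-colimit of $\mathfrak b$ if for every small category $X$ the functor $F\mapsto F\circ\sigma$, from the category of functors $P\to X$ to the category of $2$-natural transformations $\mathfrak b\to X$ and modifications, is an equivalence of categories. Dually, $\sigma:P\to\mathfrak b$ exhibits $P$ as a $2$-limit of $\mathfrak b$ if for every small category $X$ the functor $F\mapsto\sigma\circ F$ from the category of functors $X\to P$ to the category of $2$-natural transformations $X\to\mathfrak b$ and modifications is an equivalence; for a contravariant system on $\mathcal J$ one takes $\mathcal K=\mathcal J^{op}$. Let $\mathfrak a:\mathcal I\times\mathcal J^{op}\to\mathrm{CAT}$ be a $2$-functor. Then: (a) The iterated $2$-limits exist. That is, there are: a $2$-functor $j\mapsto 2\varinjlim_{i}\mathfrak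 a(i,j)$ on $\mathcal J^{op}$ with a transformation $\iota_{i,j}:\mathfrak a(i,j)\to 2\varinjlim_{i}\mathfrak a(i,j)$, $2$-natural in $(i,j)$, which for each fixed $j$ exhibits a $2$-colimit of $\mathfrak a(\cdot,j)$; a $2$-functor $i\mapsto 2\varprojlim_{j}\mathfrak a(i,j)$ on $\mathcal I$ with a transformation $\pi_{i,j}:2\varprojlim_{j}\mathfrak a(i,j)\to\mathfrak a(i,j)$, $2$-natural in $(i,j)$, which for each fixed $i$ exhibits a $2$-limit of $\mathfrak a(i,\cdot)$; a $2$-colimit $p_i:2\varprojlim_{j}\mathfrak a(i,j)\to 2\varinjlim_{i}2\varprojlim_{j}\mathfrak a(i,j)$ of the second $2$-functor; and a $2$-limit $q_j:2\varprojlim_{j}2\varinjlim_{i}\mathfrak a(i,j)\to 2\varinjlim_{i}\mathfrak a(i,j)$ of the first. (b) For every choice of such data, there is a functor $$\Psi:\ 2\varinjlim_{i\in\mathcal I}2\varprojlim_{j\in\mathcal J}\mathfrak a(i,j)\longrightarrow 2\varprojlim_{j\in\mathcal J}2\varinjlim_{i\in\mathcal I}\mathfrak a(i,j)$$ induced by the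 composites $\iota_{i,j}\circ\pi_{i,j}$, i.e. such that the $2$-natural transformations (in $(i,j)$) $q_j\circ\Psi\circ p_i$ and $\iota_{i,j}\circ\pi_{i,j}$ are isomorphic through an invertible modification. Such a functor is unique up to isomorphism. (c) For every choice of such data, every such functor $\Psi$ is an equivalence of categories. -/

import Mathlib

open CategoryTheory Bicategory
open scoped Pseudofunctor.StrongTrans

universe u

namespace TwoLim

/-- A `2`-functor (pseudofunctor) from a category `K` to `CAT`, the `2`-category of small
categories. -/
abbrev Diagram (K : Type u) [SmallCategory K] : Type (u + 1) :=
  LocallyDiscrete K ⥤ᵖ Cat.{u, u}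

section Coherence

/-! Coherence computations in a bicategory, used to restrict `2`-natural transformations. -/

universe w v u'

variable {D : Type u'} [Bicategory.{w, v} D]

theorem coh_whisker_id {X Y : D} {G' G1 : X ⟶ X} {H' H1 : Y ⟶ Y} {s : X ⟶ Y}
   {gm : G' ⟶ G1} {gid : G1 ⟶ 𝟙 X} {hm : H' ⟶ H1} {hid : H1 ⟶ 𝟙 Y} {n' : G' ≫ s ⟶ s ≫ H'} {n1 : G1 ≫ s ⟶ s ≫ H1}
   (h1 : gm ▷ s ≫ n1 = n' ≫ s ◁ hm)
   (h2 : n1 ≫ s ◁ hid = gid ▷ s ≫ (λ_ s).hom ≫ (ρ_ s).inv) {t k} (ht : t = hm ≫ hid) (hk : k = gm ≫ gid):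
   n' ≫ s ◁ t = k ▷ s ≫ (λ_ s).hom ≫ (ρ_ s).inv := by
  subst ht hk
  rw [Bicategory.whiskerLeft_comp, ← reassoc_of% h1, h2]
  simp

theorem coh_whisker_comp {X Y Z X' Y' Z' : D} {G1 G2 : X ⟶ Z} {Gf : X ⟶ Y} {Gg : Y ⟶ Z}
   {H1 H2 : X' ⟶ Z'} {Hf : X' ⟶ Y'} {Hg : Y' ⟶ Z'} {x : X ⟶ X'} {y : Y ⟶ Y'} {z : Z ⟶ Z'}
   {gm : G1 ⟶ G2} {gc : G2 ⟶ Gf ≫ Gg} {hm : H1 ⟶ H2} {hc : H2 ⟶ Hf ≫ Hg}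
   {n1 : G1 ≫ z ⟶ x ≫ H1} {n2 : G2 ≫ z ⟶ x ≫ H2} {nf : Gf ≫ y ⟶ x ≫ Hf} {ng : Gg ≫ z ⟶ y ≫ Hg}
   (h1 : gm ▷ z ≫ n2 = n1 ≫ x ◁ hm)
   (h2 : n2 ≫ x ◁ hc = gc ▷ z ≫ (α_ _ _ _).hom ≫ Gf ◁ ng ≫ (α_ _ _ _).inv ≫ nf ▷ Hg ≫ (α_ _ _ _).hom)
   {t k} (ht : t = hm ≫ hc) (hk : k = gm ≫ gc) :
   n1 ≫ x ◁ t = k ▷ z ≫ (α_ _ _ _).hom ≫ Gf ◁ ng ≫ (α_ _ _ _).inv ≫ nf ▷ Hg ≫ (α_ _ _ _).hom := by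
  subst ht hk
  rw [Bicategory.whiskerLeft_comp, ← reassoc_of% h1, h2]
  simp

theorem coh_slice_cocone {X Y Z C : D} {E : C ⟶ C} (e : E ≅ 𝟙 C)
   {m : E ⟶ E ≫ E} (hl : m ≫ e.hom ▷ E ≫ (λ_ E).hom = 𝟙 E)
   {f : X ⟶ Y} {g : Y ⟶ Z} {fg : X ⟶ Z} {k : fg ⟶ f ≫ g} {x : X ⟶ C} {y : Y ⟶ C} {z : Z ⟶ C}
   {nf : f ≫ y ⟶ x ≫ E} {ng : g ≫ z ⟶ y ≫ E} {nfg : fg ≫ z ⟶ x ≫ E}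
   (h : nfg ≫ x ◁ m = k ▷ z ≫ (α_ _ _ _).hom ≫ f ◁ ng ≫ (α_ _ _ _).inv ≫ nf ▷ E ≫ (α_ _ _ _).hom) :
   (nfg ≫ x ◁ e.hom) ≫ x ◁ (λ_ (𝟙 C)).inv = k ▷ z ≫ (α_ _ _ _).hom ≫ f ◁ (ng ≫ y ◁ e.hom) ≫ (α_ _ _ _).inv ≫
     (nf ≫ x ◁ e.hom) ▷ 𝟙 C ≫ (α_ _ _ _).hom := by
  have key : k ▷ z ≫ (α_ _ _ _).hom ≫ f ◁ (ng ≫ y ◁ e.hom) ≫ (α_ _ _ _).inv ≫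
     (nf ≫ x ◁ e.hom) ▷ 𝟙 C ≫ (α_ _ _ _).hom = (nfg ≫ x ◁ m) ≫ x ◁ (E ◁ e.hom ≫ e.hom ▷ 𝟙 C) := by
    rw [h]
    simp only [Bicategory.whiskerLeft_comp, Category.assoc, Bicategory.comp_whiskerRight]
    congr 3
    simp only [Bicategory.whisker_assoc, Category.assoc, Iso.inv_hom_id, Category.comp_id]
    rw [associator_inv_naturality_right_assoc, whisker_exchange_assoc]
    rw [← associator_naturality_right_assoc]
  rw [key, whisker_exchange]
  have : m ≫ e.hom ▷ E = (λ_ E).inv := by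
    rw [← cancel_mono (λ_ E).hom]; simpa using hl
  simp only [Category.assoc, ← Bicategory.whiskerLeft_comp]
  rw [reassoc_of% this]
  simp

theorem coh_slice_cone {X Y Z C : D} {E : C ⟶ C} (e : E ≅ 𝟙 C)
   {m : E ⟶ E ≫ E} (hl : m ≫ e.hom ▷ E ≫ (λ_ E).hom = 𝟙 E)
   {f : X ⟶ Y} {g : Y ⟶ Z} {fg : X ⟶ Z} {k : fg ⟶ f ≫ g} {x : C ⟶ X} {y : C ⟶ Y} {z : C ⟶ Z}
   {nf : E ≫ y ⟶ x ≫ f} {ng : E ≫ z ⟶ y ≫ g} {nfg : E ≫ z ⟶ x ≫ fg}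
   (h : nfg ≫ x ◁ k = m ▷ z ≫ (α_ _ _ _).hom ≫ E ◁ ng ≫ (α_ _ _ _).inv ≫ nf ▷ g ≫ (α_ _ _ _).hom) :
   (e.inv ▷ z ≫ nfg) ≫ x ◁ k = (λ_ (𝟙 C)).inv ▷ z ≫ (α_ _ _ _).hom ≫ 𝟙 C ◁ (e.inv ▷ z ≫ ng) ≫ (α_ _ _ _).inv ≫
     (e.inv ▷ y ≫ nf) ▷ g ≫ (α_ _ _ _).hom := by
  have hm : m = (λ_ E).inv ≫ e.inv ▷ E := by
    rw [← cancel_mono (e.hom ▷ E), ← cancel_mono (λ_ E).hom]; simpa using hl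
  have hm2 : e.inv ≫ m = (λ_ (𝟙 C)).inv ≫ 𝟙 C ◁ e.inv ≫ e.inv ▷ E := by
    rw [hm, leftUnitor_inv_naturality_assoc]
  rw [Category.assoc, h, ← Bicategory.comp_whiskerRight_assoc, hm2]
  simp only [Bicategory.whiskerLeft_comp, Category.assoc, Bicategory.comp_whiskerRight]
  congr 1
  simp only [Bicategory.whisker_assoc, Category.assoc]
  congr 2
  rw [associator_naturality_left_assoc, ← whisker_exchange_assoc, associator_inv_naturality_left_assoc,
    Iso.inv_hom_id_assoc]
theorem coh_slice_cocone_id {X C : D} {E : C ⟶ C} {e e' : E ⟶ 𝟙 C} (he : e' = e) {g : X ⟶ X}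
    {k : g ⟶ 𝟙 X} {x : X ⟶ C} {n : g ≫ x ⟶ x ≫ E}
    (h : n ≫ x ◁ e' = k ▷ x ≫ (λ_ x).hom ≫ (ρ_ x).inv) :
    (n ≫ x ◁ e) ≫ x ◁ 𝟙 (𝟙 C) = k ▷ x ≫ (λ_ x).hom ≫ (ρ_ x).inv := by
  subst he
  simp [h]

theorem coh_slice_cone_id {X C : D} {E : C ⟶ C} {e : E ≅ 𝟙 C} {e' : E ⟶ 𝟙 C} (he : e' = e.hom)
    {g : X ⟶ X} {k : g ⟶ 𝟙 X} {x : C ⟶ X} {n : E ≫ x ⟶ x ≫ g}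
    (h : n ≫ x ◁ k = e' ▷ x ≫ (λ_ x).hom ≫ (ρ_ x).inv) :
    (e.inv ▷ x ≫ n) ≫ x ◁ k = 𝟙 (𝟙 C) ▷ x ≫ (λ_ x).hom ≫ (ρ_ x).inv := by
  subst he
  simp [h]

theorem coh_slice_cocone_nat {X Y C : D} {E : C ⟶ C} {e : E ⟶ 𝟙 C} {t : E ⟶ E} (ht : t = 𝟙 E)
    {f g : X ⟶ Y} {η : f ⟶ g} {x : X ⟶ C} {y : Y ⟶ C} {nf : f ≫ y ⟶ x ≫ E} {ng : g ≫ y ⟶ x ≫ E}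
    (h : η ▷ y ≫ ng = nf ≫ x ◁ t) :
    η ▷ y ≫ ng ≫ x ◁ e = (nf ≫ x ◁ e) ≫ x ◁ 𝟙 (𝟙 C) := by
  subst ht
  simp [reassoc_of% h]

theorem coh_slice_cone_nat {X Y C : D} {E : C ⟶ C} {e : 𝟙 C ⟶ E} {t : E ⟶ E} (ht : t = 𝟙 E)
    {f g : X ⟶ Y} {η : f ⟶ g} {x : C ⟶ X} {y : C ⟶ Y} {nf : E ≫ y ⟶ x ≫ f} {ng : E ≫ y ⟶ x ≫ g}
    (h : t ▷ y ≫ ng = nf ≫ x ◁ η) :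
    𝟙 (𝟙 C) ▷ y ≫ e ▷ y ≫ ng = (e ▷ y ≫ nf) ≫ x ◁ η := by
  subst ht
  simp [← h]

variable {K : Type u} [SmallCategory K] (b : Diagram K)

theorem map₂_self {x y : LocallyDiscrete K} {f : x ⟶ y} (θ : f ⟶ f) : b.map₂ θ = 𝟙 (b.map f) := by
  obtain rfl : θ = 𝟙 f := Subsingleton.elim _ _
  simp

theorem map₂_mapId {x : LocallyDiscrete K} (θ θ' : 𝟙 x ⟶ 𝟙 x) :
    b.map₂ θ ≫ b.map₂ θ' ≫ (b.mapId x).hom = (b.mapId x).hom := by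
  rw [map₂_self, map₂_self, Category.id_comp, Category.id_comp]

theorem map₂_mapComp_id {x : LocallyDiscrete K} {h : x ⟶ x} (θ : 𝟙 x ⟶ h)
    (θ' : h ⟶ 𝟙 x ≫ 𝟙 x) :
    (b.map₂ θ ≫ b.map₂ θ' ≫ (b.mapComp (𝟙 x) (𝟙 x)).hom) ≫
      (b.mapId x).hom ▷ b.map (𝟙 x) ≫ (λ_ (b.map (𝟙 x))).hom = 𝟙 (b.map (𝟙 x)) := by
  simp only [Category.assoc]
  rw [← b.map₂_left_unitor, ← b.map₂_comp, ← b.map₂_comp, map₂_self]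

end Coherence

section Const

variable (K : Type u) [SmallCategory K]

/-- The constant `2`-functor with value `X`. -/
abbrev const (X : Cat.{u, u}) : Diagram K where
  obj _ := X
  map _ := 𝟙 X
  map₂ _ := 𝟙 (𝟙 X)
  mapId _ := Iso.refl _
  mapComp _ _ := (λ_ (𝟙 X)).symm

/-- The `2`-natural transformation between constant `2`-functors given by a functor `F`. -/
abbrev constMap {X Y : Cat.{u, u}} (F : X ⟶ Y) : const K X ⟶ const K Y where
  app _ := F
  naturality _ := λ_ F ≪≫ (ρ_ F).symm
  naturality_naturality η := by
    obtain rfl := LocallyDiscrete.eq_of_hom η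
    obtain rfl : η = 𝟙 _ := Subsingleton.elim _ _
    simp
  naturality_id _ := by
    change (λ_ F ≪≫ (ρ_ F).symm).hom ≫ F ◁ 𝟙 (𝟙 Y) = 𝟙 (𝟙 X) ▷ F ≫ (λ_ F).hom ≫ (ρ_ F).inv
    simp
  naturality_comp _ _ := by
    change (λ_ F ≪≫ (ρ_ F).symm).hom ≫ F ◁ (λ_ (𝟙 Y)).inv =
      (λ_ (𝟙 X)).inv ▷ F ≫ (α_ (𝟙 X) (𝟙 X) F).hom ≫ 𝟙 X ◁ (λ_ F ≪≫ (ρ_ F).symm).hom ≫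
        (α_ (𝟙 X) F (𝟙 Y)).inv ≫ (λ_ F ≪≫ (ρ_ F).symm).hom ▷ 𝟙 Y ≫ (α_ F (𝟙 Y) (𝟙 Y)).hom
    simp

/-- The functor `Hom(X, Y) ⥤ Hom(const X, const Y)`. -/
abbrev constFunctor (X Y : Cat.{u, u}) : (X ⟶ Y) ⥤ (const K X ⟶ const K Y) where
  obj F := constMap K F
  map {F G} α :=
    ⟨{app := fun _ => α
      naturality := fun _ => by
        change 𝟙 X ◁ α ≫ (λ_ G ≪≫ (ρ_ G).symm).hom = (λ_ F ≪≫ (ρ_ F).symm).hom ≫ α ▷ 𝟙 Y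
        simp }⟩

end Const

section Universal

variable {K : Type u} [SmallCategory K] {b : Diagram K} {P : Cat.{u, u}}

/-- The functor `F ↦ F ∘ σ` from the category of functors `P ⥤ X` to the category of
`2`-natural transformations `b ⟶ X` (with modifications as morphisms). -/
def compCocone (σ : b ⟶ const K P) (X : Cat.{u, u}) : (P ⟶ X) ⥤ (b ⟶ const K X) :=
  constFunctor K P X ⋙ precomp (const K X) σ

/-- The functor `F ↦ σ ∘ F` from the category of functors `X ⥤ P` to the category of
`2`-natural transformations `X ⟶ b` (with modifications as morphisms). -/
def compCone (σ : const K P ⟶ b) (X : Cat.{u, u}) : (X ⟶ P) ⥤ (const K X ⟶ b) :=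
  constFunctor K X P ⋙ postcomp (const K X) σ

/-- `σ : b ⟶ P` exhibits the category `P` as a `2`-colimit of `b`. -/
def IsTwoColimit (σ : b ⟶ const K P) : Prop :=
  ∀ X : Cat.{u, u}, (compCocone σ X).IsEquivalence

/-- `σ : P ⟶ b` exhibits the category `P` as a `2`-limit of `b`. A contravariant system on `J`
is a `2`-functor `b` on `K = Jᵒᵖ`. -/
def IsTwoLimit (σ : const K P ⟶ b) : Prop :=
  ∀ X : Cat.{u, u}, (compCone σ X).IsEquivalence

end Universal

section Pull

variable {K L : Type u} [SmallCategory K] [SmallCategory L]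

/-- Precomposition of a `2`-functor with an ordinary functor. -/
abbrev pull (S : L ⥤ K) (b : Diagram K) : Diagram L :=
  S.toPseudofunctor.comp b

/-- Restriction of a `2`-natural transformation along a functor `S`. -/
abbrev pullTrans (S : L ⥤ K) {b c : Diagram K} (σ : b ⟶ c) : pull S b ⟶ pull S c where
  app x := σ.app ⟨S.obj x.as⟩
  naturality f := σ.naturality (S.map f.as).toLoc
  naturality_naturality η := σ.naturality_naturality (S.toPseudofunctor.map₂ η)
  naturality_id x := coh_whisker_id (σ.naturality_naturality (S.toPseudofunctor.mapId x).hom)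
    (σ.naturality_id ⟨S.obj x.as⟩) rfl rfl
  naturality_comp f g :=
    coh_whisker_comp (σ.naturality_naturality (S.toPseudofunctor.mapComp f g).hom)
      (σ.naturality_comp (S.map f.as).toLoc (S.map g.as).toLoc) rfl rfl

/-- Restriction of a `2`-natural transformation `b ⟶ P` along a functor `S`. -/
abbrev pullCocone (S : L ⥤ K) {b : Diagram K} {P : Cat.{u, u}} (σ : b ⟶ const K P) :
    pull S b ⟶ const L P where
  app x := σ.app ⟨S.obj x.as⟩
  naturality f := σ.naturality (S.map f.as).toLoc
  naturality_naturality η := σ.naturality_naturality (S.toPseudofunctor.map₂ η)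
  naturality_id x := coh_whisker_id (σ.naturality_naturality (S.toPseudofunctor.mapId x).hom)
    (σ.naturality_id ⟨S.obj x.as⟩) (Category.id_comp _).symm rfl
  naturality_comp f g :=
    coh_whisker_comp (σ.naturality_naturality (S.toPseudofunctor.mapComp f g).hom)
      (σ.naturality_comp (S.map f.as).toLoc (S.map g.as).toLoc) (Category.id_comp _).symm rfl

/-- Restriction of a `2`-natural transformation `P ⟶ b` along a functor `S`. -/
abbrev pullCone (S : L ⥤ K) {b : Diagram K} {P : Cat.{u, u}} (σ : const K P ⟶ b) :
    const L P ⟶ pull S b where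
  app x := σ.app ⟨S.obj x.as⟩
  naturality f := σ.naturality (S.map f.as).toLoc
  naturality_naturality η := σ.naturality_naturality (S.toPseudofunctor.map₂ η)
  naturality_id x := coh_whisker_id (σ.naturality_naturality (S.toPseudofunctor.mapId x).hom)
    (σ.naturality_id ⟨S.obj x.as⟩) rfl (Category.id_comp _).symm
  naturality_comp f g :=
    coh_whisker_comp (σ.naturality_naturality (S.toPseudofunctor.mapComp f g).hom)
      (σ.naturality_comp (S.map f.as).toLoc (S.map g.as).toLoc) rfl (Category.id_comp _).symm

end Pull

section Slice

variable {I J : Type u} [SmallCategory I] [SmallCategory J] {a : Diagram (I × J)}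

/-- The `2`-functor `a(·, j)`. -/
abbrev col (a : Diagram (I × J)) (j : J) : Diagram I := pull (CategoryTheory.Prod.sectL I j) a

/-- The `2`-functor `a(i, ·)`. -/
abbrev row (a : Diagram (I × J)) (i : I) : Diagram J := pull (CategoryTheory.Prod.sectR i J) a

/-- The `2`-functor `(i, j) ↦ D(i)`. -/
abbrev ofFst (D : Diagram I) : Diagram (I × J) := pull (CategoryTheory.Prod.fst I J) D

/-- The `2`-functor `(i, j) ↦ C(j)`. -/
abbrev ofSnd (C : Diagram J) : Diagram (I × J) := pull (CategoryTheory.Prod.snd I J) C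

/-- A `2`-natural transformation `a(i, j) ⟶ C(j)` restricts, for fixed `j`, to a `2`-natural
transformation from `a(·, j)` to the category `C(j)`. -/
abbrev colCocone {C : Diagram J} (ι : a ⟶ ofSnd C) (j : J) : col a j ⟶ const I (C.obj ⟨j⟩) where
  app x := ι.app ⟨(x.as, j)⟩
  naturality {x _} f := (pullTrans (CategoryTheory.Prod.sectL I j) ι).naturality f ≪≫
    whiskerLeftIso (ι.app ⟨(x.as, j)⟩) (C.mapId ⟨j⟩)
  naturality_naturality η := coh_slice_cocone_nat (map₂_self C _)
    ((pullTrans (CategoryTheory.Prod.sectL I j) ι).naturality_naturality η)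
  naturality_id x := coh_slice_cocone_id (map₂_mapId C _ _)
    ((pullTrans (CategoryTheory.Prod.sectL I j) ι).naturality_id x)
  naturality_comp f g := coh_slice_cocone (C.mapId ⟨j⟩) (by exact map₂_mapComp_id C (x := ⟨j⟩) _ _)
    ((pullTrans (CategoryTheory.Prod.sectL I j) ι).naturality_comp f g)

/-- A `2`-natural transformation `D(i) ⟶ a(i, j)` restricts, for fixed `i`, to a `2`-natural
transformation from the category `D(i)` to `a(i, ·)`. -/
abbrev rowCone {D : Diagram I} (π : ofFst D ⟶ a) (i : I) : const J (D.obj ⟨i⟩) ⟶ row a i where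
  app y := π.app ⟨(i, y.as)⟩
  naturality {_ y} f := (whiskerRightIso (D.mapId ⟨i⟩) (π.app ⟨(i, y.as)⟩)).symm ≪≫
    (pullTrans (CategoryTheory.Prod.sectR i J) π).naturality f
  naturality_naturality η := coh_slice_cone_nat (map₂_self D _)
    ((pullTrans (CategoryTheory.Prod.sectR i J) π).naturality_naturality η)
  naturality_id y := coh_slice_cone_id (map₂_mapId D _ _)
    ((pullTrans (CategoryTheory.Prod.sectR i J) π).naturality_id y)
  naturality_comp f g := coh_slice_cone (D.mapId ⟨i⟩) (by exact map₂_mapComp_id D (x := ⟨i⟩) _ _)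
    ((pullTrans (CategoryTheory.Prod.sectR i J) π).naturality_comp f g)

end Slice

/-- The objects `2-colim_i 2-lim_j a(i, j)` and `2-lim_j 2-colim_i a(i, j)`: a choice of the
`2`-colimits and `2`-limits, with their universal `2`-natural transformations, for a `2`-functor
`a` on `I × J` (the limits being those of `2`-functors on `J`, which is the opposite of the
indexing category). -/
structure IteratedLimits {I J : Type u} [SmallCategory I] [SmallCategory J]
    (a : Diagram (I × J)) where
  /-- the `2`-functor `j ↦ 2-colim_i a(i, j)` -/
  colim : Diagram J
  /-- the universal transformation `a(i, j) ⟶ 2-colim_i a(i, j)`, `2`-natural in `i` and `j` -/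
  ι : a ⟶ ofSnd colim
  isTwoColimit_ι (j : J) : IsTwoColimit (colCocone ι j)
  /-- the `2`-functor `i ↦ 2-lim_j a(i, j)` -/
  lim : Diagram I
  /-- the universal transformation `2-lim_j a(i, j) ⟶ a(i, j)`, `2`-natural in `i` and `j` -/
  π : ofFst lim ⟶ a
  isTwoLimit_π (i : I) : IsTwoLimit (rowCone π i)
  /-- the category `2-colim_i 2-lim_j a(i, j)` -/
  colimLim : Cat.{u, u}
  /-- the universal transformation `2-lim_j a(i, j) ⟶ 2-colim_i 2-lim_j a(i, j)` -/
  p : lim ⟶ const I colimLim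
  isTwoColimit_p : IsTwoColimit p
  /-- the category `2-lim_j 2-colim_i a(i, j)` -/
  limColim : Cat.{u, u}
  /-- the universal transformation `2-lim_j 2-colim_i a(i, j) ⟶ 2-colim_i a(i, j)` -/
  q : const J limColim ⟶ colim
  isTwoLimit_q : IsTwoLimit q

namespace IteratedLimits

variable {I J : Type u} [SmallCategory I] [SmallCategory J] {a : Diagram (I × J)}
  (L : IteratedLimits a)

/-- The composites `2-lim_j a(i, j) ⟶ a(i, j) ⟶ 2-colim_i a(i, j)`, as a `2`-natural
transformation in `(i, j)`. -/
abbrev canonical : ofFst L.lim ⟶ ofSnd L.colim := L.π ≫ L.ι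

/-- The composites
`2-lim_j a(i, j) ⟶ 2-colim_i 2-lim_j a(i, j) ⟶ 2-lim_j 2-colim_i a(i, j) ⟶ 2-colim_i a(i, j)`
with middle functor `Ψ`, as a `2`-natural transformation in `(i, j)`. -/
abbrev through (Ψ : L.colimLim ⟶ L.limColim) : ofFst L.lim ⟶ ofSnd L.colim :=
  pullCocone (CategoryTheory.Prod.fst I J) L.p ≫ constMap (I × J) Ψ ≫
    pullCone (CategoryTheory.Prod.snd I J) L.q

/-- `Ψ` is the natural functor defined by the canonical composites: it induces them up to an
invertible modification. -/
def IsComparison (Ψ : L.colimLim ⟶ L.limColim) : Prop :=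
  Nonempty (L.canonical ≅ L.through Ψ)

end IteratedLimits

end TwoLim

/-! A pseudofunctor is handled through its Grothendieck construction `Tot`, in which every morphism
is a cocartesian morphism `cart` followed by a vertical one `vert`. Coherence identities become
ordinary equations between composites, proved by cancelling cocartesian morphisms. In these terms
both universal objects are explicit. Cocones with vertex `X` are functors `Tot ⥤ X` inverting the
class `W` of cocartesian morphisms, so a 2-colimit is a localization of `Tot` at `W`
(`isTwoColimit_of_isLocalization`, `IsTwoColimit.isLocalization`). Cones with vertex `X` are
functors from `X` to the category `Desc` of descent data, so a 2-limit is a category that its cone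
identifies with `Desc` (`isTwoLimit_iff_isEquivalence`).

Over a filtered base, `W` has a left calculus of fractions, so the localization satisfies the
elementary conditions of `Fam.IsColim`: objects come from some stage, morphisms between objects of
one stage are realised at a later stage, and morphisms with equal images agree at a later stage. A
functor compatible with two such presentations of one family is an equivalence
(`Fam.IsColim.isEquivalence`).

With `K = Jᵒᵖ`, a transformation from `D(i)` to `C(k)` induces a functor from the total category of
`D` to the descent data of `C`. This functor inverts `W`, and two transformations are isomorphic
exactly when their functors are (`toDesc_iso_of_iso`, `iso_of_toDesc_iso`). Let `T` be the functor
of the canonical composites. Then `Ψ` is a comparison functor exactly when `toTot p ⋙ Ψ ⋙ toDesc q ≅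
T`. Existence and uniqueness follow, since `toTot p` is universal among functors inverting `W` and
`toDesc q` is an equivalence. For the equivalence, `T` itself satisfies `Fam.IsColim`
(`isColim_toDesc`). A descent datum in the colimits consists of finitely many objects and morphisms,
subject to finitely many equations and invertibility conditions, so it lifts to a descent datum of
`a(i, ·)` for a single `i`, that is, to an object of the limit. Morphisms and equalities are treated
in the same way. Since `toTot p` presents the colimit of the same family, `Ψ ⋙ toDesc q`, and
therefore `Ψ`, is an equivalence.

Existence of the iterated data needs functoriality in the remaining variable. The total categories
of the columns, and the descent categories of the rows, are fibres of an `Opfibration`; transition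
functors and coherence come from cocartesian universality, and the columns are then localized
fibrewise (`Fam.localize`). -/

namespace TwoLim

/-! ### Families of categories and their total category -/

/-- A `2`-functor from a category `K` to small categories, spelled out in terms of objects and
morphisms of the categories. -/
structure Fam (K : Type u) [SmallCategory K] where
  obj : K → Type u
  [cat : ∀ k, SmallCategory (obj k)]
  tr {k l : K} (f : k ⟶ l) : obj k ⥤ obj l
  -- The constraints are indexed by every `f` equal to an identity and every `h` equal to a
  -- composite, so that no transport along equations between arrows of `K` is needed later.
  unit {k : K} (f : k ⟶ k) (hf : f = 𝟙 k) (x : obj k) : (tr f).obj x ≅ x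
  mul {k l m : K} (f : k ⟶ l) (g : l ⟶ m) (h : k ⟶ m) (e : f ≫ g = h) (x : obj k) :
    (tr h).obj x ≅ (tr g).obj ((tr f).obj x)
  unit_naturality {k : K} (f : k ⟶ k) (hf : f = 𝟙 k) {x y : obj k} (φ : x ⟶ y) :
    (tr f).map φ ≫ (unit f hf y).hom = (unit f hf x).hom ≫ φ
  mul_naturality {k l m : K} (f : k ⟶ l) (g : l ⟶ m) (h : k ⟶ m) (e : f ≫ g = h) {x y : obj k}
    (φ : x ⟶ y) : (tr h).map φ ≫ (mul f g h e y).hom =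
      (mul f g h e x).hom ≫ (tr g).map ((tr f).map φ)
  unit_mul {k l : K} (e : k ⟶ k) (he : e = 𝟙 k) (f : k ⟶ l) (h : e ≫ f = f) (x : obj k) :
    (mul e f f h x).hom ≫ (tr f).map (unit e he x).hom = 𝟙 _
  mul_unit {k l : K} (f : k ⟶ l) (e : l ⟶ l) (he : e = 𝟙 l) (h : f ≫ e = f) (x : obj k) :
    (mul f e f h x).hom ≫ (unit e he ((tr f).obj x)).hom = 𝟙 _
  mul_assoc {k l m n : K} (f : k ⟶ l) (g : l ⟶ m) (h : m ⟶ n) (fg : k ⟶ m) (gh : l ⟶ n)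
    (fgh : k ⟶ n) (e : f ≫ g = fg) (e' : g ≫ h = gh) (e₁ : fg ≫ h = fgh) (e₂ : f ≫ gh = fgh)
    (x : obj k) : (mul fg h fgh e₁ x).hom ≫ (tr h).map (mul f g fg e x).hom =
      (mul f gh fgh e₂ x).hom ≫ (mul g h gh e' ((tr f).obj x)).hom

attribute [instance] Fam.cat

namespace Fam

variable {K : Type u} [SmallCategory K] (A : Fam K)

/-- The total category (Grothendieck construction). -/
structure Tot where
  base : K
  fib : A.obj base

variable {A}

/-- Morphisms of the total category. -/
structure TotHom (X Y : A.Tot) where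
  base : X.base ⟶ Y.base
  fib : (A.tr base).obj X.fib ⟶ Y.fib

instance : CategoryStruct A.Tot where
  Hom X Y := TotHom X Y
  id X := ⟨𝟙 _, (A.unit _ rfl X.fib).hom⟩
  comp {X _ _} p q := ⟨p.base ≫ q.base,
    (A.mul _ _ _ rfl X.fib).hom ≫ (A.tr q.base).map p.fib ≫ q.fib⟩

/-- The morphism of the total category with given components. -/
abbrev homMk {k l : K} {x : A.obj k} {y : A.obj l} (f : k ⟶ l) (φ : (A.tr f).obj x ⟶ y) :
    (⟨k, x⟩ : A.Tot) ⟶ ⟨l, y⟩ := TotHom.mk f φ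

theorem homMk_comp {k l m : K} {x : A.obj k} {y : A.obj l} {z : A.obj m} (f : k ⟶ l)
    (φ : (A.tr f).obj x ⟶ y) (g : l ⟶ m) (ψ : (A.tr g).obj y ⟶ z) (h : k ⟶ m) (e : f ≫ g = h) :
    homMk f φ ≫ homMk g ψ = homMk h ((A.mul f g h e x).hom ≫ (A.tr g).map φ ≫ ψ) := by
  subst e
  rfl

theorem id_eq {k : K} (x : A.obj k) (e : k ⟶ k) (he : e = 𝟙 k) :
    𝟙 (⟨k, x⟩ : A.Tot) = homMk e (A.unit e he x).hom := by
  subst he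
  rfl

/-- The coherence laws of a family are exactly what is needed: `unit_mul` gives the left unit law,
`mul_unit` with naturality of `unit` the right one, and `mul_assoc` with naturality of `mul`
associativity. -/
instance : Category A.Tot where
  id_comp := by
    rintro ⟨k, x⟩ ⟨l, y⟩ ⟨f, φ⟩
    rw [id_eq x _ rfl]
    refine (homMk_comp _ _ _ _ f (Category.id_comp f)).trans ?_
    rw [← Category.assoc, A.unit_mul, Category.id_comp]
  comp_id := by
    rintro ⟨k, x⟩ ⟨l, y⟩ ⟨f, φ⟩
    rw [id_eq y _ rfl]
    refine (homMk_comp _ _ _ _ f (Category.comp_id f)).trans ?_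
    rw [A.unit_naturality, ← Category.assoc, A.mul_unit, Category.id_comp]
  assoc := by
    rintro ⟨k, x⟩ ⟨l, y⟩ ⟨m, z⟩ ⟨n, w⟩ ⟨f, φ⟩ ⟨g, ψ⟩ ⟨h, χ⟩
    rw [homMk_comp f φ g ψ _ rfl, homMk_comp g ψ h χ _ rfl,
      homMk_comp _ _ h χ _ rfl, homMk_comp f φ (g ≫ h) _ _ (Category.assoc _ _ _).symm]
    congr 1
    simp only [Functor.map_comp, Category.assoc]
    rw [reassoc_of% A.mul_naturality g h _ rfl φ, reassoc_of% A.mul_assoc _ _ _ _ _ _ rfl rfl rfl (Category.assoc _ _ _).symm]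

theorem homMk_injective {k l : K} {x : A.obj k} {y : A.obj l} {f : k ⟶ l}
    {φ ψ : (A.tr f).obj x ⟶ y} (h : homMk f φ = homMk f ψ) : φ = ψ := by
  cases h
  rfl

theorem base_comp {X Y Z : A.Tot} (p : X ⟶ Y) (q : Y ⟶ Z) : (p ≫ q).base = p.base ≫ q.base := rfl

/-- The cocartesian morphism over `f` with source `x`. -/
def cart {k l : K} (f : k ⟶ l) (x : A.obj k) : (⟨k, x⟩ : A.Tot) ⟶ ⟨l, (A.tr f).obj x⟩ :=
  homMk f (𝟙 _)

/-- The morphism of the total category given by a morphism of a fibre. -/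
def vert {k : K} {x y : A.obj k} (φ : x ⟶ y) : (⟨k, x⟩ : A.Tot) ⟶ ⟨k, y⟩ :=
  homMk (𝟙 k) ((A.unit _ rfl x).hom ≫ φ)

theorem base_vert {k : K} {x y : A.obj k} (φ : x ⟶ y) : (vert φ).base = 𝟙 k := rfl

@[simp]
theorem vert_id {k : K} (x : A.obj k) : vert (𝟙 x) = 𝟙 (⟨k, x⟩ : A.Tot) := by
  rw [vert, Category.comp_id]
  rfl

theorem homMk_vert {k l : K} {x : A.obj k} {y z : A.obj l} (f : k ⟶ l)
    (φ : (A.tr f).obj x ⟶ y) (ψ : y ⟶ z) : homMk f φ ≫ vert ψ = homMk f (φ ≫ ψ) := by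
  rw [vert, homMk_comp _ _ _ _ f (Category.comp_id f), reassoc_of% A.unit_naturality,
    ← Category.assoc, A.mul_unit, Category.id_comp]

theorem homMk_eq {k l : K} {x : A.obj k} {y : A.obj l} (f : k ⟶ l)
    (φ : (A.tr f).obj x ⟶ y) : homMk f φ = cart f x ≫ vert φ := by
  rw [cart, homMk_vert, Category.id_comp]

theorem hom_eq {X Y : A.Tot} (p : X ⟶ Y) : p = cart p.base X.fib ≫ vert p.fib := homMk_eq _ _

@[simp]
theorem vert_comp {k : K} {x y z : A.obj k} (φ : x ⟶ y) (ψ : y ⟶ z) :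
    vert (φ ≫ ψ) = vert φ ≫ vert ψ := by
  conv_rhs => rw [vert, homMk_vert]
  rw [vert, Category.assoc]

/-- This characterises `(A.tr f).map φ` inside the total category, and lets vertical morphisms be
moved past cocartesian ones. -/
theorem vert_cart {k l : K} {x y : A.obj k} (φ : x ⟶ y) (f : k ⟶ l) :
    vert φ ≫ cart f y = cart f x ≫ vert ((A.tr f).map φ) := by
  rw [cart, vert, homMk_comp _ _ _ _ f (Category.id_comp f), ← homMk_eq, Functor.map_comp,
    Category.comp_id, ← Category.assoc, A.unit_mul, Category.id_comp]

theorem vert_cart_assoc {k l : K} {x y : A.obj k} (φ : x ⟶ y) (f : k ⟶ l) {Z : A.Tot}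
    (h : ⟨l, (A.tr f).obj y⟩ ⟶ Z) :
    vert φ ≫ cart f y ≫ h = cart f x ≫ vert ((A.tr f).map φ) ≫ h := by
  rw [reassoc_of% vert_cart]

/-- Fibres embed faithfully, so equations in a fibre may be checked in the total category. -/
theorem vert_injective {k : K} {x y : A.obj k} {φ ψ : x ⟶ y} (h : vert φ = vert ψ) :
    φ = ψ := (cancel_epi (A.unit _ rfl x).hom).1 (homMk_injective h)

theorem cart_vert_cancel {k l : K} {x : A.obj k} {y : A.obj l} {f : k ⟶ l}
    {φ ψ : (A.tr f).obj x ⟶ y} (h : cart f x ≫ vert φ = cart f x ≫ vert ψ) : φ = ψ := by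
  rw [← homMk_eq, ← homMk_eq] at h
  exact homMk_injective h

/-- The characterisation of the constraint `mul`: it compares the cocartesian lift of a composite
with the composite of cocartesian lifts. -/
theorem cart_mul {k l m : K} (f : k ⟶ l) (g : l ⟶ m) (h : k ⟶ m) (e : f ≫ g = h) (x : A.obj k) :
    cart h x ≫ vert (A.mul f g h e x).hom = cart f x ≫ cart g _ := by
  rw [← homMk_eq, cart, cart, homMk_comp _ _ _ _ h e]
  simp

theorem cart_mul_assoc {k l m : K} (f : k ⟶ l) (g : l ⟶ m) (h : k ⟶ m) (e : f ≫ g = h)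
    (x : A.obj k) {Z : A.Tot} (q : ⟨m, _⟩ ⟶ Z) :
    cart h x ≫ vert (A.mul f g h e x).hom ≫ q = cart f x ≫ cart g _ ≫ q := by
  rw [reassoc_of% cart_mul]

theorem cart_mul_inv {k l m : K} (f : k ⟶ l) (g : l ⟶ m) (h : k ⟶ m) (e : f ≫ g = h)
    (x : A.obj k) : cart f x ≫ cart g _ ≫ vert (A.mul f g h e x).inv = cart h x := by
  rw [← cart_mul_assoc f g h e, ← vert_comp, Iso.hom_inv_id, vert_id, Category.comp_id]

theorem cart_mul_inv_assoc {k l m : K} (f : k ⟶ l) (g : l ⟶ m) (h : k ⟶ m) (e : f ≫ g = h)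
    (x : A.obj k) {Z : A.Tot} (q : ⟨m, _⟩ ⟶ Z) :
    cart f x ≫ cart g _ ≫ vert (A.mul f g h e x).inv ≫ q = cart h x ≫ q := by
  rw [← cart_mul_inv f g h e]
  simp only [Category.assoc]

theorem cart_unit {k : K} (e : k ⟶ k) (he : e = 𝟙 k) (x : A.obj k) :
    cart e x ≫ vert (A.unit e he x).hom = 𝟙 (⟨k, x⟩ : A.Tot) := by
  rw [← homMk_eq, id_eq]

theorem cart_unit_assoc {k : K} (e : k ⟶ k) (he : e = 𝟙 k) (x : A.obj k) {Z : A.Tot}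
    (q : ⟨k, x⟩ ⟶ Z) : cart e x ≫ vert (A.unit e he x).hom ≫ q = q := by
  rw [reassoc_of% cart_unit]

/-- The transition along an identity is only isomorphic to the identity, so the lift of an identity
is a vertical isomorphism rather than an identity. -/
theorem cart_eq_unit {k : K} (e : k ⟶ k) (he : e = 𝟙 k) (x : A.obj k) :
    cart e x = vert (A.unit e he x).inv := by
  have h := cart_unit_assoc e he x (vert (A.unit e he x).inv)
  rwa [← vert_comp, Iso.hom_inv_id, vert_id, Category.comp_id] at h

/-- Two morphisms out of the target of a cocartesian morphism agree if they have the same base and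
agree after composition with it. -/
theorem cart_cancel {k : K} {X Y : A.Tot} (f : X.base ⟶ k) {p q : (⟨k, (A.tr f).obj X.fib⟩ : A.Tot) ⟶ Y}
    (hb : p.base = q.base) (h : cart f X.fib ≫ p = cart f X.fib ≫ q) : p = q := by
  obtain ⟨l, y⟩ := Y
  obtain ⟨g, φ⟩ := p
  obtain ⟨g', ψ⟩ := q
  obtain rfl : g = g' := hb
  have h' : cart f X.fib ≫ homMk g φ = cart f X.fib ≫ homMk g ψ := h
  rw [homMk_eq, homMk_eq, ← cart_mul_assoc f g _ rfl, ← cart_mul_assoc f g _ rfl, ← vert_comp,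
    ← vert_comp] at h'
  have := (cancel_epi _).1 (cart_vert_cancel h')
  subst this
  rfl

/-- A morphism over a composite factors through a cocartesian morphism over the first factor. -/
theorem exists_cart_fac {X Y : A.Tot} (p : X ⟶ Y) {k : K} (f : X.base ⟶ k) (g : k ⟶ Y.base)
    (e : f ≫ g = p.base) : ∃ φ : (A.tr g).obj ((A.tr f).obj X.fib) ⟶ Y.fib,
      cart f X.fib ≫ cart g _ ≫ vert φ = p := by
  refine ⟨(A.mul f g _ e X.fib).inv ≫ p.fib, ?_⟩
  rw [vert_comp, cart_mul_inv_assoc, ← hom_eq]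

variable (A) in
/-- The class of cocartesian morphisms. -/
def W : MorphismProperty A.Tot := fun _ _ p => IsIso p.fib

theorem W_cart {k l : K} (f : k ⟶ l) (x : A.obj k) : A.W (cart f x) := by
  change IsIso (𝟙 _)
  infer_instance

theorem W_homMk {k l : K} {x : A.obj k} {y : A.obj l} (f : k ⟶ l)
    (φ : (A.tr f).obj x ⟶ y) [h : IsIso φ] : A.W (homMk f φ) := h

theorem W_vert {k : K} {x y : A.obj k} (φ : x ⟶ y) [IsIso φ] : A.W (vert φ) := by
  change IsIso ((A.unit _ rfl x).hom ≫ φ)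
  exact IsIso.comp_isIso

instance isIso_vert {k : K} {x y : A.obj k} (φ : x ⟶ y) [IsIso φ] : IsIso (vert φ) :=
  ⟨vert (inv φ), by rw [← vert_comp, IsIso.hom_inv_id, vert_id],
    by rw [← vert_comp, IsIso.inv_hom_id, vert_id]⟩

instance : A.W.IsMultiplicative where
  id_mem X := by
    change IsIso (A.unit _ _ _).hom
    infer_instance
  comp_mem {X Y Z} p q hp hq := by
    have : IsIso p.fib := hp
    have : IsIso q.fib := hq
    change IsIso ((A.mul _ _ _ _ _).hom ≫ (A.tr q.base).map p.fib ≫ q.fib)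
    infer_instance

/-- The functor out of the total category given by functors on the fibres and their values on
cocartesian morphisms. -/
@[simps obj]
def Tot.desc {E : Type*} [Category* E] (o : ∀ k, A.obj k ⥤ E)
    (N : ∀ {k l : K} (f : k ⟶ l) (x : A.obj k), (o k).obj x ⟶ (o l).obj ((A.tr f).obj x))
    (hN : ∀ {k l : K} (f : k ⟶ l) {x y : A.obj k} (φ : x ⟶ y),
      (o k).map φ ≫ N f y = N f x ≫ (o l).map ((A.tr f).map φ))
    (hid : ∀ {k : K} (x : A.obj k), N (𝟙 k) x ≫ (o k).map (A.unit _ rfl x).hom = 𝟙 _)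
    (hcomp : ∀ {k l m : K} (f : k ⟶ l) (g : l ⟶ m) (x : A.obj k),
      N (f ≫ g) x ≫ (o m).map (A.mul f g _ rfl x).hom = N f x ≫ N g _) : A.Tot ⥤ E where
  obj X := (o X.base).obj X.fib
  map {X Y} p := N p.base X.fib ≫ (o Y.base).map p.fib
  map_id X := hid X.fib
  map_comp {X Y Z} p q := by
    change N (p.base ≫ q.base) _ ≫ (o Z.base).map ((A.mul _ _ _ _ _).hom ≫
      (A.tr q.base).map p.fib ≫ q.fib) = _
    rw [Functor.map_comp, reassoc_of% hcomp, Functor.map_comp, Category.assoc, reassoc_of% hN]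

section desc

variable {E : Type*} [Category* E] (o : ∀ k, A.obj k ⥤ E)
    (N : ∀ {k l : K} (f : k ⟶ l) (x : A.obj k), (o k).obj x ⟶ (o l).obj ((A.tr f).obj x))
    (hN : ∀ {k l : K} (f : k ⟶ l) {x y : A.obj k} (φ : x ⟶ y),
      (o k).map φ ≫ N f y = N f x ≫ (o l).map ((A.tr f).map φ))
    (hid : ∀ {k : K} (x : A.obj k), N (𝟙 k) x ≫ (o k).map (A.unit _ rfl x).hom = 𝟙 _)
    (hcomp : ∀ {k l m : K} (f : k ⟶ l) (g : l ⟶ m) (x : A.obj k),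
      N (f ≫ g) x ≫ (o m).map (A.mul f g _ rfl x).hom = N f x ≫ N g _)

@[simp]
theorem Tot.desc_map_cart {k l : K} (f : k ⟶ l) (x : A.obj k) :
    (Tot.desc o N hN hid hcomp).map (cart f x) = N f x := by
  change N f x ≫ (o l).map (𝟙 _) = _
  rw [CategoryTheory.Functor.map_id, Category.comp_id]

@[simp]
theorem Tot.desc_map_vert {k : K} {x y : A.obj k} (φ : x ⟶ y) :
    (Tot.desc o N hN hid hcomp).map (vert φ) = (o k).map φ := by
  change N (𝟙 k) x ≫ (o k).map (_ ≫ φ) = _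
  rw [Functor.map_comp, ← Category.assoc, hid, Category.id_comp]

end desc

/-- Restriction along a functor. -/
@[reducible]
def pull {L : Type u} [SmallCategory L] (S : L ⥤ K) (A : Fam K) : Fam L where
  obj l := A.obj (S.obj l)
  tr f := A.tr (S.map f)
  unit f hf x := A.unit (S.map f) (by rw [hf, S.map_id]) x
  mul f g h e x := A.mul (S.map f) (S.map g) (S.map h) (by rw [← e, S.map_comp]) x
  unit_naturality f hf _ _ φ := A.unit_naturality _ _ φ
  mul_naturality f g h e _ _ φ := A.mul_naturality _ _ _ _ φ
  unit_mul e he f h x := A.unit_mul _ _ _ _ x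
  mul_unit f e he h x := A.mul_unit _ _ _ _ x
  mul_assoc f g h fg gh fgh e e' e₁ e₂ x := A.mul_assoc _ _ _ _ _ _ _ _ _ _ x

/-- The projection of total categories for a restriction along a functor. -/
def pullTot {L : Type u} [SmallCategory L] (S : L ⥤ K) (A : Fam K) : (pull S A).Tot ⥤ A.Tot where
  obj X := ⟨S.obj X.base, X.fib⟩
  map p := homMk (S.map p.base) p.fib
  map_id _ := (id_eq _ _ (S.map_id _)).symm
  map_comp _ _ := (homMk_comp _ _ _ _ _ (S.map_comp _ _).symm).symm

/-- The base of the image is `S.map (𝟙 l)`, an identity only propositionally; the discrepancy is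
absorbed by `cart_unit_assoc`. -/
theorem pullTot_map_vert {L : Type u} [SmallCategory L] (S : L ⥤ K) {l : L}
    {x y : A.obj (S.obj l)} (φ : x ⟶ y) :
    (pullTot S A).map (vert (A := pull S A) φ) = vert φ := by
  have h : homMk (S.map (𝟙 l)) ((A.unit _ (S.map_id l) x).hom ≫ φ) = vert φ := by
    rw [homMk_eq, vert_comp, cart_unit_assoc]
  exact h

end Fam

end TwoLim

/-! ### Transformations of families and descent data -/

namespace TwoLim

namespace Fam

variable {K : Type u} [SmallCategory K]

/-- `2`-natural transformations, in terms of objects and morphisms. -/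
structure Trans (A B : Fam K) where
  ap (k : K) : A.obj k ⥤ B.obj k
  nat {k l : K} (f : k ⟶ l) (x : A.obj k) :
    (ap l).obj ((A.tr f).obj x) ≅ (B.tr f).obj ((ap k).obj x)
  naturality {k l : K} (f : k ⟶ l) {x y : A.obj k} (φ : x ⟶ y) :
    (ap l).map ((A.tr f).map φ) ≫ (nat f y).hom = (nat f x).hom ≫ (B.tr f).map ((ap k).map φ)
  nat_unit {k : K} (e : k ⟶ k) (he : e = 𝟙 k) (x : A.obj k) :
    (nat e x).hom ≫ (B.unit e he ((ap k).obj x)).hom = (ap k).map (A.unit e he x).hom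
  nat_mul {k l m : K} (f : k ⟶ l) (g : l ⟶ m) (h : k ⟶ m) (e : f ≫ g = h) (x : A.obj k) :
    (nat h x).hom ≫ (B.mul f g h e ((ap k).obj x)).hom = (ap m).map (A.mul f g h e x).hom ≫
      (nat g ((A.tr f).obj x)).hom ≫ (B.tr g).map (nat f x).hom

variable {A B : Fam K} (t : Trans A B)

/-- The comparison of the image of a cocartesian morphism with a cocartesian morphism. -/
def Trans.N {k l : K} (f : k ⟶ l) (x : A.obj k) :
    (⟨k, (t.ap k).obj x⟩ : B.Tot) ⟶ ⟨l, (t.ap l).obj ((A.tr f).obj x)⟩ :=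
  homMk f (t.nat f x).inv

theorem Trans.N_eq {k l : K} (f : k ⟶ l) (x : A.obj k) :
    t.N f x = cart f _ ≫ vert (t.nat f x).inv := homMk_eq _ _

theorem Trans.N_hom {k l : K} (f : k ⟶ l) (x : A.obj k) :
    t.N f x ≫ vert (t.nat f x).hom = cart f _ := by
  rw [Trans.N, homMk_vert, Iso.inv_hom_id, cart]

theorem Trans.N_naturality {k l : K} (f : k ⟶ l) {x y : A.obj k} (φ : x ⟶ y) :
    vert ((t.ap k).map φ) ≫ t.N f y = t.N f x ≫ vert ((t.ap l).map ((A.tr f).map φ)) := by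
  rw [N_eq, vert_cart_assoc, ← vert_comp, N_eq, Category.assoc, ← vert_comp]
  congr 2
  rw [Iso.eq_inv_comp, ← Category.assoc, Iso.comp_inv_eq]
  exact (t.naturality f φ).symm

/-- Passing to the inverse constraint makes `N` a morphism of the total category lying over `f`. The
two axioms of a transformation then become the identity and composition laws of `Trans.tot`. -/
theorem Trans.N_unit {k : K} (e : k ⟶ k) (he : e = 𝟙 k) (x : A.obj k) :
    t.N e x ≫ vert ((t.ap k).map (A.unit e he x).hom) = 𝟙 _ := by
  rw [← t.nat_unit, vert_comp, ← Category.assoc, N_hom, cart_unit]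

theorem Trans.N_mul {k l m : K} (f : k ⟶ l) (g : l ⟶ m) (h : k ⟶ m) (e : f ≫ g = h)
    (x : A.obj k) : t.N h x ≫ vert ((t.ap m).map (A.mul f g h e x).hom) = t.N f x ≫ t.N g _ := by
  have h1 : (t.ap m).map (A.mul f g h e x).hom = (t.nat h x).hom ≫ (B.mul f g h e _).hom ≫
      (B.tr g).map (t.nat f x).inv ≫ (t.nat g _).inv := by
    rw [reassoc_of% t.nat_mul, ← Functor.map_comp_assoc, Iso.hom_inv_id]
    simp
  rw [h1, vert_comp, ← Category.assoc, N_hom, vert_comp, cart_mul_assoc, N_eq, N_eq, vert_comp,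
    Category.assoc, vert_cart_assoc]

/-- The functor between total categories induced by a `2`-natural transformation. -/
def Trans.tot : A.Tot ⥤ B.Tot where
  obj X := ⟨X.base, (t.ap _).obj X.fib⟩
  map p := homMk p.base ((t.nat _ _).inv ≫ (t.ap _).map p.fib)
  map_id X := by
    rw [← homMk_vert]
    exact t.N_unit _ rfl _
  map_comp {X Y Z} p q := by
    rw [← homMk_vert, ← homMk_vert, ← homMk_vert]
    change t.N (p.base ≫ q.base) X.fib ≫ vert ((t.ap Z.base).map
      ((A.mul _ _ _ rfl _).hom ≫ (A.tr q.base).map p.fib ≫ q.fib)) =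
      (t.N p.base X.fib ≫ vert ((t.ap Y.base).map p.fib)) ≫
        t.N q.base Y.fib ≫ vert ((t.ap Z.base).map q.fib)
    rw [Functor.map_comp, Functor.map_comp, vert_comp, vert_comp, ← Category.assoc, t.N_mul,
      Category.assoc, Category.assoc, ← Category.assoc (vert _) (t.N _ _), t.N_naturality,
      Category.assoc]

theorem Trans.tot_map_cart {k l : K} (f : k ⟶ l) (x : A.obj k) :
    t.tot.map (cart f x) = t.N f x := by
  change homMk f ((t.nat _ _).inv ≫ (t.ap _).map (𝟙 _)) = _
  rw [CategoryTheory.Functor.map_id, Category.comp_id]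
  rfl

theorem Trans.tot_map_vert {k : K} {x y : A.obj k} (φ : x ⟶ y) :
    t.tot.map (vert φ) = vert ((t.ap k).map φ) := by
  change homMk (𝟙 k) ((t.nat _ _).inv ≫ (t.ap _).map ((A.unit _ rfl x).hom ≫ φ)) = _
  rw [← homMk_vert]
  change t.N _ _ ≫ _ = _
  rw [Functor.map_comp, vert_comp, ← Category.assoc, t.N_unit, Category.id_comp]

/-- Descent data: the objects of the explicit `2`-limit. -/
structure Desc (A : Fam K) where
  obj (k : K) : A.obj k
  θ {k l : K} (g : k ⟶ l) : (A.tr g).obj (obj k) ⟶ obj l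
  isIso {k l : K} (g : k ⟶ l) : IsIso (θ g)
  -- The cocycle conditions are stated in the total category: together with `isIso` they say that
  -- the data form a cocartesian section over `K`.
  id (k : K) : homMk (𝟙 k) (θ (𝟙 k)) = 𝟙 (⟨k, obj k⟩ : A.Tot)
  comp {k l m : K} (g : k ⟶ l) (h : l ⟶ m) :
    homMk (g ≫ h) (θ (g ≫ h)) = homMk g (θ g) ≫ homMk h (θ h)

attribute [instance] Desc.isIso

namespace Desc

/-- The structure morphisms of a descent datum, in the total category. -/
def mor (c : Desc A) {k l : K} (g : k ⟶ l) : (⟨k, c.obj k⟩ : A.Tot) ⟶ ⟨l, c.obj l⟩ :=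
  homMk g (c.θ g)

theorem mor_eq (c : Desc A) {k l : K} (g : k ⟶ l) :
    c.mor g = cart g _ ≫ vert (c.θ g) := homMk_eq _ _

theorem mor_id (c : Desc A) (k : K) : c.mor (𝟙 k) = 𝟙 _ := c.id k

theorem mor_comp (c : Desc A) {k l m : K} (g : k ⟶ l) (h : l ⟶ m) :
    c.mor (g ≫ h) = c.mor g ≫ c.mor h := c.comp g h

/-- Morphisms of descent data. -/
@[ext]
structure Hom (c d : Desc A) where
  app (k : K) : c.obj k ⟶ d.obj k
  comm {k l : K} (g : k ⟶ l) : c.mor g ≫ vert (app l) = vert (app k) ≫ d.mor g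

instance : Category (Desc A) where
  Hom := Hom
  id c := ⟨fun _ => 𝟙 _, fun _ => by simp⟩
  comp p q := ⟨fun k => p.app k ≫ q.app k, fun g => by
    rw [vert_comp, vert_comp, reassoc_of% p.comm, q.comm, Category.assoc]⟩
  id_comp _ := Hom.ext (funext fun _ => Category.id_comp _)
  comp_id _ := Hom.ext (funext fun _ => Category.comp_id _)
  assoc _ _ _ := Hom.ext (funext fun _ => Category.assoc _ _ _)

@[ext]
theorem hom_ext {c d : Desc A} {p q : c ⟶ d} (h : ∀ k, p.app k = q.app k) : p = q :=
  Hom.ext (funext h)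

@[simp]
theorem id_app (c : Desc A) (k : K) : (𝟙 c : c ⟶ c).app k = 𝟙 _ := rfl

@[simp]
theorem comp_app {c d e : Desc A} (p : c ⟶ d) (q : d ⟶ e) (k : K) :
    (p ≫ q).app k = p.app k ≫ q.app k := rfl

/-- The evaluation functors. -/
@[simps]
def ev (k : K) : Desc A ⥤ A.obj k where
  obj c := c.obj k
  map p := p.app k

/-- Isomorphisms of descent data from isomorphisms of the components. -/
@[simps]
def isoMk {c d : Desc A} (e : ∀ k, c.obj k ≅ d.obj k)
    (h : ∀ {k l : K} (g : k ⟶ l), c.mor g ≫ vert (e l).hom = vert (e k).hom ≫ d.mor g) :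
    c ≅ d where
  hom := ⟨fun k => (e k).hom, h⟩
  inv := ⟨fun k => (e k).inv, fun {k l} g => by
    have := congrArg (fun z => vert (e k).inv ≫ z ≫ vert (e l).inv) (h g)
    simp only [Category.assoc, ← vert_comp, Iso.hom_inv_id, vert_id, Category.comp_id] at this
    rw [this, ← Category.assoc, ← vert_comp, Iso.inv_hom_id, vert_id, Category.id_comp]⟩
  hom_inv_id := by ext; simp
  inv_hom_id := by ext; simp

theorem isIso_of_app {c d : Desc A} (p : c ⟶ d) (h : ∀ k, IsIso (p.app k)) : IsIso p := by
  have : p = (isoMk (fun k => asIso (p.app k)) p.comm).hom := rfl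
  rw [this]
  infer_instance

/-- The functor to descent data given by a functor `E × K ⥤ A.Tot` over `K`. -/
@[simps obj_obj obj_θ]
def ofFunctor {E : Type*} [Category* E] (o : E → ∀ k, A.obj k)
    (φ : ∀ {e e' : E} (_ : e ⟶ e') {k l : K} (g : k ⟶ l), (A.tr g).obj (o e k) ⟶ o e' l)
    (hiso : ∀ (e : E) {k l : K} (g : k ⟶ l), IsIso (φ (𝟙 e) g))
    (hid : ∀ e k, homMk (𝟙 k) (φ (𝟙 e) (𝟙 k)) = 𝟙 (⟨k, o e k⟩ : A.Tot))
    (hcomp : ∀ {e e' e'' : E} (p : e ⟶ e') (q : e' ⟶ e'') {k l m : K} (g : k ⟶ l) (h : l ⟶ m),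
      homMk (g ≫ h) (φ (p ≫ q) (g ≫ h)) = homMk g (φ p g) ≫ homMk h (φ q h)) : E ⥤ Desc A where
  obj e :=
    { obj := o e
      θ := φ (𝟙 e)
      isIso := hiso e
      id := hid e
      comp := fun g h => by rw [← hcomp, Category.comp_id] }
  map {e e'} p := ⟨fun k => (A.unit (𝟙 k) rfl _).inv ≫ φ p (𝟙 k), fun {k l} g => by
    -- The factor `unit⁻¹` removes the transition along `𝟙 k` from the source of `φ p (𝟙 k)`. In the
    -- total category the result is the value at `(p, 𝟙 k)`, and commutation with the structure
    -- morphisms is `hcomp` for the two factorisations of `(p, g)`.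
    have hv (k : K) : vert ((A.unit (𝟙 k) rfl _).inv ≫ φ p (𝟙 k)) = homMk (𝟙 k) (φ p (𝟙 k)) := by
      rw [vert_comp, ← cart_eq_unit, ← homMk_eq]
    rw [hv, hv]
    change homMk _ _ ≫ _ = _ ≫ homMk _ _
    rw [← hcomp, ← hcomp, Category.id_comp p, Category.comp_id p]
    have hg : g ≫ 𝟙 l = 𝟙 k ≫ g := by rw [Category.id_comp, Category.comp_id]
    rw [hg]⟩
  map_id e := hom_ext fun k => by
    refine vert_injective ?_
    rw [vert_comp, ← cart_eq_unit, ← homMk_eq, hid]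
    exact (vert_id _).symm
  map_comp {e e' e''} p q := hom_ext fun k => by
    refine vert_injective ?_
    rw [comp_app]
    simp only [vert_comp]
    rw [← cart_eq_unit, ← cart_eq_unit, Category.assoc, ← homMk_eq, ← homMk_eq (𝟙 k) (φ q (𝟙 k)),
      ← Category.assoc, ← homMk_eq, ← hcomp]
    have hk : 𝟙 k ≫ 𝟙 k = 𝟙 k := Category.comp_id _
    rw [hk]

theorem vert_ofFunctor_map_app {E : Type*} [Category* E] (o : E → ∀ k, A.obj k)
    (φ : ∀ {e e' : E} (_ : e ⟶ e') {k l : K} (g : k ⟶ l), (A.tr g).obj (o e k) ⟶ o e' l)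
    (hiso hid hcomp) {e e' : E} (p : e ⟶ e') (k : K) :
    vert (((ofFunctor o φ hiso hid hcomp).map p).app k) = homMk (𝟙 k) (φ p (𝟙 k)) := by
  change vert (x := o e k) (y := o e' k) ((A.unit (𝟙 k) rfl _).inv ≫ φ p (𝟙 k)) = _
  rw [vert_comp, ← cart_eq_unit, ← homMk_eq]

end Desc

end Fam

end TwoLim

/-! ### Dictionary between pseudofunctors and families -/

namespace TwoLim

variable {K : Type u} [SmallCategory K]

theorem toLoc_eq_id {k : K} {f : k ⟶ k} (hf : f = 𝟙 k) : f.toLoc = 𝟙 (⟨k⟩ : LocallyDiscrete K) := by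
  rw [hf]
  rfl

theorem toLoc_comp_eq {k l m : K} {f : k ⟶ l} {g : l ⟶ m} {h : k ⟶ m} (e : f ≫ g = h) :
    f.toLoc ≫ g.toLoc = h.toLoc := by
  rw [← e]
  rfl

/-- A `2`-functor in terms of objects and morphisms. -/
def fam (b : Diagram K) : Fam K where
  obj k := b.obj ⟨k⟩
  tr f := (b.map f.toLoc).toFunctor
  unit f hf x := (Cat.Hom.toNatIso (b.mapId' f.toLoc (toLoc_eq_id hf))).app x
  mul f g h e x := (Cat.Hom.toNatIso (b.mapComp' f.toLoc g.toLoc h.toLoc (toLoc_comp_eq e))).app x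
  unit_naturality f hf _ _ φ := b.mapId'_hom_naturality _ (toLoc_eq_id hf) φ
  mul_naturality f g h e _ _ φ := b.mapComp'_hom_naturality _ _ _ (toLoc_comp_eq e) φ
  unit_mul {k l} e he f h x := by
    subst he
    have h1 := b.mapComp'_id_comp_hom_app f.toLoc x
    have h2 : (b.mapId' (𝟙 (⟨k⟩ : LocallyDiscrete K)) rfl).hom.toNatTrans.app x =
      (b.mapId ⟨k⟩).hom.toNatTrans.app x := by rw [b.mapId'_eq_mapId]
    refine (congrArg₂ (· ≫ ·) h1 (congrArg (b.map f.toLoc).toFunctor.map h2)).trans ?_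
    refine ((b.map f.toLoc).toFunctor.map_comp _ _).symm.trans ?_
    refine (congrArg _ ((Cat.Hom.toNatIso (b.mapId ⟨k⟩)).inv_hom_id_app x)).trans ?_
    exact (b.map f.toLoc).toFunctor.map_id x
  mul_unit {k l} f e he h x := by
    subst he
    have h1 := b.mapComp'_comp_id_hom_app f.toLoc x
    have h2 : (b.mapId' (𝟙 (⟨l⟩ : LocallyDiscrete K)) rfl).hom.toNatTrans.app
      ((b.map f.toLoc).toFunctor.obj x) = (b.mapId ⟨l⟩).hom.toNatTrans.app _ := by
        rw [b.mapId'_eq_mapId]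
    exact (congrArg₂ (· ≫ ·) h1 h2).trans ((Cat.Hom.toNatIso (b.mapId ⟨l⟩)).inv_hom_id_app _)
  mul_assoc f g h fg gh fgh e e' e₁ e₂ x :=
    (b.mapComp'₀₁₃_hom_comp_whiskerLeft_mapComp'_hom_app f.toLoc g.toLoc h.toLoc fg.toLoc gh.toLoc
      fgh.toLoc (toLoc_comp_eq e) (toLoc_comp_eq e') (toLoc_comp_eq e₂) x).symm

/-- At the literal composite the flexible constraint is the original `mapComp`. Laws for an
arbitrary `h` reduce to this case by substituting the equation. -/
theorem fam_mul_hom (b : Diagram K) {k l m : K} (f : k ⟶ l) (g : l ⟶ m) (x : b.obj ⟨k⟩) :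
    ((fam b).mul f g (f ≫ g) rfl x).hom = (b.mapComp f.toLoc g.toLoc).hom.toNatTrans.app x := by
  exact congrArg (fun z => z.hom.toNatTrans.app x) (b.mapComp'_eq_mapComp f.toLoc g.toLoc)

theorem fam_unit_hom (b : Diagram K) {k : K} (x : b.obj ⟨k⟩) :
    ((fam b).unit (𝟙 k) rfl x).hom = (b.mapId ⟨k⟩).hom.toNatTrans.app x := by
  exact congrArg (fun z => z.hom.toNatTrans.app x) (b.mapId'_eq_mapId ⟨k⟩)

/-- A `2`-natural transformation in terms of objects and morphisms. -/
def trans {b c : Diagram K} (σ : b ⟶ c) : (fam b).Trans (fam c) where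
  ap k := (σ.app ⟨k⟩).toFunctor
  nat f x := (Cat.Hom.toNatIso (σ.naturality f.toLoc)).app x
  naturality f _ _ φ := (σ.naturality f.toLoc).hom.toNatTrans.naturality φ
  nat_unit e he x := by
    subst he
    refine (congrArg (_ ≫ ·) (fam_unit_hom c _)).trans ?_
    refine Eq.trans ?_ (congrArg (σ.app ⟨_⟩).toFunctor.map (fam_unit_hom b x)).symm
    have h := congrArg (fun z => z.toNatTrans.app x) (σ.naturality_id ⟨_⟩)
    exact h.trans ((congrArg (_ ≫ ·) (Category.id_comp _)).trans (Category.comp_id _))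
  nat_mul {k l m} f g h e x := by
    subst e
    refine (congrArg (_ ≫ ·) (fam_mul_hom c f g _)).trans ?_
    refine Eq.trans ?_
      (congrArg (· ≫ _) (congrArg (σ.app ⟨_⟩).toFunctor.map (fam_mul_hom b f g x))).symm
    have h := congrArg (fun z => z.toNatTrans.app x) (σ.naturality_comp f.toLoc g.toLoc)
    refine h.trans ?_
    -- The associators of `Cat` have identity components; the remaining lines strip these off.
    refine congrArg (_ ≫ ·) ?_
    refine (Category.id_comp _).trans ?_
    refine congrArg (_ ≫ ·) ?_
    refine (Category.id_comp _).trans ?_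
    exact Category.comp_id _

/-- A `2`-natural transformation from its description in terms of objects and morphisms. -/
def mkTrans {b c : Diagram K} (t : (fam b).Trans (fam c)) : b ⟶ c where
  app k := ⟨t.ap k.as⟩
  naturality f := Cat.Hom.isoMk (C := b.obj _) (D := c.obj _)
    (F := (b.map f).toFunctor ⋙ t.ap _) (G := t.ap _ ⋙ (c.map f).toFunctor)
    (NatIso.ofComponents (fun x => t.nat f.as x) (fun φ => t.naturality f.as φ))
  naturality_naturality {k l f g} η := by
    obtain rfl := LocallyDiscrete.eq_of_hom η
    rw [map₂_self, map₂_self]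
    simp
  naturality_id k := by
    refine Cat.Hom₂.ext (NatTrans.ext (funext fun x => ?_))
    have h := ((congrArg (_ ≫ ·) (fam_unit_hom c _)).symm.trans (t.nat_unit (𝟙 k.as) rfl x)).trans
      (congrArg (t.ap k.as).map (fam_unit_hom b x))
    exact h.trans ((congrArg (_ ≫ ·) (Category.id_comp _)).trans (Category.comp_id _)).symm
  naturality_comp f g := by
    refine Cat.Hom₂.ext (NatTrans.ext (funext fun x => ?_))
    have h := ((congrArg (_ ≫ ·) (fam_mul_hom c f.as g.as _)).symm.trans
      (t.nat_mul f.as g.as _ rfl x)).trans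
      (congrArg (· ≫ _) (congrArg (t.ap _).map (fam_mul_hom b f.as g.as x)))
    refine h.trans ?_
    refine congrArg (_ ≫ ·) (Eq.symm ?_)
    refine (Category.id_comp _).trans ?_
    refine congrArg (_ ≫ ·) ?_
    refine (Category.id_comp _).trans ?_
    exact Category.comp_id _

/-- The components of a modification. -/
def mapp {b c : Diagram K} {σ τ : b ⟶ c} (Γ : σ ⟶ τ) {k : K} (x : (fam b).obj k) :
    ((trans σ).ap k).obj x ⟶ ((trans τ).ap k).obj x := (Γ.as.app ⟨k⟩).toNatTrans.app x

theorem mapp_naturality {b c : Diagram K} {σ τ : b ⟶ c} (Γ : σ ⟶ τ) {k : K} {x y : (fam b).obj k}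
    (φ : x ⟶ y) : ((trans σ).ap k).map φ ≫ mapp Γ y = mapp Γ x ≫ ((trans τ).ap k).map φ :=
  (Γ.as.app ⟨k⟩).toNatTrans.naturality φ

theorem mapp_nat {b c : Diagram K} {σ τ : b ⟶ c} (Γ : σ ⟶ τ) {k l : K} (f : k ⟶ l)
    (x : (fam b).obj k) :
    mapp Γ (((fam b).tr f).obj x) ≫ ((trans τ).nat f x).hom =
      ((trans σ).nat f x).hom ≫ ((fam c).tr f).map (mapp Γ x) :=
  congrArg (fun z => z.toNatTrans.app x) (Γ.as.naturality f.toLoc)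

theorem mapp_injective {b c : Diagram K} {σ τ : b ⟶ c} {Γ Θ : σ ⟶ τ}
    (h : ∀ {k : K} (x : (fam b).obj k), mapp Γ x = mapp Θ x) : Γ = Θ :=
  Pseudofunctor.StrongTrans.homCategory.ext fun _ =>
    Cat.Hom₂.ext (NatTrans.ext (funext fun x => h x))

/-- A modification from its components. -/
def mkMod {b c : Diagram K} {σ τ : b ⟶ c}
    (Γ : ∀ {k : K} (x : (fam b).obj k), ((trans σ).ap k).obj x ⟶ ((trans τ).ap k).obj x)
    (h1 : ∀ {k : K} {x y : (fam b).obj k} (φ : x ⟶ y),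
      ((trans σ).ap k).map φ ≫ Γ y = Γ x ≫ ((trans τ).ap k).map φ)
    (h2 : ∀ {k l : K} (f : k ⟶ l) (x : (fam b).obj k),
      Γ (((fam b).tr f).obj x) ≫ ((trans τ).nat f x).hom =
        ((trans σ).nat f x).hom ≫ ((fam c).tr f).map (Γ x)) : σ ⟶ τ :=
  ⟨{app := fun _ => ⟨⟨fun x => Γ x, fun _ _ φ => h1 φ⟩⟩
    naturality := fun f => Cat.Hom₂.ext (NatTrans.ext (funext fun x => h2 f.as x))}⟩

section

variable {L : Type u} [SmallCategory L] (S : L ⥤ K) (b : Diagram K)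

/-- Forming `fam` and restricting along `S` give the same fibres and transition functors by
definition, but their constraints are identified only after the equation for `e` is substituted. -/
theorem fam_pull_unit {l : L} (e : l ⟶ l) (he : e = 𝟙 l) (x : b.obj ⟨S.obj l⟩) :
    (fam (pull S b)).unit e he x = (fam b).unit (S.map e) (by rw [he, S.map_id]) x := by
  subst he
  ext
  refine (fam_unit_hom (pull S b) x).trans ?_
  rfl

theorem fam_pull_mul {l m n : L} (f : l ⟶ m) (g : m ⟶ n) (h : l ⟶ n) (e : f ≫ g = h)
    (x : b.obj ⟨S.obj l⟩) : (fam (pull S b)).mul f g h e x =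
      (fam b).mul (S.map f) (S.map g) (S.map h) (by rw [← e, S.map_comp]) x := by
  subst e
  ext
  refine (fam_mul_hom (pull S b) f g x).trans ?_
  rfl

theorem fam_const_unit (X : Cat.{u, u}) {k : K} (e : k ⟶ k) (he : e = 𝟙 k) (x : X) :
    ((fam (const K X)).unit e he x).hom = 𝟙 x := by
  subst he
  exact fam_unit_hom (const K X) x

theorem fam_const_mul (X : Cat.{u, u}) {k l m : K} (f : k ⟶ l) (g : l ⟶ m) (h : k ⟶ m)
    (e : f ≫ g = h) (x : X) : ((fam (const K X)).mul f g h e x).hom = 𝟙 x := by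
  subst e
  exact fam_mul_hom (const K X) f g x

end

/-- Two names for the same composite change the constraint only by an `eqToHom`, which is the form
in which `LocallyDiscrete.mkPseudofunctor` asks for coherence. -/
theorem Fam.mul_hom_mul_inv (A : Fam K) {k l m : K} (f : k ⟶ l) (g : l ⟶ m) (h h' : k ⟶ m)
    (e : f ≫ g = h) (e' : f ≫ g = h') (x : A.obj k) :
    (A.mul f g h e x).hom ≫ (A.mul f g h' e' x).inv = eqToHom (by rw [← e, ← e']) := by
  subst e e'
  simp

theorem Fam.mul_hom_map_unit (A : Fam K) {k l : K} (f g : k ⟶ l) (e : 𝟙 k ≫ f = g) (x : A.obj k) :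
    (A.mul (𝟙 k) f g e x).hom ≫ (A.tr f).map (A.unit (𝟙 k) rfl x).hom =
      eqToHom (by rw [← e, Category.id_comp]) := by
  obtain rfl : f = g := by rw [← e, Category.id_comp]
  exact A.unit_mul _ _ _ _ _

theorem Fam.mul_hom_unit (A : Fam K) {k l : K} (f g : k ⟶ l) (e : f ≫ 𝟙 l = g) (x : A.obj k) :
    (A.mul f (𝟙 l) g e x).hom ≫ (A.unit (𝟙 l) rfl _).hom =
      eqToHom (by rw [← e, Category.comp_id]) := by
  obtain rfl : f = g := by rw [← e, Category.comp_id]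
  exact A.mul_unit _ _ _ _ _

/-- The `2`-functor with a given description in terms of objects and morphisms. -/
def mkDiagram (A : Fam K) : Diagram K :=
  LocallyDiscrete.mkPseudofunctor (fun k => Cat.of (A.obj k)) (fun f => (A.tr f).toCatHom)
    (fun k => Cat.Hom.isoMk (G := 𝟭 (A.obj k)) (NatIso.ofComponents (fun x => A.unit (𝟙 k) rfl x)
      (fun φ => A.unit_naturality _ _ φ)))
    (fun f g => Cat.Hom.isoMk (G := A.tr f ⋙ A.tr g) (NatIso.ofComponents (fun x => A.mul f g _ rfl x)
      (fun φ => A.mul_naturality _ _ _ _ φ)))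
    (fun f g h => by
      refine Cat.Hom₂.ext (NatTrans.ext (funext fun x => ?_))
      rw [Cat.Hom₂.eqToHom_toNatTrans, eqToHom_app]
      refine Eq.trans ?_ (A.mul_hom_mul_inv f (g ≫ h) _ _ (Category.assoc _ _ _).symm rfl x)
      have h1 := A.mul_assoc f g h _ _ _ rfl rfl rfl (Category.assoc _ _ _).symm x
      change (A.mul _ _ _ _ x).hom ≫ (A.tr h).map (A.mul f g _ _ x).hom ≫ 𝟙 _ ≫
        (A.mul g h _ _ _).inv ≫ (A.mul f _ _ _ x).inv = _
      rw [Category.id_comp, reassoc_of% h1, Iso.hom_inv_id_assoc])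
    (fun f => by
      refine Cat.Hom₂.ext (NatTrans.ext (funext fun x => ?_))
      rw [Cat.Hom₂.eqToHom_toNatTrans, eqToHom_app]
      exact (congrArg (_ ≫ ·) (Category.comp_id _)).trans (A.mul_hom_map_unit f _ rfl x))
    (fun f => by
      refine Cat.Hom₂.ext (NatTrans.ext (funext fun x => ?_))
      rw [Cat.Hom₂.eqToHom_toNatTrans, eqToHom_app]
      exact (congrArg (_ ≫ ·) (Category.comp_id _)).trans (A.mul_hom_unit f _ rfl x))

theorem fam_mkDiagram_unit (A : Fam K) {k : K} (e : k ⟶ k) (he : e = 𝟙 k) (x : A.obj k) :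
    ((fam (mkDiagram A)).unit e he x).hom = (A.unit e he x).hom := by
  subst he
  exact fam_unit_hom (mkDiagram A) x

theorem fam_mkDiagram_mul (A : Fam K) {k l m : K} (f : k ⟶ l) (g : l ⟶ m) (h : k ⟶ m)
    (e : f ≫ g = h) (x : A.obj k) :
    ((fam (mkDiagram A)).mul f g h e x).hom = (A.mul f g h e x).hom := by
  subst e
  exact fam_mul_hom (mkDiagram A) f g x

end TwoLim

/-! ### 2-limits as categories of descent data -/

namespace TwoLim

open Fam

variable {K : Type u} [SmallCategory K]

theorem trans_comp_nat_hom {b c d : Diagram K} (σ : b ⟶ c) (τ : c ⟶ d) {k l : K} (f : k ⟶ l)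
    (x : (fam b).obj k) : ((trans (σ ≫ τ)).nat f x).hom =
      ((trans τ).ap l).map ((trans σ).nat f x).hom ≫
        ((trans τ).nat f (((trans σ).ap k).obj x)).hom := by
  have h := congrArg (fun z => z.toNatTrans.app x)
    (Pseudofunctor.StrongTrans.categoryStruct_comp_naturality_hom σ τ f.toLoc)
  refine h.trans ((Category.id_comp _).trans (congrArg (_ ≫ ·) ?_))
  exact (Category.id_comp _).trans (Category.comp_id _)

theorem trans_constMap_nat_hom {X Y : Cat.{u, u}} (F : X ⟶ Y) {k l : K} (f : k ⟶ l) (x : X) :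
    ((trans (constMap K F)).nat f x).hom = 𝟙 (F.toFunctor.obj x) :=
  Category.comp_id _

/-- The functor sending a `1`-morphism of `Cat` to the underlying functor. -/
@[simps]
def catHomFunctor (X P : Cat.{u, u}) : (X ⟶ P) ⥤ (X ⥤ P) where
  obj F := F.toFunctor
  map α := α.toNatTrans

instance (X P : Cat.{u, u}) : (catHomFunctor X P).IsEquivalence where
  faithful := ⟨fun h => Cat.Hom₂.ext h⟩
  full := ⟨fun α => ⟨⟨α⟩, rfl⟩⟩
  essSurj := ⟨fun F => ⟨⟨F⟩, ⟨Iso.refl _⟩⟩⟩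

/-- Cocartesian cancellation turns the modification axiom, stated in a fibre, into a commutative
square of morphisms `N` in the total category. -/
theorem Fam.nat_comm_iff {A B : Fam K} (t s : A.Trans B) {k l : K} (f : k ⟶ l) (x : A.obj k)
    (p : (t.ap k).obj x ⟶ (s.ap k).obj x)
    (q : (t.ap l).obj ((A.tr f).obj x) ⟶ (s.ap l).obj ((A.tr f).obj x)) :
    t.N f x ≫ vert q = vert p ≫ s.N f x ↔
      q ≫ (s.nat f x).hom = (t.nat f x).hom ≫ (B.tr f).map p := by
  rw [t.N_eq, s.N_eq, vert_cart_assoc, Category.assoc, ← vert_comp, ← vert_comp]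
  refine ⟨fun h => ?_, fun h => ?_⟩
  · rw [← Iso.eq_comp_inv, Category.assoc, ← cart_vert_cancel h, Iso.hom_inv_id_assoc]
  · congr 2
    rw [Iso.inv_comp_eq, ← Category.assoc, Iso.eq_comp_inv]
    exact h

namespace Fam.Desc

variable {A : Fam K}

theorem comm_iff (c d : Desc A) {k l : K} (g : k ⟶ l) (p : c.obj k ⟶ d.obj k)
    (q : c.obj l ⟶ d.obj l) : c.mor g ≫ vert q = vert p ≫ d.mor g ↔
      c.θ g ≫ q = (A.tr g).map p ≫ d.θ g := by
  rw [mor_eq, mor_eq, vert_cart_assoc, Category.assoc, ← vert_comp, ← vert_comp]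
  exact ⟨cart_vert_cancel, fun h => by rw [h]⟩

theorem θ_id (c : Desc A) (k : K) : c.θ (𝟙 k) = (A.unit (𝟙 k) rfl (c.obj k)).hom :=
  homMk_injective ((c.id k).trans (id_eq _ _ rfl))

theorem θ_comp (c : Desc A) {k l m : K} (g : k ⟶ l) (h : l ⟶ m) : c.θ (g ≫ h) =
    (A.mul g h _ rfl (c.obj k)).hom ≫ (A.tr h).map (c.θ g) ≫ c.θ h :=
  homMk_injective ((c.comp g h).trans (homMk_comp _ _ _ _ _ rfl))

/-- The structure maps of a descent datum leave the transported object, whereas those of a cone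
enter it. This lemma and the next two supply the cone axioms for the inverses of the `θ`. -/
theorem inv_θ_naturality {c d : Desc A} (p : c ⟶ d) {k l : K} (g : k ⟶ l) :
    p.app l ≫ inv (d.θ g) = inv (c.θ g) ≫ (A.tr g).map (p.app k) := by
  rw [IsIso.eq_inv_comp, ← Category.assoc, IsIso.comp_inv_eq]
  exact (comm_iff c d g _ _).1 (p.comm g)

theorem inv_θ_id (c : Desc A) (k : K) :
    inv (c.θ (𝟙 k)) ≫ (A.unit (𝟙 k) rfl (c.obj k)).hom = 𝟙 _ := by
  rw [IsIso.inv_comp_eq, Category.comp_id, θ_id]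

theorem inv_θ_comp (c : Desc A) {k l m : K} (g : k ⟶ l) (h : l ⟶ m) :
    inv (c.θ (g ≫ h)) ≫ (A.mul g h _ rfl (c.obj k)).hom =
      inv (c.θ h) ≫ (A.tr h).map (inv (c.θ g)) := by
  rw [IsIso.inv_comp_eq, θ_comp, Category.assoc, Category.assoc, IsIso.hom_inv_id_assoc,
    ← Functor.map_comp, IsIso.hom_inv_id, CategoryTheory.Functor.map_id, Category.comp_id]

end Fam.Desc

theorem mapp_N {b c : Diagram K} {σ τ : b ⟶ c} (Γ : σ ⟶ τ) {k l : K} (f : k ⟶ l)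
    (x : (fam b).obj k) :
    (trans σ).N f x ≫ vert (mapp Γ (((fam b).tr f).obj x)) = vert (mapp Γ x) ≫ (trans τ).N f x :=
  (nat_comm_iff _ _ _ _ _ _).2 (mapp_nat Γ f x)

section Cone

variable {b : Diagram K} {X : Cat.{u, u}}

/-- The components of a cone. -/
def capp (σ : const K X ⟶ b) (k : K) : X ⥤ (fam b).obj k := (trans σ).ap k

/-- The comparison morphisms of a cone. -/
def cnat (σ : const K X ⟶ b) {k l : K} (f : k ⟶ l) (x : X) :
    (capp σ l).obj x ≅ ((fam b).tr f).obj ((capp σ k).obj x) := (trans σ).nat f x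

/-- The comparison morphisms of a cone in the total category. -/
def cN (σ : const K X ⟶ b) {k l : K} (f : k ⟶ l) (x : X) :
    (⟨k, (capp σ k).obj x⟩ : (fam b).Tot) ⟶ ⟨l, (capp σ l).obj x⟩ := homMk f (cnat σ f x).inv

theorem cN_naturality (σ : const K X ⟶ b) {k l : K} (f : k ⟶ l) {x y : X} (φ : x ⟶ y) :
    vert ((capp σ k).map φ) ≫ cN σ f y = cN σ f x ≫ vert ((capp σ l).map φ) :=
  (trans σ).N_naturality f φ

/-- The constraints of a constant family are identities, so `Trans.N_unit` loses its correction
term; likewise for composites below. Hence a cone gives a descent datum at each object of its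
vertex. -/
theorem cN_id (σ : const K X ⟶ b) (k : K) (x : X) : cN σ (𝟙 k) x = 𝟙 _ := by
  have h := (trans σ).N_unit (𝟙 k) rfl x
  have h2 : vert (((trans σ).ap k).map ((fam (const K X)).unit (𝟙 k) rfl x).hom) = 𝟙 _ := by
    refine (congrArg vert ?_).trans (vert_id _)
    exact (congrArg ((trans σ).ap k).map (fam_const_unit X (𝟙 k) rfl x)).trans
      (((trans σ).ap k).map_id x)
  exact ((Category.comp_id _).symm.trans (congrArg (_ ≫ ·) h2.symm)).trans h

theorem cN_comp (σ : const K X ⟶ b) {k l m : K} (f : k ⟶ l) (g : l ⟶ m) (x : X) :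
    cN σ (f ≫ g) x = cN σ f x ≫ cN σ g x := by
  have h := (trans σ).N_mul f g _ rfl x
  have h2 : vert (((trans σ).ap m).map ((fam (const K X)).mul f g _ rfl x).hom) = 𝟙 _ := by
    refine (congrArg vert ?_).trans (vert_id _)
    exact (congrArg ((trans σ).ap m).map (fam_const_mul X f g _ rfl x)).trans
      (((trans σ).ap m).map_id x)
  exact ((Category.comp_id _).symm.trans (congrArg (_ ≫ ·) h2.symm)).trans h

/-- The functor to descent data induced by a cone. -/
@[simps]
def toDesc (σ : const K X ⟶ b) : X ⥤ Desc (fam b) where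
  obj x :=
    { obj := fun k => (capp σ k).obj x
      θ := fun g => (cnat σ g x).inv
      isIso := fun g => inferInstance
      id := fun k => cN_id σ k x
      comp := fun g h => cN_comp σ g h x }
  map p := ⟨fun k => (capp σ k).map p, fun g => (cN_naturality σ g p).symm⟩

/-- A cone from its components. -/
def mkCone (ap : ∀ k, X ⥤ (fam b).obj k)
    (nat : ∀ {k l : K} (f : k ⟶ l) (x : X),
      (ap l).obj x ≅ ((fam b).tr f).obj ((ap k).obj x))
    (h1 : ∀ {k l : K} (f : k ⟶ l) {x y : X} (φ : x ⟶ y),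
      (ap l).map φ ≫ (nat f y).hom = (nat f x).hom ≫ ((fam b).tr f).map ((ap k).map φ))
    (h2 : ∀ (k : K) (x : X),
      (nat (𝟙 k) x).hom ≫ ((fam b).unit (𝟙 k) rfl ((ap k).obj x)).hom = 𝟙 _)
    (h3 : ∀ {k l m : K} (f : k ⟶ l) (g : l ⟶ m) (x : X),
      (nat (f ≫ g) x).hom ≫ ((fam b).mul f g _ rfl ((ap k).obj x)).hom =
        (nat g x).hom ≫ ((fam b).tr g).map (nat f x).hom) : const K X ⟶ b :=
  mkTrans
    { ap := ap
      nat := nat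
      naturality := h1
      nat_unit := fun {k} e he x => by
        subst he
        refine (h2 k x).trans ?_
        exact ((ap k).map_id x).symm.trans
          (congrArg (ap k).map (fam_const_unit X (𝟙 k) rfl x).symm)
      nat_mul := fun {k l m} f g h e x => by
        subst e
        refine (h3 f g x).trans ((Category.id_comp _).symm.trans ?_)
        refine congrArg (· ≫ _) ?_
        exact ((ap m).map_id x).symm.trans
          (congrArg (ap m).map (fam_const_mul X f g _ rfl x).symm) }

variable (b X) in
/-- Cones with vertex `X` are functors from `X` to descent data. -/
def coneFunctor : (const K X ⟶ b) ⥤ (X ⥤ Desc (fam b)) where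
  obj σ := toDesc σ
  map {σ τ} Γ :=
    { app := fun x => ⟨fun k => mapp Γ (k := k) x, fun {k l} g => mapp_N Γ g x⟩
      naturality := fun _ _ p => Desc.hom_ext fun k => mapp_naturality Γ (k := k) p }

instance : (coneFunctor b X).Faithful where
  map_injective h := mapp_injective fun {k} x =>
    congrArg (fun z => Desc.Hom.app z k) (congrArg (fun z => NatTrans.app z x) h)

instance : (coneFunctor b X).Full where
  map_surjective {σ τ} η := by
    refine ⟨mkMod (fun {k} x => (η.app x).app k)
      (fun {k} x y φ => congrArg (fun z => Desc.Hom.app z k) (η.naturality φ))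
      (fun {k l} f x => (nat_comm_iff (trans σ) (trans τ) f x _ _).1 ?_), ?_⟩
    · exact (η.app x).comm f
    · rfl

/-- A functor `F` into descent data is realised by evaluating it at each `k` and taking the inverses
of its structure isomorphisms as constraints. -/
instance : (coneFunctor b X).EssSurj where
  mem_essImage F := by
    refine ⟨mkCone (fun k => F ⋙ Desc.ev k) (fun {k l} f x => (asIso ((F.obj x).θ f)).symm)
      ?_ ?_ ?_, ⟨?_⟩⟩
    · intro k l f x y φ
      exact Desc.inv_θ_naturality (F.map φ) f
    · intro k x
      exact (F.obj x).inv_θ_id k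
    · intro k l m f g x
      exact (F.obj x).inv_θ_comp f g
    · refine NatIso.ofComponents (fun x => Desc.isoMk (fun k => Iso.refl _) ?_) ?_
      · intro k l g
        refine (congrArg (_ ≫ ·) (vert_id _)).trans ?_
        refine Eq.trans ?_ (congrArg (· ≫ _) (vert_id _)).symm
        refine (Category.comp_id _).trans (Eq.trans ?_ (Category.id_comp _).symm)
        rfl
      · intro x y p
        ext k
        exact (Category.comp_id _).trans (Category.id_comp _).symm

theorem comp_cnat {P : Cat.{u, u}} (F : X ⟶ P) (σ : const K P ⟶ b) {k l : K} (g : k ⟶ l) (x : X) :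
    cnat (constMap K F ≫ σ) g x = cnat σ g (F.toFunctor.obj x) := by
  refine Iso.ext ((trans_comp_nat_hom (constMap K F) σ g x).trans ?_)
  refine Eq.trans (congrArg (· ≫ _) ?_) (Category.id_comp _)
  exact (congrArg ((trans σ).ap l).map (trans_constMap_nat_hom F g x)).trans
    (((trans σ).ap l).map_id _)

/-- A functor is an equivalence if it induces an equivalence on the categories of objects. -/
theorem isEquivalence_of_whiskeringRight {C D : Type u} [SmallCategory C] [SmallCategory D] (F : C ⥤ D)
    [h : ((Functor.whiskeringRight (Discrete PUnit.{u + 1}) C D).obj F).IsEquivalence] :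
    F.IsEquivalence where
  faithful := ⟨fun {x y p q} hpq => by
    let α (p : x ⟶ y) : Functor.fromPUnit x ⟶ Functor.fromPUnit y := Discrete.natTrans fun _ => p
    have : α p = α q := ((Functor.whiskeringRight (Discrete PUnit.{u + 1}) C D).obj F).map_injective
      (NatTrans.ext (funext fun _ => hpq))
    exact congrArg (fun z => NatTrans.app z ⟨⟨⟩⟩) this⟩
  full := ⟨fun {x y} q => by
    let α : ((Functor.whiskeringRight (Discrete PUnit.{u + 1}) C D).obj F).obj
      (Functor.fromPUnit x) ⟶ ((Functor.whiskeringRight (Discrete PUnit.{u + 1}) C D).obj F).obj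
      (Functor.fromPUnit y) := Discrete.natTrans fun _ => q
    obtain ⟨β, hβ⟩ := ((Functor.whiskeringRight (Discrete PUnit.{u + 1}) C D).obj F).map_surjective α
    exact ⟨β.app ⟨⟨⟩⟩, congrArg (fun z => NatTrans.app z ⟨⟨⟩⟩) hβ⟩⟩
  essSurj := ⟨fun y => by
    obtain ⟨G, ⟨e⟩⟩ := h.essSurj.mem_essImage
      (Functor.fromPUnit y)
    exact ⟨G.obj ⟨⟨⟩⟩, ⟨e.app ⟨⟨⟩⟩⟩⟩⟩

/-- Through the equivalence `coneFunctor`, the functor `compCone σ X` becomes postcomposition with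
`toDesc σ`. Testing on the one-point category recovers `toDesc σ` itself; conversely,
postcomposition with an equivalence is an equivalence for every `X`. -/
theorem isTwoLimit_iff_isEquivalence {P : Cat.{u, u}} (σ : const K P ⟶ b) :
    IsTwoLimit σ ↔ (toDesc σ).IsEquivalence := by
  have e (X : Cat.{u, u}) : compCone σ X ⋙ coneFunctor b X ≅
      catHomFunctor X P ⋙ (Functor.whiskeringRight X P _).obj (toDesc σ) :=
    NatIso.ofComponents (fun F => NatIso.ofComponents (fun x => Desc.isoMk (fun k => Iso.refl _) (by
        intro k l g
        refine (congrArg (_ ≫ ·) (vert_id _)).trans ?_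
        refine Eq.trans ?_ (congrArg (· ≫ _) (vert_id _)).symm
        refine (Category.comp_id _).trans (Eq.trans ?_ (Category.id_comp _).symm)
        refine congrArg (homMk g) ?_
        exact congrArg Iso.inv (comp_cnat F σ g x)))
      (by
        intro x y p
        ext k
        exact (Category.comp_id _).trans (Category.id_comp _).symm)) (by
        intro F G α
        ext x k
        exact (Category.comp_id _).trans (Category.id_comp _).symm)
  have hc (X : Cat.{u, u}) : (coneFunctor b X).IsEquivalence := { }
  constructor
  · intro h
    let X : Cat.{u, u} := Cat.of (Discrete PUnit.{u + 1})
    have := h X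
    have := Functor.isEquivalence_of_iso (e X)
    have : ((Functor.whiskeringRight X P _).obj (toDesc σ)).IsEquivalence :=
      Functor.isEquivalence_of_comp_left (catHomFunctor X P) _
    have h3 : ((Functor.whiskeringRight (Discrete PUnit.{u + 1}) P _).obj (toDesc σ)).IsEquivalence := this
    exact isEquivalence_of_whiskeringRight (toDesc σ)
  · intro h X
    have := Functor.isEquivalence_of_iso (e X).symm
    exact Functor.isEquivalence_of_comp_right _ (coneFunctor b X)

end Cone

end TwoLim

/-! ### 2-colimits as localizations of the total category -/

namespace TwoLim

open Fam

variable {K : Type u} [SmallCategory K]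

/-- The inclusion of a fibre in the total category. -/
@[simps]
def Fam.fibre (A : Fam K) (k : K) : A.obj k ⥤ A.Tot where
  obj x := ⟨k, x⟩
  map φ := vert φ
  map_id := vert_id
  map_comp := vert_comp

/-- A natural transformation between functors on the total category. -/
@[simps]
def Fam.Tot.natTransMk {A : Fam K} {E : Type*} [Category* E] {F G : A.Tot ⥤ E}
    (η : ∀ (k : K) (x : A.obj k), F.obj ⟨k, x⟩ ⟶ G.obj ⟨k, x⟩)
    (hv : ∀ {k : K} {x y : A.obj k} (φ : x ⟶ y),
      F.map (vert φ) ≫ η k y = η k x ≫ G.map (vert φ))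
    (hc : ∀ {k l : K} (f : k ⟶ l) (x : A.obj k),
      F.map (cart f x) ≫ η l _ = η k x ≫ G.map (cart f x)) : F ⟶ G where
  app x := η x.base x.fib
  naturality Y Z p := by
    rw [hom_eq p, Functor.map_comp, Functor.map_comp, Category.assoc]
    exact (congrArg (_ ≫ ·) (hv p.fib)).trans ((Category.assoc _ _ _).symm.trans
      ((congrArg (· ≫ _) (hc p.base Y.fib)).trans (Category.assoc _ _ _)))

section Cocone

variable {b : Diagram K} {X : Cat.{u, u}}

/-- The components of a cocone. -/
def coapp (σ : b ⟶ const K X) (k : K) : (fam b).obj k ⥤ X := (trans σ).ap k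

/-- The comparison isomorphisms of a cocone. -/
def conat (σ : b ⟶ const K X) {k l : K} (f : k ⟶ l) (x : (fam b).obj k) :
    (coapp σ l).obj (((fam b).tr f).obj x) ≅ (coapp σ k).obj x := (trans σ).nat f x

theorem conat_naturality (σ : b ⟶ const K X) {k l : K} (f : k ⟶ l) {x y : (fam b).obj k}
    (φ : x ⟶ y) : (coapp σ l).map (((fam b).tr f).map φ) ≫ (conat σ f y).hom =
      (conat σ f x).hom ≫ (coapp σ k).map φ := (trans σ).naturality f φ

theorem conat_unit (σ : b ⟶ const K X) {k : K} (x : (fam b).obj k) :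
    (conat σ (𝟙 k) x).hom = (coapp σ k).map ((fam b).unit (𝟙 k) rfl x).hom := by
  have h := (trans σ).nat_unit (𝟙 k) rfl x
  exact ((Category.comp_id _).symm.trans
    (congrArg (_ ≫ ·) (fam_const_unit X (𝟙 k) rfl _).symm)).trans h

theorem conat_mul (σ : b ⟶ const K X) {k l m : K} (f : k ⟶ l) (g : l ⟶ m) (x : (fam b).obj k) :
    (conat σ (f ≫ g) x).hom = (coapp σ m).map ((fam b).mul f g _ rfl x).hom ≫
      (conat σ g _).hom ≫ (conat σ f x).hom := by
  have h := (trans σ).nat_mul f g _ rfl x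
  exact ((Category.comp_id _).symm.trans
    (congrArg (_ ≫ ·) (fam_const_mul X f g _ rfl _).symm)).trans h

theorem conat_inv_naturality (σ : b ⟶ const K X) {k l : K} (f : k ⟶ l) {x y : (fam b).obj k}
    (φ : x ⟶ y) : (coapp σ k).map φ ≫ (conat σ f y).inv =
      (conat σ f x).inv ≫ (coapp σ l).map (((fam b).tr f).map φ) := by
  rw [Iso.eq_inv_comp, ← Category.assoc, Iso.comp_inv_eq]
  exact (conat_naturality σ f φ).symm

theorem conat_inv_unit (σ : b ⟶ const K X) {k : K} (x : (fam b).obj k) :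
    (conat σ (𝟙 k) x).inv ≫ (coapp σ k).map ((fam b).unit (𝟙 k) rfl x).hom = 𝟙 _ := by
  rw [Iso.inv_comp_eq, Category.comp_id, conat_unit]

theorem conat_inv_mul (σ : b ⟶ const K X) {k l m : K} (f : k ⟶ l) (g : l ⟶ m)
    (x : (fam b).obj k) :
    (conat σ (f ≫ g) x).inv ≫ (coapp σ m).map ((fam b).mul f g _ rfl x).hom =
      (conat σ f x).inv ≫ (conat σ g _).inv := by
  rw [Iso.inv_comp_eq, conat_mul]
  simp

/-- The functor on the total category induced by a cocone. -/
def toTot (σ : b ⟶ const K X) : (fam b).Tot ⥤ X :=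
  Tot.desc (coapp σ) (fun f x => (conat σ f x).inv) (conat_inv_naturality σ) (conat_inv_unit σ)
    (conat_inv_mul σ)

theorem toTot_map_cart (σ : b ⟶ const K X) {k l : K} (f : k ⟶ l) (x : (fam b).obj k) :
    (toTot σ).map (cart f x) = (conat σ f x).inv :=
  Tot.desc_map_cart _ _ (conat_inv_naturality σ) (conat_inv_unit σ) (conat_inv_mul σ) f x

theorem toTot_map_vert (σ : b ⟶ const K X) {k : K} {x y : (fam b).obj k} (φ : x ⟶ y) :
    (toTot σ).map (vert φ) = (coapp σ k).map φ :=
  Tot.desc_map_vert _ _ (conat_inv_naturality σ) (conat_inv_unit σ) (conat_inv_mul σ) φ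

/-- A morphism of `W` is a chosen cocartesian morphism followed by a vertical isomorphism, so
inverting the chosen ones suffices. -/
theorem isIso_of_W {A : Fam K} {E : Type*} [Category* E] {F : A.Tot ⥤ E}
    (h : ∀ {k l : K} (f : k ⟶ l) (x : A.obj k), IsIso (F.map (cart f x))) :
    A.W.IsInvertedBy F := by
  intro Y Z p (hp : IsIso p.fib)
  rw [hom_eq p, Functor.map_comp]
  have := h p.base Y.fib
  infer_instance

theorem toTot_inverts (σ : b ⟶ const K X) : (fam b).W.IsInvertedBy (toTot σ) :=
  isIso_of_W fun f x => by
    have h : IsIso (conat σ f x).inv := inferInstance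
    exact (congrArg (fun z => IsIso z) (toTot_map_cart σ f x)).mpr h

theorem conat_comm_iff (σ τ : b ⟶ const K X) {k l : K} (f : k ⟶ l) (x : (fam b).obj k)
    (p : (coapp σ k).obj x ⟶ (coapp τ k).obj x)
    (q : (coapp σ l).obj (((fam b).tr f).obj x) ⟶ (coapp τ l).obj (((fam b).tr f).obj x)) :
    q ≫ (conat τ f x).hom = (conat σ f x).hom ≫ p ↔
      (conat σ f x).inv ≫ q = p ≫ (conat τ f x).inv := by
  rw [Iso.inv_comp_eq, ← Category.assoc, Iso.eq_comp_inv]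

variable (b X) in
/-- Cocones are functors on the total category. -/
def coconeFunctor : (b ⟶ const K X) ⥤ ((fam b).Tot ⥤ X) where
  obj σ := toTot σ
  map {σ τ} Γ := Tot.natTransMk (F := toTot σ) (G := toTot τ) (fun k x => mapp Γ x)
    (fun φ => (congrArg (· ≫ _) (toTot_map_vert σ φ)).trans
      ((mapp_naturality Γ φ).trans (congrArg (_ ≫ ·) (toTot_map_vert τ φ).symm)))
    (fun f x => (congrArg (· ≫ _) (toTot_map_cart σ f x)).trans
      ((conat_comm_iff σ τ f x _ _).1 (mapp_nat Γ f x) |>.trans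
        (congrArg (_ ≫ ·) (toTot_map_cart τ f x).symm)))

instance : (coconeFunctor b X).Faithful where
  map_injective h := mapp_injective fun {k} x =>
    congrArg (fun z => NatTrans.app z ⟨k, x⟩) h

/-- Naturality on vertical morphisms makes each component natural, and naturality on cocartesian
morphisms is the modification axiom. -/
instance : (coconeFunctor b X).Full where
  map_surjective {σ τ} η := by
    refine ⟨mkMod (fun {k} x => η.app ⟨k, x⟩)
      (fun {k} x y φ => ?_)
      (fun {k l} f x => (conat_comm_iff σ τ f x _ _).2 ?_), ?_⟩
    · exact (congrArg (· ≫ _) (toTot_map_vert σ φ)).symm.trans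
        ((η.naturality (vert φ)).trans (congrArg (_ ≫ ·) (toTot_map_vert τ φ)))
    · exact (congrArg (· ≫ _) (toTot_map_cart σ f x)).symm.trans
        ((η.naturality (cart f x)).trans (congrArg (_ ≫ ·) (toTot_map_cart τ f x)))
    · rfl

/-- The cocone given by a functor on the total category. -/
noncomputable def mkCocone (G : (fam b).Tot ⥤ X)
    (hG : ∀ {k l : K} (f : k ⟶ l) (x : (fam b).obj k), IsIso (G.map (cart f x))) :
    b ⟶ const K X :=
  mkTrans
    { ap := fun k => (fam b).fibre k ⋙ G
      nat := fun f x => (@asIso _ _ _ _ _ (hG f x)).symm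
      naturality := fun {k l} f {x y} φ => by
        have := hG f x
        have := hG f y
        change G.map (vert _) ≫ inv (G.map (cart f y)) = inv (G.map (cart f x)) ≫ G.map (vert φ)
        rw [IsIso.eq_inv_comp, ← Category.assoc, IsIso.comp_inv_eq, ← Functor.map_comp,
          ← Functor.map_comp, vert_cart]
      nat_unit := fun {k} e he x => by
        subst he
        refine ((congrArg (_ ≫ ·) (fam_const_unit X (𝟙 k) rfl _)).trans (Category.comp_id _)).trans ?_
        have := hG (𝟙 k) x
        change inv (G.map (cart _ x)) = G.map (vert _)
        rw [IsIso.inv_eq_of_hom_inv_id]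
        rw [← Functor.map_comp, cart_unit, CategoryTheory.Functor.map_id]
      nat_mul := fun {k l m} f g h e x => by
        subst e
        refine ((congrArg (_ ≫ ·) (fam_const_mul X f g _ rfl _)).trans (Category.comp_id _)).trans ?_
        have := hG (f ≫ g) x
        have := hG f x
        have := hG g (((fam b).tr f).obj x)
        change inv (G.map (cart _ x)) = G.map (vert _) ≫ inv (G.map (cart g _)) ≫
          inv (G.map (cart f x))
        rw [← Category.assoc, IsIso.eq_comp_inv, IsIso.inv_comp_eq, ← Category.assoc,
          IsIso.eq_comp_inv, ← Functor.map_comp, ← Functor.map_comp, cart_mul] }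

/-- The functor on the total category induced by the cocone of a functor on the total category. -/
noncomputable def toTotMkCocone (G : (fam b).Tot ⥤ X)
    (hG : ∀ {k l : K} (f : k ⟶ l) (x : (fam b).obj k), IsIso (G.map (cart f x))) :
    toTot (mkCocone G hG) ≅ G :=
  have hv {k : K} {x y : (fam b).obj k} (φ : x ⟶ y) :
      (toTot (mkCocone G hG)).map (vert φ) = G.map (vert φ) := toTot_map_vert _ φ
  have hc {k l : K} (f : k ⟶ l) (x : (fam b).obj k) :
      (toTot (mkCocone G hG)).map (cart f x) = G.map (cart f x) := toTot_map_cart _ f x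
  have h {Y Z : (fam b).Tot} (p : Y ⟶ Z) : (toTot (mkCocone G hG)).map p = G.map p := by
    rw [hom_eq p, Functor.map_comp, Functor.map_comp]
    exact congrArg₂ (· ≫ ·) (hc p.base Y.fib) (hv p.fib)
  NatIso.ofComponents (fun Y => Iso.refl (G.obj Y)) (fun p =>
    (Category.comp_id _).trans ((h p).trans (Category.id_comp _).symm))

theorem conat_comp {P : Cat.{u, u}} (σ : b ⟶ const K P) (F : P ⟶ X) {k l : K} (f : k ⟶ l)
    (x : (fam b).obj k) :
    (conat (σ ≫ constMap K F) f x).inv = F.toFunctor.map (conat σ f x).inv := by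
  rw [← Functor.mapIso_inv]
  refine congrArg Iso.inv (Iso.ext ?_)
  exact (trans_comp_nat_hom σ (constMap K F) f x).trans
    ((congrArg (_ ≫ ·) (trans_constMap_nat_hom F f _)).trans (Category.comp_id _))

/-- The functor on the total category induced by the composition of a cocone and a functor. -/
def toTotComp {P : Cat.{u, u}} (σ : b ⟶ const K P) (F : P ⟶ X) :
    toTot (σ ≫ constMap K F) ≅ toTot σ ⋙ F.toFunctor :=
  have hv {k : K} {x y : (fam b).obj k} (φ : x ⟶ y) :
      (toTot (σ ≫ constMap K F)).map (vert φ) = F.toFunctor.map ((toTot σ).map (vert φ)) :=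
    (toTot_map_vert _ φ).trans (congrArg F.toFunctor.map (toTot_map_vert σ φ)).symm
  have hc {k l : K} (f : k ⟶ l) (x : (fam b).obj k) :
      (toTot (σ ≫ constMap K F)).map (cart f x) = F.toFunctor.map ((toTot σ).map (cart f x)) :=
    (toTot_map_cart _ f x).trans ((conat_comp σ F f x).trans
      (congrArg F.toFunctor.map (toTot_map_cart σ f x)).symm)
  have h {Y Z : (fam b).Tot} (p : Y ⟶ Z) :
      (toTot (σ ≫ constMap K F)).map p = F.toFunctor.map ((toTot σ).map p) := by
    rw [hom_eq p, Functor.map_comp, Functor.map_comp, Functor.map_comp]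
    exact congrArg₂ (· ≫ ·) (hc p.base Y.fib) (hv p.fib)
  NatIso.ofComponents (fun Y => Iso.refl (F.toFunctor.obj ((toTot σ).obj Y))) (fun p =>
    (Category.comp_id _).trans ((h p).trans (Category.id_comp _).symm))

variable (X) in
/-- Compatibility of composition of cocones with composition of functors. -/
def compCoconeIso {P : Cat.{u, u}} (σ : b ⟶ const K P) : compCocone σ X ⋙ coconeFunctor b X ≅
    catHomFunctor P X ⋙ (Functor.whiskeringLeft _ P X).obj (toTot σ) :=
  NatIso.ofComponents (fun F => toTotComp σ F) (fun α => by
    ext Y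
    exact (Category.comp_id _).trans (Category.id_comp _).symm)

/-- Cocones embed fully faithfully in functors on the total category, and those functors invert `W`.
Precomposition with a localization functor is fully faithful and reaches every functor inverting
`W`. -/
theorem isTwoColimit_of_isLocalization {P : Cat.{u, u}} (σ : b ⟶ const K P)
    [(toTot σ).IsLocalization (fam b).W] : IsTwoColimit σ := fun X =>
  { faithful := by
      have := Localization.faithful_whiskeringLeft (toTot σ) (fam b).W X
      exact Functor.Faithful.of_comp_iso (compCoconeIso X σ)
    full := by
      have := Localization.full_whiskeringLeft (toTot σ) (fam b).W X
      exact Functor.Full.of_comp_faithful_iso (compCoconeIso X σ)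
    essSurj := ⟨fun τ => ⟨⟨Localization.lift (toTot τ) (toTot_inverts τ) (toTot σ)⟩,
      ⟨(coconeFunctor b X).preimageIso ((toTotComp σ _).trans
        (Localization.fac (toTot τ) (toTot_inverts τ) (toTot σ)))⟩⟩⟩ }

/-- With the next lemma, the universal property in the form of a localization: factorisation of
functors inverting `W`, and uniqueness of the factor up to isomorphism. -/
theorem IsTwoColimit.exists_fac {P : Cat.{u, u}} {σ : b ⟶ const K P} (h : IsTwoColimit σ)
    (G : (fam b).Tot ⥤ X) (hG : (fam b).W.IsInvertedBy G) :
    ∃ F : P ⥤ X, Nonempty (toTot σ ⋙ F ≅ G) := by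
  have := h X
  obtain ⟨F, ⟨e⟩⟩ := (h X).essSurj.mem_essImage (mkCocone G fun f x => hG _ (W_cart f x))
  exact ⟨F.toFunctor, ⟨(toTotComp σ F).symm ≪≫ (coconeFunctor b X).mapIso e ≪≫
    toTotMkCocone G _⟩⟩

theorem IsTwoColimit.exists_iso {P : Cat.{u, u}} {σ : b ⟶ const K P} (h : IsTwoColimit σ)
    {F G : P ⥤ X} (e : toTot σ ⋙ F ≅ toTot σ ⋙ G) : Nonempty (F ≅ G) := by
  have := h X
  let F' : P ⟶ X := ⟨F⟩
  let G' : P ⟶ X := ⟨G⟩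
  let e' : (compCocone σ X).obj F' ≅ (compCocone σ X).obj G' :=
    (coconeFunctor b X).preimageIso (toTotComp σ F' ≪≫ e ≪≫ (toTotComp σ G').symm)
  exact ⟨(catHomFunctor P X).mapIso ((compCocone σ X).preimageIso e')⟩

/-- The constructed localization `M` lives in the same universe, so it is an admissible test
category. The universal properties of `M` and of `P` give functors both ways, and the uniqueness
halves make them mutually inverse. -/
theorem IsTwoColimit.isLocalization {P : Cat.{u, u}} {σ : b ⟶ const K P} (h : IsTwoColimit σ) :
    (toTot σ).IsLocalization (fam b).W := by
  let M : Cat.{u, u} := Cat.of (fam b).W.Localization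
  let G : M ⥤ P := Localization.Construction.lift (toTot σ) (toTot_inverts σ)
  have hG : (fam b).W.Q ⋙ G = toTot σ := Localization.Construction.fac _ _
  obtain ⟨H, ⟨e⟩⟩ := h.exists_fac (X := M) (fam b).W.Q (fam b).W.Q_inverts
  obtain ⟨e1⟩ := h.exists_iso (F := H ⋙ G) (G := 𝟭 P)
    (Functor.isoWhiskerRight e G ≪≫ eqToIso hG)
  have e2 : G ⋙ H ≅ 𝟭 M := Localization.liftNatIso (h₁ := ⟨Iso.refl _⟩) (h₂ := ⟨Iso.refl _⟩)
    (fam b).W.Q (fam b).W ((fam b).W.Q ⋙ G ⋙ H) ((fam b).W.Q ⋙ 𝟭 _) (G ⋙ H) (𝟭 _)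
      (Functor.isoWhiskerRight (eqToIso hG) H ≪≫ e ≪≫ (Functor.rightUnitor _).symm)
  exact ⟨toTot_inverts σ, (CategoryTheory.Equivalence.mk G H e2.symm e1).isEquivalence_functor⟩

end Cocone

end TwoLim

/-! ### Filtered base: calculus of fractions and recognition of colimits -/

namespace TwoLim

section Filtered

variable {I : Type u} [SmallCategory I] [IsFiltered I]

/-- Finitely many eventually satisfied conditions are eventually satisfied simultaneously. -/
theorem exists_common {T : Type*} [Finite T] {i : I} (P : T → ∀ {j : I}, (i ⟶ j) → Prop)
    (hP : ∀ t {j k : I} (f : i ⟶ j) (g : j ⟶ k), P t f → P t (f ≫ g))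
    (h : ∀ t, ∃ (j : I) (f : i ⟶ j), P t f) : ∃ (j : I) (f : i ⟶ j), ∀ t, P t f := by
  classical
  have := Fintype.ofFinite T
  suffices H : ∀ s : Finset T, ∃ (j : I) (f : i ⟶ j), ∀ t ∈ s, P t f by
    obtain ⟨j, f, hf⟩ := H Finset.univ
    exact ⟨j, f, fun t => hf t (Finset.mem_univ t)⟩
  intro s
  induction s using Finset.induction_on with
  | empty => exact ⟨i, 𝟙 i, by simp⟩
  | insert t s _ ih =>
    obtain ⟨j, f, hf⟩ := ih
    obtain ⟨k, g, hg⟩ := h t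
    obtain ⟨l, a, b, hab⟩ := IsFiltered.span f g
    refine ⟨l, f ≫ a, fun t' ht' => ?_⟩
    obtain rfl | ht' := Finset.mem_insert.1 ht'
    · rw [hab]
      exact hP _ _ _ hg
    · exact hP _ _ _ (hf _ ht')

end Filtered

namespace Fam

variable {I : Type u} [SmallCategory I] {A : Fam I}

/-- Together with `W_fac` this is the cocartesian universal property for all of `W`. It passes from
the chosen lifts because a vertical isomorphism can be cancelled. -/
theorem W_cancel {X Y Z : A.Tot} {s : X ⟶ Y} (hs : A.W s) {p q : Y ⟶ Z} (hb : p.base = q.base)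
    (h : s ≫ p = s ≫ q) : p = q := by
  obtain ⟨i, x⟩ := X
  obtain ⟨j, y⟩ := Y
  obtain ⟨f, φ⟩ := s
  have : IsIso φ := hs
  have h' : homMk f φ ≫ p = homMk f φ ≫ q := h
  rw [homMk_eq, Category.assoc, Category.assoc] at h'
  refine (cancel_epi (vert φ)).1 (cart_cancel f ?_ h')
  rw [base_comp, base_comp, hb]

theorem W_fac {X Y Z : A.Tot} {s : X ⟶ Y} (hs : A.W s) (p : X ⟶ Z) (g : Y.base ⟶ Z.base)
    (e : s.base ≫ g = p.base) : ∃ φ : (A.tr g).obj Y.fib ⟶ Z.fib, s ≫ homMk g φ = p := by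
  obtain ⟨i, x⟩ := X
  obtain ⟨j, y⟩ := Y
  obtain ⟨k, z⟩ := Z
  obtain ⟨f, φ⟩ := s
  have : IsIso φ := hs
  obtain ⟨ψ, hψ⟩ := exists_cart_fac p f g e
  refine ⟨(A.tr g).map (inv φ) ≫ ψ, ?_⟩
  change homMk f φ ≫ homMk g _ = p
  rw [homMk_eq f, homMk_eq g, vert_comp, Category.assoc, ← vert_cart_assoc,
    ← Category.assoc (vert φ), ← vert_comp, IsIso.hom_inv_id, vert_id, Category.id_comp]
  exact hψ

/-- Filteredness is needed only in the base. Completing the bases of a span to a commutative square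
permits a cocartesian factorisation. For a pair equalized by a morphism of `W`, coequalizing the
bases is enough, since cocartesian morphisms then cancel. -/
instance [IsFiltered I] : A.W.HasLeftCalculusOfFractions where
  exists_leftFraction {X Y} φ := by
    obtain ⟨k, u, v, huv⟩ := IsFiltered.span φ.s.base φ.f.base
    obtain ⟨ψ, hψ⟩ := W_fac φ.hs (φ.f ≫ cart v Y.fib) u huv
    exact ⟨⟨homMk u ψ, cart v Y.fib, W_cart _ _⟩, hψ.symm⟩
  ext {X' X Y} p q s hs h := by
    refine ⟨_, cart (IsFiltered.coeqHom p.base q.base) Y.fib, W_cart _ _, W_cancel hs ?_ ?_⟩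
    · exact IsFiltered.coeq_condition _ _
    · rw [reassoc_of% h]

/-- The functor `L` presents its target as the filtered colimit of the fibres. -/
structure IsColim {P : Type*} [Category* P] (L : A.Tot ⥤ P) : Prop where
  isIso {i j : I} (f : i ⟶ j) (x : A.obj i) : IsIso (L.map (cart f x))
  surj (z : P) : ∃ X, Nonempty (L.obj X ≅ z)
  full {i : I} {x y : A.obj i} (w : L.obj ⟨i, x⟩ ⟶ L.obj ⟨i, y⟩) :
    ∃ (j : I) (f : i ⟶ j) (v : (A.tr f).obj x ⟶ (A.tr f).obj y),
      L.map (cart f x) ≫ L.map (vert v) = w ≫ L.map (cart f y)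
  faithful {i : I} {x y : A.obj i} {v w : x ⟶ y} (h : L.map (vert v) = L.map (vert w)) :
    ∃ (j : I) (f : i ⟶ j), (A.tr f).map v = (A.tr f).map w

variable [IsFiltered I]

/-- Morphisms of the localization are left fractions. Once both legs lie over one arrow `f`, the
invertible fibre part of the denominator can be divided out, leaving a vertical morphism at the
later stage. Equality of images is equality after postcomposition with a member of `W`, hence after
transport along its base. -/
theorem isColim_of_isLocalization {P : Type*} [Category* P] (L : A.Tot ⥤ P)
    [L.IsLocalization A.W] : IsColim L where
  isIso f x := Localization.inverts L A.W _ (W_cart f x)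
  surj z := by
    have := Localization.essSurj L A.W
    exact ⟨_, ⟨L.objObjPreimageIso z⟩⟩
  full {i x y} w := by
    obtain ⟨φ, hφ⟩ := Localization.exists_leftFraction L A.W w
    obtain ⟨⟨j, z⟩, p, s, hs, rfl⟩ := φ.cases
    have h1 : w ≫ L.map s = L.map p := by
      rw [hφ]
      exact MorphismProperty.LeftFraction.map_comp_map_s _ _ _
    -- The two legs of the fraction may lie over different arrows; postcomposing both with the lift
    -- of a coequalizing arrow gives them the same base.
    let t := IsFiltered.coeqHom p.base s.base
    have ht : p.base ≫ t = s.base ≫ t := IsFiltered.coeq_condition _ _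
    have hs' : A.W (s ≫ cart t z) := MorphismProperty.comp_mem _ _ _ hs (W_cart _ _)
    have h2 : w ≫ L.map (s ≫ cart t z) = L.map (p ≫ cart t z) := by
      rw [Functor.map_comp, reassoc_of% h1, Functor.map_comp]
    have hb : (p ≫ cart t z).base = (s ≫ cart t z).base := ht
    generalize p ≫ cart t z = p' at h2 hb
    generalize s ≫ cart t z = s' at hs' h2 hb
    obtain ⟨f, ψ⟩ := p'
    obtain ⟨f', σ⟩ := s'
    obtain rfl : f = f' := hb
    have : IsIso σ := hs'
    have h3 : w ≫ L.map (homMk f σ) = L.map (homMk f ψ) := h2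
    refine ⟨_, f, ψ ≫ inv σ, ?_⟩
    rw [vert_comp, Functor.map_comp, ← Functor.map_comp_assoc, ← homMk_eq, ← h3, homMk_eq f σ,
      Functor.map_comp, Category.assoc, Category.assoc, ← Functor.map_comp, ← vert_comp,
      IsIso.hom_inv_id, vert_id, CategoryTheory.Functor.map_id, Category.comp_id]
  faithful {i x y v w} h := by
    obtain ⟨⟨j, z⟩, ⟨f, σ⟩, hs, h⟩ := (MorphismProperty.map_eq_iff_postcomp L A.W _ _).1 h
    have : IsIso σ := hs
    have h' : vert v ≫ homMk f σ = vert w ≫ homMk f σ := h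
    rw [homMk_eq, vert_cart_assoc, vert_cart_assoc, ← vert_comp, ← vert_comp] at h'
    exact ⟨j, f, (cancel_mono σ).1 (cart_vert_cancel h')⟩

namespace IsColim

variable {P Q : Type*} [Category* P] [Category* Q] {L : A.Tot ⥤ P} {M : A.Tot ⥤ Q}

theorem surj_pair (hL : IsColim L) (z z' : P) : ∃ (i : I) (x y : A.obj i),
    Nonempty (L.obj ⟨i, x⟩ ≅ z) ∧ Nonempty (L.obj ⟨i, y⟩ ≅ z') := by
  obtain ⟨⟨i, x⟩, ⟨α⟩⟩ := hL.surj z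
  obtain ⟨⟨j, y⟩, ⟨β⟩⟩ := hL.surj z'
  have := hL.isIso (IsFiltered.leftToMax i j) x
  have := hL.isIso (IsFiltered.rightToMax i j) y
  exact ⟨_, _, _, ⟨(asIso (L.map (cart (IsFiltered.leftToMax i j) x))).symm ≪≫ α⟩,
    ⟨(asIso (L.map (cart (IsFiltered.rightToMax i j) y))).symm ≪≫ β⟩⟩

/-- Images of vertical morphisms that agree in `Q` agree at a later stage, hence already in `P`,
where the lifts are invertible. An arbitrary morphism of `P` is reduced to this case by representing
it at a later stage. -/
theorem faithful_of_iso (hL : IsColim L) (hM : IsColim M) (F : P ⥤ Q) (e : L ⋙ F ≅ M) :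
    F.Faithful := by
  have hvert {i : I} {x y : A.obj i} (v w : x ⟶ y)
      (h : F.map (L.map (vert v)) = F.map (L.map (vert w))) : L.map (vert v) = L.map (vert w) := by
    obtain ⟨j, g, hg⟩ := hM.faithful (v := v) (w := w) (by
      have h1 := e.hom.naturality (vert v)
      have h2 := e.hom.naturality (vert w)
      rw [Functor.comp_map] at h1 h2
      rw [← cancel_epi (e.hom.app _), ← h1, ← h2, h])
    have := hL.isIso g y
    rw [← cancel_mono (L.map (cart g y)), ← Functor.map_comp, ← Functor.map_comp, vert_cart,
      vert_cart, hg]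
  -- Now only one of the two morphisms is vertical: the other is realised at a later stage by `w`,
  -- and `hvert` compares `w` with the transport of `v`.
  have hfib {i : I} {x y : A.obj i} (v : x ⟶ y) (b : L.obj ⟨i, x⟩ ⟶ L.obj ⟨i, y⟩)
      (h : F.map (L.map (vert v)) = F.map b) : L.map (vert v) = b := by
    obtain ⟨j, g, w, hw⟩ := hL.full b
    have := hL.isIso g y
    have := hL.isIso g x
    have h1 : L.map (cart g x) ≫ L.map (vert ((A.tr g).map v)) =
        L.map (vert v) ≫ L.map (cart g y) := by
      rw [← Functor.map_comp, ← Functor.map_comp, vert_cart]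
    rw [← cancel_mono (L.map (cart g y)), ← hw, ← h1, cancel_epi]
    refine hvert _ _ ?_
    rw [← cancel_epi (F.map (L.map (cart g x))), ← F.map_comp, ← F.map_comp, h1, hw,
      Functor.map_comp, Functor.map_comp, h]
  refine ⟨fun {z z' a b} hab => ?_⟩
  obtain ⟨i, x, y, ⟨α⟩, ⟨β⟩⟩ := hL.surj_pair z z'
  obtain ⟨j, f, v, hv⟩ := hL.full (α.hom ≫ a ≫ β.inv)
  have := hL.isIso f y
  have := hL.isIso f x
  have h := hfib v (inv (L.map (cart f x)) ≫ (α.hom ≫ b ≫ β.inv) ≫ L.map (cart f y)) (by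
    rw [← cancel_epi (F.map (L.map (cart f x))), ← F.map_comp, ← F.map_comp, hv,
      IsIso.hom_inv_id_assoc]
    simp only [Functor.map_comp, hab])
  rw [h, IsIso.hom_inv_id_assoc, cancel_mono, cancel_epi, cancel_mono] at hv
  exact hv.symm

/-- A functor between two presentations of a filtered colimit is an equivalence. -/
theorem isEquivalence (hL : IsColim L) (hM : IsColim M) (F : P ⥤ Q) (e : L ⋙ F ≅ M) :
    F.IsEquivalence where
  faithful := faithful_of_iso hL hM F e
  full := ⟨fun {z z'} w => by
    obtain ⟨i, x, y, ⟨α⟩, ⟨β⟩⟩ := hL.surj_pair z z'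
    -- Carried to `M` by `e`, the morphism `w` is represented by some `v` at a stage `j`. The image
    -- of `v` under `L`, conjugated by the invertible cocartesian morphisms, is the preimage.
    obtain ⟨j, f, v, hv⟩ :=
      hM.full (e.inv.app _ ≫ F.map α.hom ≫ w ≫ F.map β.inv ≫ e.hom.app _)
    have := hL.isIso f y
    have := hM.isIso f y
    refine ⟨α.inv ≫ L.map (cart f x) ≫ L.map (vert v) ≫ inv (L.map (cart f y)) ≫ β.hom, ?_⟩
    have h1 : F.map (L.map (cart f x) ≫ L.map (vert v)) =
        (F.map α.hom ≫ w ≫ F.map β.inv) ≫ F.map (L.map (cart f y)) := by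
      have h2 := e.hom.naturality (cart f x ≫ vert v)
      have h3 := e.hom.naturality (cart f y)
      rw [Functor.comp_map, Functor.map_comp, Functor.map_comp M, hv] at h2
      rw [Functor.comp_map] at h3
      rw [← cancel_mono (e.hom.app _), h2]
      simp only [Category.assoc]
      rw [h3]
      simp
    rw [← Category.assoc (L.map (cart f x)), Functor.map_comp, Functor.map_comp, h1,
      Functor.map_comp F, Category.assoc (F.map α.hom ≫ _), ← Functor.map_comp_assoc,
      IsIso.hom_inv_id]
    simp [← Functor.map_comp, ← Functor.map_comp_assoc]⟩
  essSurj := ⟨fun z => by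
    obtain ⟨X, ⟨α⟩⟩ := hM.surj z
    exact ⟨L.obj X, ⟨e.app X ≪≫ α⟩⟩⟩

end IsColim

end Fam

end TwoLim

/-! ### Transformations over a product and functors to descent data -/

namespace TwoLim

variable {I K : Type u} [SmallCategory I] [SmallCategory K]

namespace Fam

/-- The first projection of a product of categories. -/
@[reducible]
def pr1 (I K : Type u) [SmallCategory I] [SmallCategory K] : I × K ⥤ I where
  obj x := x.1
  map f := f.1

/-- The second projection of a product of categories. -/
@[reducible]
def pr2 (I K : Type u) [SmallCategory I] [SmallCategory K] : I × K ⥤ K where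
  obj x := x.2
  map f := f.2

/-- Composition of `2`-natural transformations. -/
@[simps]
def Trans.comp {A B C : Fam K} (t : A.Trans B) (s : B.Trans C) : A.Trans C where
  ap k := t.ap k ⋙ s.ap k
  nat f x := (s.ap _).mapIso (t.nat f x) ≪≫ s.nat f _
  naturality f x y φ := by
    have h := s.naturality f ((t.ap _).map φ)
    simp only [Functor.comp_map, Iso.trans_hom, Functor.mapIso_hom, Category.assoc]
    rw [← h, ← Functor.map_comp_assoc, t.naturality, Functor.map_comp_assoc]
  nat_unit e he x := by
    simp only [Functor.comp_map, Functor.comp_obj, Iso.trans_hom, Functor.mapIso_hom, Category.assoc]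
    rw [s.nat_unit, ← Functor.map_comp, t.nat_unit]
  nat_mul f g h e x := by
    simp only [Functor.comp_map, Functor.comp_obj, Iso.trans_hom, Functor.mapIso_hom, Category.assoc,
      Functor.map_comp]
    rw [s.nat_mul, ← Functor.map_comp_assoc, t.nat_mul, ← reassoc_of% s.naturality]
    simp only [Functor.map_comp, Category.assoc]

theorem Trans.comp_tot_map {A B C : Fam K} (t : A.Trans B) (s : B.Trans C) {X Y : A.Tot}
    (p : X ⟶ Y) : (t.comp s).tot.map p = s.tot.map (t.tot.map p) := by
  have h : ((t.comp s).nat p.base X.fib).inv ≫ (s.ap _).map ((t.ap _).map p.fib) =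
      (s.nat _ _).inv ≫ (s.ap _).map ((t.nat _ _).inv ≫ (t.ap _).map p.fib) := by
    simp only [Trans.comp_nat, Iso.trans_inv, Functor.mapIso_inv, Functor.map_comp]
    exact Category.assoc _ _ _
  exact congrArg (homMk p.base) h

section

variable {L : Type u} [SmallCategory L] {S : L ⥤ K} {A : Fam L} {B : Fam K}

/-- The components of a transformation to a restriction. -/
abbrev Trans.to (t : A.Trans (pull S B)) (k : L) : A.obj k ⥤ B.obj (S.obj k) := t.ap k

/-- The action on morphisms of total categories of a transformation to a restriction. -/
def Trans.hom (t : A.Trans (pull S B)) {X Y : A.Tot} (p : X ⟶ Y) :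
    (⟨S.obj X.base, (t.to _).obj X.fib⟩ : B.Tot) ⟶ ⟨S.obj Y.base, (t.to _).obj Y.fib⟩ :=
  (pullTot S B).map (t.tot.map p)

variable (t s : A.Trans (pull S B))

theorem Trans.hom_id (X : A.Tot) : t.hom (𝟙 X) = 𝟙 _ :=
  (t.tot ⋙ pullTot S B).map_id X

theorem Trans.hom_comp {X Y Z : A.Tot} (p : X ⟶ Y) (q : Y ⟶ Z) :
    t.hom (p ≫ q) = t.hom p ≫ t.hom q :=
  (t.tot ⋙ pullTot S B).map_comp p q

theorem Trans.hom_cart {k l : L} (f : k ⟶ l) (x : A.obj k) :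
    t.hom (cart f x) = homMk (S.map f) (t.nat f x).inv :=
  congrArg (pullTot S B).map (t.tot_map_cart f x)

theorem Trans.hom_vert {k : L} {x y : A.obj k} (φ : x ⟶ y) :
    t.hom (vert φ) = vert ((t.to k).map φ) :=
  (congrArg (pullTot S B).map (t.tot_map_vert φ)).trans (pullTot_map_vert S _)

theorem Trans.W_tot {A B : Fam K} (t : A.Trans B) {X Y : A.Tot} {p : X ⟶ Y} (hp : A.W p) :
    B.W (t.tot.map p) := by
  have : IsIso p.fib := hp
  change IsIso ((t.nat _ _).inv ≫ (t.ap _).map p.fib)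
  infer_instance

theorem Trans.W_hom {X Y : A.Tot} {p : X ⟶ Y} (hp : A.W p) : B.W (t.hom p) := t.W_tot hp

/-- The counterpart of `Fam.nat_comm_iff` for a target restricted along `S`, with the square read in
the total category over `K` rather than over `L`. -/
theorem Trans.hom_comm_iff {k l : L} (f : k ⟶ l) (x : A.obj k)
    (p : (t.to k).obj x ⟶ (s.to k).obj x)
    (q : (t.to l).obj ((A.tr f).obj x) ⟶ (s.to l).obj ((A.tr f).obj x)) :
    t.hom (cart f x) ≫ vert q = vert p ≫ s.hom (cart f x) ↔
      q ≫ (s.nat f x).hom = (t.nat f x).hom ≫ (B.tr (S.map f)).map p := by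
  rw [t.hom_cart, s.hom_cart, homMk_eq, homMk_eq, vert_cart_assoc, Category.assoc, ← vert_comp,
    ← vert_comp]
  refine ⟨fun h => ?_, fun h => ?_⟩
  · rw [← Iso.eq_comp_inv, Category.assoc, ← cart_vert_cancel h, Iso.hom_inv_id_assoc]
  · congr 2
    rw [Iso.inv_comp_eq, ← Category.assoc, Iso.eq_comp_inv]
    exact h

end

section

variable {E : Fam I} {A : Fam (I × K)} {B : Fam K}

/-- The morphism of the total category of a constant family given by a pair of morphisms. -/
def prodHom {X Y : E.Tot} (p : X ⟶ Y) {k l : K} (g : k ⟶ l) :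
    (⟨(X.base, k), X.fib⟩ : (pull (pr1 I K) E).Tot) ⟶ ⟨(Y.base, l), Y.fib⟩ :=
  homMk (A := pull (pr1 I K) E) (k := (X.base, k)) (l := (Y.base, l)) (p.base, g) p.fib

theorem W_prodHom {X Y : E.Tot} {p : X ⟶ Y} (hp : E.W p) {k l : K} (g : k ⟶ l) :
    (pull (pr1 I K) E).W (prodHom p g) := hp

/-- The components of a transformation from a family on the first factor to a family on the second
factor. -/
abbrev Trans.bi (τ : (pull (pr1 I K) E).Trans (pull (pr2 I K) B)) (i : I) (k : K) :
    E.obj i ⥤ B.obj k := τ.ap (i, k)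

/-- The action of a transformation from a family on the first factor to a family on the second
factor on pairs of morphisms. -/
def Trans.pair (τ : (pull (pr1 I K) E).Trans (pull (pr2 I K) B)) {X Y : E.Tot} (p : X ⟶ Y)
    {k l : K} (g : k ⟶ l) :
    (⟨k, (τ.bi X.base k).obj X.fib⟩ : B.Tot) ⟶ ⟨l, (τ.bi Y.base l).obj Y.fib⟩ :=
  τ.hom (prodHom p g)

section

variable (τ τ' : (pull (pr1 I K) E).Trans (pull (pr2 I K) B))

theorem Trans.pair_id (X : E.Tot) (k : K) : τ.pair (𝟙 X) (𝟙 k) = 𝟙 _ := τ.hom_id _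

theorem Trans.pair_comp {X Y Z : E.Tot} (p : X ⟶ Y) (q : Y ⟶ Z) {k l m : K} (g : k ⟶ l)
    (h : l ⟶ m) : τ.pair (p ≫ q) (g ≫ h) = τ.pair p g ≫ τ.pair q h :=
  τ.hom_comp (prodHom p g) (prodHom q h)

theorem Trans.pair_vert {i : I} {x y : E.obj i} (φ : x ⟶ y) (k : K) :
    τ.pair (vert φ) (𝟙 k) = vert ((τ.bi i k).map φ) := τ.hom_vert (k := (i, k)) φ

/-- Moving first in the `I` direction and then in the `K` direction separates naturality of a
functor to `Desc` from compatibility with descent structure. -/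
theorem Trans.pair_eq {X Y : E.Tot} (p : X ⟶ Y) {k l : K} (g : k ⟶ l) :
    τ.pair p g = τ.pair p (𝟙 k) ≫ τ.pair (𝟙 Y) g := by
  rw [← pair_comp, Category.id_comp, Category.comp_id]

theorem Trans.pair_eq' {X Y : E.Tot} (p : X ⟶ Y) {k l : K} (g : k ⟶ l) :
    τ.pair p g = τ.pair (cart p.base X.fib) g ≫ vert ((τ.bi Y.base l).map p.fib) := by
  rw [← pair_vert, ← pair_comp, Category.comp_id, ← hom_eq]

theorem Trans.W_pair {X Y : E.Tot} {p : X ⟶ Y} (hp : E.W p) {k l : K} (g : k ⟶ l) :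
    B.W (τ.pair p g) := τ.W_hom (W_prodHom hp g)

theorem Trans.pair_comm_iff {i j : I} {k l : K} (f : i ⟶ j) (g : k ⟶ l) (x : E.obj i)
    (p : (τ.bi i k).obj x ⟶ (τ'.bi i k).obj x)
    (q : (τ.bi j l).obj ((E.tr f).obj x) ⟶ (τ'.bi j l).obj ((E.tr f).obj x)) :
    τ.pair (cart f x) g ≫ vert q = vert p ≫ τ'.pair (cart f x) g ↔
      q ≫ (τ'.nat (k := (i, k)) (l := (j, l)) (f, g) x).hom =
        (τ.nat (k := (i, k)) (l := (j, l)) (f, g) x).hom ≫ (B.tr g).map p :=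
  τ.hom_comm_iff τ' (k := (i, k)) (l := (j, l)) (f, g) x p q

/-- The functor to descent data induced by a transformation from a family on the first factor to a
family on the second factor. -/
def Trans.toDesc : E.Tot ⥤ Desc B :=
  Desc.ofFunctor (fun X k => (τ.bi X.base k).obj X.fib)
    (fun p _ _ g => (τ.pair p g).fib)
    (fun X _ _ g => τ.W_pair (MorphismProperty.id_mem _ X) g)
    (fun X k => τ.pair_id X k)
    (fun p q _ _ _ g h => τ.pair_comp p q g h)

/-- The components of the functor to descent data on morphisms. -/
def Trans.comp₁ {X Y : E.Tot} (p : X ⟶ Y) (k : K) :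
    (τ.bi X.base k).obj X.fib ⟶ (τ.bi Y.base k).obj Y.fib := (τ.toDesc.map p).app k

theorem Trans.vert_comp₁ {X Y : E.Tot} (p : X ⟶ Y) (k : K) :
    vert (τ.comp₁ p k) = τ.pair p (𝟙 k) :=
  Desc.vert_ofFunctor_map_app _ _ _ _ _ p k

theorem Trans.toDesc_map_vert_app {i : I} {x y : E.obj i} (φ : x ⟶ y) (k : K) :
    (τ.toDesc.map (vert φ)).app k = (τ.bi i k).map φ :=
  vert_injective ((τ.vert_comp₁ (vert φ) k).trans (τ.pair_vert φ k))

theorem isIso_of_W_vert {k : K} {x y : B.obj k} {φ : x ⟶ y} (h : B.W (vert φ)) : IsIso φ := by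
  have h' : IsIso ((B.unit _ rfl _).hom ≫ φ) := h
  exact IsIso.of_isIso_comp_left (B.unit _ rfl _).hom _

/-- Transformations preserve cocartesian morphisms, and each component of the image lies over an
identity of `K`; a vertical cocartesian morphism is invertible. -/
theorem Trans.isIso_toDesc_map {X Y : E.Tot} {p : X ⟶ Y} (hp : E.W p) :
    IsIso (τ.toDesc.map p) :=
  Desc.isIso_of_app _ fun k => by
    have h : B.W (vert (τ.comp₁ p k)) := by
      rw [vert_comp₁]
      exact τ.W_pair hp (𝟙 k)
    exact isIso_of_W_vert h

theorem Trans.toDesc_inverts : E.W.IsInvertedBy τ.toDesc :=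
  fun _ _ _ hp => τ.isIso_toDesc_map hp

end

variable {τ τ' : (pull (pr1 I K) E).Trans (pull (pr2 I K) B)}

/-- The components of a natural transformation of functors to descent data are compatible with the
comparison isomorphisms. -/
theorem Trans.toDesc_comm (η : τ.toDesc ⟶ τ'.toDesc) {i j : I} {k l : K} (f : i ⟶ j) (g : k ⟶ l)
    (x : E.obj i)
    (q : ∀ (i : I) (k : K) (x : E.obj i), (τ.bi i k).obj x ⟶ (τ'.bi i k).obj x)
    (hq : ∀ i k x, q i k x = (η.app ⟨i, x⟩).app k) :
    τ.pair (cart f x) g ≫ vert (q j l ((E.tr f).obj x)) =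
      vert (q i k x) ≫ τ'.pair (cart f x) g := by
  -- The square over `(f, g)` splits: `h1` is naturality of `η`, and `h2` says that a component of
  -- `η` respects descent structure.
  have h1 : τ.pair (cart f x) (𝟙 k) ≫ vert (q j k ((E.tr f).obj x)) =
      vert (q i k x) ≫ τ'.pair (cart f x) (𝟙 k) := by
    have h : τ.comp₁ (cart f x) k ≫ q j k ((E.tr f).obj x) = q i k x ≫ τ'.comp₁ (cart f x) k := by
      rw [hq, hq]
      exact congrArg (fun z => Desc.Hom.app z k) (η.naturality (cart f x))
    have h' := congrArg vert h
    rw [vert_comp, vert_comp, τ.vert_comp₁, τ'.vert_comp₁] at h'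
    exact h'
  have h2 : τ.pair (𝟙 (⟨j, (E.tr f).obj x⟩ : E.Tot)) g ≫ vert (q j l ((E.tr f).obj x)) =
      vert (q j k ((E.tr f).obj x)) ≫ τ'.pair (𝟙 (⟨j, (E.tr f).obj x⟩ : E.Tot)) g := by
    rw [hq, hq]
    exact (η.app ⟨j, (E.tr f).obj x⟩).comm g
  rw [τ.pair_eq (cart f x) g, τ'.pair_eq (cart f x) g, Category.assoc]
  refine (congrArg (_ ≫ ·) h2).trans ?_
  rw [← Category.assoc, h1, Category.assoc]

/-- A natural transformation of functors to descent data from compatible components. -/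
def Trans.toDescHom
    (Γ : ∀ (i : I) (k : K) (x : E.obj i), (τ.bi i k).obj x ⟶ (τ'.bi i k).obj x)
    (hv : ∀ (i : I) (k : K) {x y : E.obj i} (φ : x ⟶ y),
      (τ.bi i k).map φ ≫ Γ i k y = Γ i k x ≫ (τ'.bi i k).map φ)
    (hc : ∀ {i j : I} {k l : K} (f : i ⟶ j) (g : k ⟶ l) (x : E.obj i),
      τ.pair (cart f x) g ≫ vert (Γ j l ((E.tr f).obj x)) =
        vert (Γ i k x) ≫ τ'.pair (cart f x) g) : τ.toDesc ⟶ τ'.toDesc :=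
  have key {X Y : E.Tot} (p : X ⟶ Y) {k l : K} (g : k ⟶ l) :
      τ.pair p g ≫ vert (Γ Y.base l Y.fib) = vert (Γ X.base k X.fib) ≫ τ'.pair p g := by
    rw [τ.pair_eq', τ'.pair_eq', Category.assoc, ← vert_comp, hv, vert_comp, ← Category.assoc]
    refine (congrArg (· ≫ _) (hc p.base g X.fib)).trans ?_
    rw [Category.assoc]
  { app := fun X => ⟨fun k => Γ X.base k X.fib, fun g => key (𝟙 X) g⟩
    naturality := fun X Y p => Desc.hom_ext fun k => vert_injective (by
      refine (vert_comp _ _).trans (Eq.trans ?_ (vert_comp _ _).symm)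
      refine (congrArg (· ≫ _) (τ.vert_comp₁ p k)).trans (Eq.trans ?_
        (congrArg (_ ≫ ·) (τ'.vert_comp₁ p k)).symm)
      exact key p (𝟙 k)) }

end

end Fam

end TwoLim

/-! ### Two-variable families: transport in the filtered direction -/

namespace TwoLim

namespace Fam

section

variable {K : Type u} [SmallCategory K] {A : Fam K}

/-- The fibre part of the composite is that of `p` preceded by two isomorphisms: a constraint and
the transport of the fibre part of `s`. -/
theorem W_of_W_comp {X Y Z : A.Tot} {s : X ⟶ Y} {p : Y ⟶ Z} (hs : A.W s) (h : A.W (s ≫ p)) :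
    A.W p := by
  have : IsIso s.fib := hs
  have h' : IsIso ((A.mul _ _ _ rfl X.fib).hom ≫ (A.tr p.base).map s.fib ≫ p.fib) := h
  have h1 := IsIso.of_isIso_comp_left (A.mul s.base p.base _ rfl X.fib).hom
    ((A.tr p.base).map s.fib ≫ p.fib)
  exact IsIso.of_isIso_comp_left ((A.tr p.base).map s.fib) p.fib

/-- The case of equal bases: the factor supplied by `W_fac` lies over an identity and becomes
vertical after composing with `unit⁻¹`. -/
theorem W_fac_vert {X : A.Tot} {k : K} {y z : A.obj k} {s : X ⟶ ⟨k, y⟩} (hs : A.W s)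
    (p : X ⟶ ⟨k, z⟩) (e : p.base = s.base) : ∃ φ : y ⟶ z, s ≫ vert φ = p := by
  obtain ⟨φ, hφ⟩ := W_fac hs p (𝟙 k) ((Category.comp_id _).trans e.symm)
  refine ⟨(A.unit (𝟙 k) rfl y).inv ≫ φ, ?_⟩
  rw [vert_comp, ← cart_eq_unit, ← homMk_eq, hφ]

theorem W_vert_cancel {X : A.Tot} {k : K} {y z : A.obj k} {s : X ⟶ ⟨k, y⟩} (hs : A.W s)
    {φ ψ : y ⟶ z} (h : s ≫ vert φ = s ≫ vert ψ) : φ = ψ :=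
  vert_injective (W_cancel hs rfl h)

end

variable {I K : Type u} [SmallCategory I] [SmallCategory K]

section

variable (A : Fam (I × K))

/-- The transition functors in the first direction. -/
abbrev htr {i j : I} (f : i ⟶ j) (k : K) : A.obj (i, k) ⥤ A.obj (j, k) :=
  A.tr (k := (i, k)) (l := (j, k)) (f, 𝟙 k)

/-- The transition functors in the second direction. -/
abbrev vtr (i : I) {k l : K} (g : k ⟶ l) : A.obj (i, k) ⥤ A.obj (i, l) :=
  A.tr (k := (i, k)) (l := (i, l)) (𝟙 i, g)

variable {A}

/-- The cocartesian morphisms in the first direction. -/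
abbrev hcart {i j : I} (f : i ⟶ j) {k : K} (x : A.obj (i, k)) :
    (⟨(i, k), x⟩ : A.Tot) ⟶ ⟨(j, k), (A.htr f k).obj x⟩ :=
  cart (k := (i, k)) (l := (j, k)) (f, 𝟙 k) x

/-- The cocartesian morphisms in the second direction. -/
abbrev vcart {i : I} {k l : K} (g : k ⟶ l) (x : A.obj (i, k)) :
    (⟨(i, k), x⟩ : A.Tot) ⟶ ⟨(i, l), (A.vtr i g).obj x⟩ :=
  cart (k := (i, k)) (l := (i, l)) (𝟙 i, g) x

/-- Composition of the transition functors in the first direction. -/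
def hmul {i j m : I} (f : i ⟶ j) (g : j ⟶ m) {k : K} (x : A.obj (i, k)) :
    (A.htr (f ≫ g) k).obj x ≅ (A.htr g k).obj ((A.htr f k).obj x) :=
  A.mul (k := (i, k)) (l := (j, k)) (m := (m, k)) (f, 𝟙 k) (g, 𝟙 k) (f ≫ g, 𝟙 k)
    (Prod.ext rfl (Category.comp_id _)) x

theorem hcart_hmul {i j m : I} (f : i ⟶ j) (g : j ⟶ m) {k : K} (x : A.obj (i, k)) :
    hcart (f ≫ g) x ≫ vert (hmul f g x).hom = hcart f x ≫ hcart g _ := cart_mul _ _ _ _ _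

theorem hcart_hmul_inv {i j m : I} (f : i ⟶ j) (g : j ⟶ m) {k : K} (x : A.obj (i, k)) :
    hcart f x ≫ hcart g _ ≫ vert (hmul f g x).inv = hcart (f ≫ g) x := cart_mul_inv _ _ _ _ _

theorem htr_comp_isIso {i j m : I} (f : i ⟶ j) (g : j ⟶ m) {k : K} {x y : A.obj (i, k)}
    (φ : x ⟶ y) (h : IsIso ((A.htr g k).map ((A.htr f k).map φ))) :
    IsIso ((A.htr (f ≫ g) k).map φ) := by
  have h1 : (A.htr (f ≫ g) k).map φ ≫ (hmul f g y).hom = (hmul f g x).hom ≫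
    (A.htr g k).map ((A.htr f k).map φ) := A.mul_naturality _ _ _ _ φ
  have h2 : IsIso ((A.htr (f ≫ g) k).map φ ≫ (hmul f g y).hom) := by
    rw [h1]
    infer_instance
  exact IsIso.of_isIso_comp_right _ (hmul f g y).hom

/-- Agreement at a stage persists at later stages, as required by `exists_common`; `hcart_eq_comp`
does the same for morphisms over arrows of `K`. -/
theorem htr_comp_eq {i j m : I} (f : i ⟶ j) (g : j ⟶ m) {k : K} {x y : A.obj (i, k)}
    {φ ψ : x ⟶ y} (h : (A.htr f k).map φ = (A.htr f k).map ψ) :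
    (A.htr (f ≫ g) k).map φ = (A.htr (f ≫ g) k).map ψ := by
  have h1 (φ : x ⟶ y) : (A.htr (f ≫ g) k).map φ ≫ (hmul f g y).hom = (hmul f g x).hom ≫
    (A.htr g k).map ((A.htr f k).map φ) := A.mul_naturality _ _ _ _ φ
  rw [← cancel_mono (hmul f g y).hom, h1, h1, h]

/-- Transport of morphisms along the first direction. -/
theorem exists_push {i j : I} (f : i ⟶ j) {k l : K} {x : A.obj (i, k)} {y : A.obj (i, l)}
    (g : k ⟶ l) (p : (⟨(i, k), x⟩ : A.Tot) ⟶ ⟨(i, l), y⟩) (hp : p.base = (𝟙 i, g)) :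
    ∃ p' : (⟨(j, k), (A.htr f k).obj x⟩ : A.Tot) ⟶ ⟨(j, l), (A.htr f l).obj y⟩,
      p'.base = (𝟙 j, g) ∧ hcart f x ≫ p' = p ≫ hcart f y := by
  obtain ⟨φ, hφ⟩ := W_fac (s := hcart f x) (W_cart _ _) (p ≫ hcart f y) (𝟙 j, g) (by
    rw [base_comp, hp]
    exact Prod.ext ((Category.comp_id f).trans (Category.id_comp f).symm)
      ((Category.id_comp g).trans (Category.comp_id g).symm))
  exact ⟨_, rfl, hφ⟩

theorem W_push {i j : I} {f : i ⟶ j} {k l : K} {x : A.obj (i, k)} {y : A.obj (i, l)}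
    {p : (⟨(i, k), x⟩ : A.Tot) ⟶ ⟨(i, l), y⟩}
    {p' : (⟨(j, k), (A.htr f k).obj x⟩ : A.Tot) ⟶ ⟨(j, l), (A.htr f l).obj y⟩}
    (h : hcart f x ≫ p' = p ≫ hcart f y) (hp : A.W p) : A.W p' := by
  refine W_of_W_comp (s := hcart f x) (W_cart _ _) ?_
  rw [h]
  exact MorphismProperty.comp_mem _ _ _ hp (W_cart _ _)

/-- Transport of morphisms along a further morphism in the first direction. -/
theorem exists_push_comp {i j m : I} (f : i ⟶ j) (f' : j ⟶ m) {k l : K} {x : A.obj (i, k)}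
    {y : A.obj (i, l)} (g : k ⟶ l)
    (p : (⟨(j, k), (A.htr f k).obj x⟩ : A.Tot) ⟶ ⟨(j, l), (A.htr f l).obj y⟩)
    (hp : p.base = (𝟙 j, g)) :
    ∃ p' : (⟨(m, k), (A.htr (f ≫ f') k).obj x⟩ : A.Tot) ⟶ ⟨(m, l), (A.htr (f ≫ f') l).obj y⟩,
      p'.base = (𝟙 m, g) ∧ (A.W p → A.W p') ∧ hcart (f ≫ f') x ≫ p' =
        hcart f x ≫ p ≫ hcart f' _ ≫ vert (hmul f f' y).inv := by
  obtain ⟨q, hq, hq'⟩ := exists_push f' g p hp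
  refine ⟨vert (hmul f f' x).hom ≫ q ≫ vert (hmul f f' y).inv, ?_, fun h => ?_, ?_⟩
  · rw [base_comp, base_comp, hq, base_vert, base_vert]
    exact (Category.id_comp _).trans (Category.comp_id _)
  · exact MorphismProperty.comp_mem _ _ _ (W_vert _)
      (MorphismProperty.comp_mem _ _ _ (W_push hq' h) (W_vert _))
  · rw [reassoc_of% hcart_hmul, reassoc_of% hq']

theorem hcart_eq_comp {i j m : I} (f : i ⟶ j) (f' : j ⟶ m) {k : K} {y : A.obj (i, k)} {X : A.Tot}
    {p q : X ⟶ ⟨(i, k), y⟩} (h : p ≫ hcart f y = q ≫ hcart f y) :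
    p ≫ hcart (f ≫ f') y = q ≫ hcart (f ≫ f') y := by
  rw [← hcart_hmul_inv, reassoc_of% h]

end

variable {A : Fam (I × K)} {B : Fam K}

/-- The components of a transformation to a family on the second factor. -/
abbrev Trans.lo (s : A.Trans (pull (pr2 I K) B)) (i : I) (k : K) : A.obj (i, k) ⥤ B.obj k :=
  s.ap (i, k)

/-- The action of a transformation to a family on the second factor on morphisms of total
categories. -/
def Trans.sn (s : A.Trans (pull (pr2 I K) B)) {i j : I} {k l : K} {x : A.obj (i, k)}
    {y : A.obj (j, l)} (p : (⟨(i, k), x⟩ : A.Tot) ⟶ ⟨(j, l), y⟩) :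
    (⟨k, (s.lo i k).obj x⟩ : B.Tot) ⟶ ⟨l, (s.lo j l).obj y⟩ := s.hom p

section

variable (s : A.Trans (pull (pr2 I K) B))

theorem Trans.sn_base {i j : I} {k l : K} {x : A.obj (i, k)}
    {y : A.obj (j, l)} (p : (⟨(i, k), x⟩ : A.Tot) ⟶ ⟨(j, l), y⟩) : (s.sn p).base = p.base.2 := rfl

theorem Trans.sn_id {i : I} {k : K} (x : A.obj (i, k)) : s.sn (𝟙 (⟨(i, k), x⟩ : A.Tot)) = 𝟙 _ :=
  s.hom_id _

theorem Trans.sn_comp {i j m : I} {k l n : K} {x : A.obj (i, k)} {y : A.obj (j, l)}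
    {z : A.obj (m, n)} (p : (⟨(i, k), x⟩ : A.Tot) ⟶ ⟨(j, l), y⟩)
    (q : (⟨(j, l), y⟩ : A.Tot) ⟶ ⟨(m, n), z⟩) : s.sn (p ≫ q) = s.sn p ≫ s.sn q :=
  s.hom_comp p q

theorem Trans.sn_vert {i : I} {k : K} {x y : A.obj (i, k)} (φ : x ⟶ y) :
    s.sn (vert φ) = vert ((s.lo i k).map φ) := s.hom_vert (k := (i, k)) φ

theorem Trans.W_sn {i j : I} {k l : K} {x : A.obj (i, k)}
    {y : A.obj (j, l)} {p : (⟨(i, k), x⟩ : A.Tot) ⟶ ⟨(j, l), y⟩} (hp : A.W p) : B.W (s.sn p) :=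
  s.W_hom hp

/-- The transformation presents its target as the fibrewise filtered colimit in the first
direction. -/
structure Trans.IsColim : Prop where
  surj (k : K) (z : B.obj k) : ∃ (i : I) (x : A.obj (i, k)), Nonempty ((s.lo i k).obj x ≅ z)
  full {i : I} {k : K} {x y : A.obj (i, k)} (w : (s.lo i k).obj x ⟶ (s.lo i k).obj y) :
    ∃ (j : I) (f : i ⟶ j) (v : (A.htr f k).obj x ⟶ (A.htr f k).obj y),
      s.sn (hcart f x) ≫ vert ((s.lo j k).map v) = vert w ≫ s.sn (hcart f y)
  faithful {i : I} {k : K} {x y : A.obj (i, k)} {v w : x ⟶ y}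
    (h : (s.lo i k).map v = (s.lo i k).map w) :
    ∃ (j : I) (f : i ⟶ j), (A.htr f k).map v = (A.htr f k).map w

variable {s}

namespace Trans.IsColim

variable (hs : s.IsColim)
include hs

/-- Split `w` as the image of a cocartesian lift of `g` followed by a vertical morphism `ω`.
Fibrewise fullness realises `ω` at a later stage, and the composite factors through the cocartesian
`hcart f x`. -/
theorem exists_hom {i : I} {k l : K} {x : A.obj (i, k)} {y : A.obj (i, l)} (g : k ⟶ l)
    (w : (⟨k, (s.lo i k).obj x⟩ : B.Tot) ⟶ ⟨l, (s.lo i l).obj y⟩) (hw : w.base = g) :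
    ∃ (j : I) (f : i ⟶ j)
      (p : (⟨(j, k), (A.htr f k).obj x⟩ : A.Tot) ⟶ ⟨(j, l), (A.htr f l).obj y⟩),
      p.base = (𝟙 j, g) ∧ s.sn (hcart f x) ≫ s.sn p = w ≫ s.sn (hcart f y) := by
  obtain ⟨ω, hω⟩ := W_fac_vert (s.W_sn (W_cart (k := (i, k)) (l := (i, l)) (𝟙 i, g) x)) w hw
  obtain ⟨j, f, v, hv⟩ := hs.full ω
  obtain ⟨φ, hφ⟩ := W_fac (s := hcart f x) (W_cart _ _) (vcart g x ≫ hcart f _ ≫ vert v) (𝟙 j, g) (by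
    rw [base_comp, base_comp, base_vert]
    refine Prod.ext ?_ ?_
    · exact (Category.comp_id f).trans ((Category.id_comp _).trans (Category.comp_id f)).symm
    · exact (Category.id_comp g).trans ((congrArg (g ≫ ·) (Category.id_comp _)).trans
        (Category.comp_id g)).symm)
  refine ⟨j, f, homMk (k := (j, k)) (l := (j, l)) (𝟙 j, g) φ, rfl, ?_⟩
  rw [← s.sn_comp]
  refine (congrArg s.sn hφ).trans ?_
  rw [s.sn_comp, s.sn_comp, s.sn_vert, hv, ← hω, Category.assoc]

/-- Morphisms with a common base differ only in their vertical parts. The image of the common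
cocartesian part cancels, so fibrewise faithfulness applies. -/
theorem exists_eq {i j : I} {k l : K} {x : A.obj (i, k)} {y : A.obj (j, l)}
    {p q : (⟨(i, k), x⟩ : A.Tot) ⟶ ⟨(j, l), y⟩} (hb : p.base = q.base) (h : s.sn p = s.sn q) :
    ∃ (m : I) (f : j ⟶ m), p ≫ hcart f y = q ≫ hcart f y := by
  obtain ⟨b, φ⟩ := p
  obtain ⟨b', ψ⟩ := q
  obtain rfl : b = b' := hb
  have h' : s.sn (homMk b φ) = s.sn (homMk b ψ) := h
  rw [homMk_eq, homMk_eq, s.sn_comp, s.sn_comp, s.sn_vert, s.sn_vert] at h'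
  obtain ⟨m, f, hf⟩ := hs.faithful (W_vert_cancel (s.W_sn (W_cart _ _)) h')
  refine ⟨m, f, ?_⟩
  change homMk b φ ≫ _ = homMk b ψ ≫ _
  rw [homMk_eq, homMk_eq, Category.assoc, Category.assoc, vert_cart, vert_cart, hf]

/-- The inverse is realised by some `ψ` at a later stage; the two identities making `ψ` an inverse
each hold later still, and a common stage exists. -/
theorem exists_isIso [IsFiltered I] {i : I} {k : K} {x y : A.obj (i, k)} (φ : x ⟶ y)
    (hφ : IsIso ((s.lo i k).map φ)) : ∃ (j : I) (f : i ⟶ j), IsIso ((A.htr f k).map φ) := by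
  obtain ⟨j, f, ψ, hψ⟩ := hs.full (inv ((s.lo i k).map φ))
  have h1 : s.sn (hcart f x) ≫ vert ((s.lo j k).map ((A.htr f k).map φ)) =
      vert ((s.lo i k).map φ) ≫ s.sn (hcart f y) := by
    rw [← s.sn_vert, ← s.sn_vert, ← s.sn_comp, ← s.sn_comp, vert_cart]
  obtain ⟨m, g, hg⟩ := hs.faithful (v := (A.htr f k).map φ ≫ ψ) (w := 𝟙 _) (by
    refine W_vert_cancel (s.W_sn (W_cart (k := (i, k)) (l := (j, k)) (f, 𝟙 k) x)) ?_
    rw [Functor.map_comp, vert_comp, reassoc_of% h1, hψ, ← Category.assoc, ← vert_comp,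
      IsIso.hom_inv_id, vert_id, CategoryTheory.Functor.map_id, vert_id, Category.id_comp,
      Category.comp_id])
  obtain ⟨n, h, hh⟩ := hs.faithful (v := ψ ≫ (A.htr f k).map φ) (w := 𝟙 _) (by
    refine W_vert_cancel (s.W_sn (W_cart (k := (i, k)) (l := (j, k)) (f, 𝟙 k) y)) ?_
    rw [Functor.map_comp, vert_comp, reassoc_of% hψ, h1, ← Category.assoc, ← vert_comp,
      IsIso.inv_hom_id, vert_id, CategoryTheory.Functor.map_id, vert_id, Category.id_comp,
      Category.comp_id])
  obtain ⟨r, a, b, hab⟩ := IsFiltered.span g h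
  have h2 := htr_comp_eq g a hg
  have h3 := htr_comp_eq h b hh
  rw [← hab] at h3
  refine ⟨r, f ≫ g ≫ a, htr_comp_isIso f (g ≫ a) φ ?_⟩
  rw [Functor.map_comp, CategoryTheory.Functor.map_id] at h2 h3
  exact ⟨_, h2, h3⟩

/-- The vertical part of `p` becomes invertible in the colimit, so it is already invertible after
transport to some stage. -/
theorem exists_W [IsFiltered I] {i : I} {k l : K} {x : A.obj (i, k)} {y : A.obj (i, l)} (g : k ⟶ l)
    (p : (⟨(i, k), x⟩ : A.Tot) ⟶ ⟨(i, l), y⟩) (hp : p.base = (𝟙 i, g)) (hW : B.W (s.sn p)) :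
    ∃ (j : I) (f : i ⟶ j)
      (p' : (⟨(j, k), (A.htr f k).obj x⟩ : A.Tot) ⟶ ⟨(j, l), (A.htr f l).obj y⟩),
      p'.base = (𝟙 j, g) ∧ A.W p' ∧ hcart f x ≫ p' = p ≫ hcart f y := by
  obtain ⟨φ, hφ⟩ := W_fac_vert (s := vcart g x) (W_cart _ _) p hp
  have h1 : B.W (vert ((s.lo i l).map φ)) := by
    refine W_of_W_comp (s.W_sn (W_cart (k := (i, k)) (l := (i, l)) (𝟙 i, g) x)) ?_
    rw [← s.sn_vert, ← s.sn_comp]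
    exact (congrArg (fun z => B.W (s.sn z)) hφ).mpr hW
  obtain ⟨j, f, hf⟩ := hs.exists_isIso φ (isIso_of_W_vert h1)
  obtain ⟨p', hp', h⟩ := exists_push f g p hp
  refine ⟨j, f, p', hp', ?_, h⟩
  refine W_of_W_comp (s := hcart f x) (W_cart _ _) ?_
  rw [h, ← hφ, Category.assoc, vert_cart]
  exact MorphismProperty.comp_mem _ _ _ (W_cart _ _)
    (MorphismProperty.comp_mem _ _ _ (W_cart _ _) (W_vert _))

end Trans.IsColim

end

end Fam

end TwoLim

/-! ### Filtered colimits commute with finite limits -/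

namespace TwoLim

namespace Fam

variable {I K : Type u} [SmallCategory I] [SmallCategory K] {E : Fam I} {A : Fam (I × K)}
  {B : Fam K}

/-- The components of a transformation from a family on the first factor. -/
abbrev Trans.fr (t : (pull (pr1 I K) E).Trans A) (i : I) (k : K) : E.obj i ⥤ A.obj (i, k) :=
  t.ap (i, k)

/-- The action of a transformation from a family on the first factor on pairs of morphisms. -/
def Trans.pr (t : (pull (pr1 I K) E).Trans A) {i j : I} {x : E.obj i} {y : E.obj j}
    (p : (⟨i, x⟩ : E.Tot) ⟶ ⟨j, y⟩) {k l : K} (g : k ⟶ l) :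
    (⟨(i, k), (t.fr i k).obj x⟩ : A.Tot) ⟶ ⟨(j, l), (t.fr j l).obj y⟩ :=
  t.tot.map (prodHom p g)

section

variable (t : (pull (pr1 I K) E).Trans A)

theorem Trans.pr_comp {i j m : I} {x : E.obj i} {y : E.obj j} {z : E.obj m}
    (p : (⟨i, x⟩ : E.Tot) ⟶ ⟨j, y⟩) (q : (⟨j, y⟩ : E.Tot) ⟶ ⟨m, z⟩) {k l n : K} (g : k ⟶ l)
    (h : l ⟶ n) : t.pr (p ≫ q) (g ≫ h) = t.pr p g ≫ t.pr q h :=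
  t.tot.map_comp (prodHom p g) (prodHom q h)

theorem Trans.pr_vert {i : I} {x y : E.obj i} (φ : x ⟶ y) (k : K) :
    t.pr (vert φ) (𝟙 k) = vert ((t.fr i k).map φ) := t.tot_map_vert (k := (i, k)) φ

theorem Trans.W_pr {i j : I} {x : E.obj i} {y : E.obj j} {p : (⟨i, x⟩ : E.Tot) ⟶ ⟨j, y⟩}
    (hp : E.W p) {k l : K} (g : k ⟶ l) : A.W (t.pr p g) := t.W_tot (W_prodHom hp g)

/-- The structure morphisms of the descent datum of an object. -/
abbrev Trans.mor {i : I} (x : E.obj i) {k l : K} (g : k ⟶ l) :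
    (⟨(i, k), (t.fr i k).obj x⟩ : A.Tot) ⟶ ⟨(i, l), (t.fr i l).obj x⟩ :=
  t.pr (𝟙 (⟨i, x⟩ : E.Tot)) g

/-- The images of cocartesian morphisms. -/
abbrev Trans.shift {i j : I} (f : i ⟶ j) (x : E.obj i) (k : K) :
    (⟨(i, k), (t.fr i k).obj x⟩ : A.Tot) ⟶ ⟨(j, k), (t.fr j k).obj ((E.tr f).obj x)⟩ :=
  t.pr (cart f x) (𝟙 k)

/-- Both sides are the value of `t` at the same pair of arrows: transport to a later stage respects
descent structure. -/
theorem Trans.mor_shift {i j : I} (f : i ⟶ j) (x : E.obj i) {k l : K} (g : k ⟶ l) :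
    t.mor x g ≫ t.shift f x l = t.shift f x k ≫ t.mor _ g := by
  rw [← pr_comp, ← pr_comp, Category.id_comp, Category.comp_id, Category.id_comp, Category.comp_id]

theorem Trans.W_shift {i j : I} (f : i ⟶ j) (x : E.obj i) (k : K) : A.W (t.shift f x k) :=
  t.W_pr (W_cart f x) _

theorem Trans.shift_comp {i j m : I} (f : i ⟶ j) (f' : j ⟶ m) (x : E.obj i) (k : K) :
    t.shift (f ≫ f') x k ≫ vert ((t.fr m k).map (E.mul f f' _ rfl x).hom) =
      t.shift f x k ≫ t.shift f' _ k := by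
  rw [← pr_vert, ← pr_comp, cart_mul, Category.comp_id, ← pr_comp, Category.comp_id]

/-- The comparison of the images of cocartesian morphisms with cocartesian morphisms. -/
def Trans.shiftIso {i j : I} (f : i ⟶ j) (x : E.obj i) (k : K) :
    (t.fr j k).obj ((E.tr f).obj x) ≅ (A.htr f k).obj ((t.fr i k).obj x) :=
  t.nat (k := (i, k)) (l := (j, k)) (f, 𝟙 k) x

theorem Trans.shift_shiftIso {i j : I} (f : i ⟶ j) (x : E.obj i) (k : K) :
    t.shift f x k ≫ vert (t.shiftIso f x k).hom = hcart f ((t.fr i k).obj x) :=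
  (congrArg (· ≫ _) (t.tot_map_cart (k := (i, k)) (l := (j, k)) (f, 𝟙 k) x)).trans
    (t.N_hom (k := (i, k)) (l := (j, k)) (f, 𝟙 k) x)

theorem Trans.hcart_shiftIso {i j : I} (f : i ⟶ j) (x : E.obj i) (k : K) :
    hcart f ((t.fr i k).obj x) ≫ vert (t.shiftIso f x k).inv = t.shift f x k := by
  rw [← shift_shiftIso, Category.assoc, ← vert_comp, Iso.hom_inv_id, vert_id, Category.comp_id]

/-- The transformation presents its source as the limit in the second direction. -/
structure Trans.IsLim : Prop where
  faithful {i : I} {x y : E.obj i} {v w : x ⟶ y}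
    (h : ∀ k, (t.fr i k).map v = (t.fr i k).map w) : v = w
  full {i : I} {x y : E.obj i} (v : ∀ k, (t.fr i k).obj x ⟶ (t.fr i k).obj y)
    (h : ∀ {k l : K} (g : k ⟶ l), t.mor x g ≫ vert (v l) = vert (v k) ≫ t.mor y g) :
    ∃ w : x ⟶ y, ∀ k, (t.fr i k).map w = v k
  surj {i : I} (y : ∀ k, A.obj (i, k))
    (m : ∀ {k l : K} (_ : k ⟶ l), (⟨(i, k), y k⟩ : A.Tot) ⟶ ⟨(i, l), y l⟩)
    (hb : ∀ {k l : K} (g : k ⟶ l), (m g).base = (𝟙 i, g))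
    (hW : ∀ {k l : K} (g : k ⟶ l), A.W (m g))
    (hid : ∀ k, m (𝟙 k) = 𝟙 _)
    (hcomp : ∀ {k l n : K} (g : k ⟶ l) (h : l ⟶ n), m (g ≫ h) = m g ≫ m h) :
    ∃ (x : E.obj i) (γ : ∀ k, (t.fr i k).obj x ≅ y k),
      ∀ {k l : K} (g : k ⟶ l), t.mor x g ≫ vert (γ l).hom = vert (γ k).hom ≫ m g

variable {t} {s : A.Trans (pull (pr2 I K) B)} (ht : t.IsLim) (hs : s.IsColim)
include ht

theorem Trans.IsLim.map_eq {i j : I} (f : i ⟶ j) {x y : E.obj i} {v w : x ⟶ y}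
    (h : ∀ k, (A.htr f k).map ((t.fr i k).map v) = (A.htr f k).map ((t.fr i k).map w)) :
    (E.tr f).map v = (E.tr f).map w := by
  refine ht.faithful fun k => ?_
  have h1 (v : x ⟶ y) : (t.fr j k).map ((E.tr f).map v) ≫ (t.shiftIso f y k).hom =
    (t.shiftIso f x k).hom ≫ (A.htr f k).map ((t.fr i k).map v) :=
      t.naturality (k := (i, k)) (l := (j, k)) (f, 𝟙 k) v
  rw [← cancel_mono (t.shiftIso f y k).hom, h1, h1, h]

include hs
variable [IsFiltered I] [FinCategory K]

/-- For each of the finitely many objects of `K` the components agree at some stage; at a common one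
they all agree, and the limit is jointly faithful. -/
theorem exists_map_eq {i : I} {x y : E.obj i} {v w : x ⟶ y}
    (h : ∀ k, (s.lo i k).map ((t.fr i k).map v) = (s.lo i k).map ((t.fr i k).map w)) :
    ∃ (j : I) (f : i ⟶ j), (E.tr f).map v = (E.tr f).map w := by
  obtain ⟨j, f, hf⟩ := exists_common (T := K)
    (fun k {j} f => (A.htr f k).map ((t.fr i k).map v) = (A.htr f k).map ((t.fr i k).map w))
    (fun k {j m} f g h => htr_comp_eq f g h) (fun k => hs.faithful (h k))
  exact ⟨j, f, ht.map_eq f hf⟩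

/-- Lifting of morphisms, up to transport along the first direction. -/
theorem exists_lift_hom {i : I} {x y : E.obj i}
    (v : ∀ k, (t.fr i k).obj x ⟶ (t.fr i k).obj y)
    (h : ∀ {k l : K} (g : k ⟶ l), s.sn (t.mor x g ≫ vert (v l)) = s.sn (vert (v k) ≫ t.mor y g)) :
    ∃ (j : I) (f : i ⟶ j) (w : (E.tr f).obj x ⟶ (E.tr f).obj y), ∀ k,
      t.shift f x k ≫ vert ((t.fr j k).map w) = vert (v k) ≫ t.shift f y k := by
  -- One compatibility square for each arrow of `K`; there are finitely many, so all of them commute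
  -- at one stage.
  obtain ⟨j, f, hf⟩ := exists_common (T := Σ k l : K, k ⟶ l)
    (fun g {j} f => (t.mor x g.2.2 ≫ vert (v g.2.1)) ≫ hcart f _ =
      (vert (v g.1) ≫ t.mor y g.2.2) ≫ hcart f _)
    (fun g {j m} f f' h => hcart_eq_comp f f' h) (fun g => hs.exists_eq (by
      rw [base_comp, base_comp, base_vert, base_vert]
      exact (Category.comp_id _).trans (Category.id_comp _).symm) (h g.2.2))
  have hf' {k l : K} (g : k ⟶ l) : t.mor x g ≫ vert (v l) ≫ t.shift f y l =
      vert (v k) ≫ t.mor y g ≫ t.shift f y l := by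
    have := congrArg (· ≫ vert (t.shiftIso f y l).inv) (hf ⟨k, l, g⟩)
    simp only [Category.assoc] at this
    rwa [t.hcart_shiftIso] at this
  -- The transports of the `v k` to stage `j`, determined by the cocartesian shift morphisms.
  choose w hw using fun k => W_fac_vert (t.W_shift f x k) (vert (v k) ≫ t.shift f y k) (by
    rw [base_comp, base_vert]
    exact Category.id_comp _)
  obtain ⟨w', hw'⟩ := ht.full w (fun {k l} g => by
    refine W_cancel (t.W_shift f x k) ?_ ?_
    · rw [base_comp, base_comp, base_vert, base_vert]
      exact (Category.comp_id _).trans (Category.id_comp _).symm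
    · rw [← Category.assoc, ← t.mor_shift, Category.assoc, hw, hf', reassoc_of% hw, t.mor_shift])
  exact ⟨j, f, w', fun k => by rw [hw', hw]⟩

/-- Two successive moves to a later stage are used. The first realises the finitely many components
of `w`. The second, by `exists_lift_hom`, makes them compatible with descent structure, so that they
come from the limit. -/
theorem exists_full {i : I} {x y : E.obj i}
    (w : ∀ k, (s.lo i k).obj ((t.fr i k).obj x) ⟶ (s.lo i k).obj ((t.fr i k).obj y))
    (h : ∀ {k l : K} (g : k ⟶ l), s.sn (t.mor x g) ≫ vert (w l) = vert (w k) ≫ s.sn (t.mor y g)) :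
    ∃ (j : I) (f : i ⟶ j) (v : (E.tr f).obj x ⟶ (E.tr f).obj y), ∀ k,
      s.sn (t.shift f x k) ≫ vert ((s.lo j k).map ((t.fr j k).map v)) =
        vert (w k) ≫ s.sn (t.shift f y k) := by
  obtain ⟨j, f, hf⟩ := exists_common (T := K)
    (fun k {j} f => ∃ p : (⟨(j, k), (A.htr f k).obj ((t.fr i k).obj x)⟩ : A.Tot) ⟶
        ⟨(j, k), (A.htr f k).obj ((t.fr i k).obj y)⟩, p.base = (𝟙 j, 𝟙 k) ∧
        s.sn (hcart f _) ≫ s.sn p = vert (w k) ≫ s.sn (hcart f _))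
    (fun k {j m} f f' h => by
      obtain ⟨p, hp, hp'⟩ := h
      obtain ⟨q, hq, -, hq'⟩ := exists_push_comp f f' (𝟙 k) p hp
      refine ⟨q, hq, ?_⟩
      rw [← s.sn_comp, hq', s.sn_comp, s.sn_comp, reassoc_of% hp', ← s.sn_comp, hcart_hmul_inv])
    (fun k => hs.exists_hom (𝟙 k) (vert (w k)) rfl)
  choose p hp hp' using hf
  choose v hv using fun k => W_fac_vert (t.W_shift f x k)
    (hcart f _ ≫ p k ≫ vert (t.shiftIso f y k).inv) (by
      rw [base_comp, base_comp, hp, base_vert]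
      exact Prod.ext ((congrArg (f ≫ ·) (Category.comp_id _)).trans (Category.comp_id _))
        ((congrArg (𝟙 k ≫ ·) (Category.comp_id _)).trans (Category.comp_id _)))
  have hv' (k : K) : s.sn (t.shift f x k) ≫ s.sn (vert (v k)) =
      vert (w k) ≫ s.sn (t.shift f y k) := by
    rw [← s.sn_comp, hv, s.sn_comp, s.sn_comp, reassoc_of% hp', ← s.sn_comp, t.hcart_shiftIso]
  -- The lifted components are compatible only after applying `s`: this follows from the
  -- compatibility of `w` by cancelling the image of the shift.
  obtain ⟨m, f', v', hv''⟩ := exists_lift_hom ht hs v (fun {k l} g => by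
    refine W_cancel (s.W_sn (t.W_shift f x k)) ?_ ?_
    · rw [s.sn_base, s.sn_base, base_comp, base_comp, base_vert, base_vert]
      exact (Category.comp_id _).trans (Category.id_comp _).symm
    · rw [← s.sn_comp, ← Category.assoc, ← t.mor_shift, Category.assoc, s.sn_comp, s.sn_comp, hv',
        reassoc_of% h, ← s.sn_comp, t.mor_shift, s.sn_comp (t.shift f y k), s.sn_comp (vert (v k)),
        reassoc_of% hv'])
  have e (x : E.obj i) (k : K) : s.sn (t.shift (f ≫ f') x k) ≫
      vert ((s.lo m k).map ((t.fr m k).map (E.mul f f' _ rfl x).hom)) =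
      s.sn (t.shift f x k) ≫ s.sn (t.shift f' _ k) := by
    rw [← s.sn_vert, ← s.sn_comp, t.shift_comp, s.sn_comp]
  refine ⟨m, f ≫ f', (E.mul f f' _ rfl x).hom ≫ v' ≫ (E.mul f f' _ rfl y).inv, fun k => ?_⟩
  have h1 : s.sn (t.shift f' _ k) ≫ vert ((s.lo m k).map ((t.fr m k).map v')) =
      s.sn (vert (v k)) ≫ s.sn (t.shift f' _ k) := by
    rw [← s.sn_vert, ← s.sn_comp, hv'', s.sn_comp]
  rw [Functor.map_comp, Functor.map_comp, Functor.map_comp, Functor.map_comp, vert_comp, vert_comp,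
    reassoc_of% e, reassoc_of% h1, reassoc_of% hv', ← reassoc_of% e, ← vert_comp,
    ← Functor.map_comp, ← Functor.map_comp, Iso.hom_inv_id, CategoryTheory.Functor.map_id,
    CategoryTheory.Functor.map_id, vert_id, Category.comp_id]

-- Replacing an object by its transport in the `I` direction does not change its image, because
-- `hcart` is sent to a cocartesian morphism over an identity of `K`.
omit ht hs [IsFiltered I] [FinCategory K] in
theorem exists_shift_iso {i j : I} (f : i ⟶ j) {k : K} {x : A.obj (i, k)} {z : B.obj k}
    (β : (s.lo i k).obj x ≅ z) : ∃ β' : (s.lo j k).obj ((A.htr f k).obj x) ≅ z,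
      s.sn (hcart f x) ≫ vert β'.hom = vert β.hom := by
  obtain ⟨φ, hφ⟩ := W_fac_vert (s.W_sn (W_cart (k := (i, k)) (l := (j, k)) (f, 𝟙 k) x))
    (vert β.hom) rfl
  have hW : B.W (vert φ) := by
    refine W_of_W_comp (s.W_sn (W_cart (k := (i, k)) (l := (j, k)) (f, 𝟙 k) x)) ?_
    rw [hφ]
    exact W_vert _
  have := isIso_of_W_vert hW
  exact ⟨asIso φ, hφ⟩

omit ht in
/-- Objects of the fibres over a common object of the first factor. -/
theorem exists_obj_common (c : ∀ k, B.obj k) :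
    ∃ (i : I) (x : ∀ k, A.obj (i, k)), ∀ k, Nonempty ((s.lo i k).obj (x k) ≅ c k) := by
  classical
  choose i x hx using fun k => hs.surj k (c k)
  obtain ⟨j, hj⟩ := IsFiltered.sup_objs_exists (Finset.univ.image i)
  have f (k : K) : Nonempty (i k ⟶ j) := hj (Finset.mem_image_of_mem _ (Finset.mem_univ k))
  refine ⟨j, fun k => (A.htr (f k).some k).obj (x k), fun k => ?_⟩
  obtain ⟨φ, -⟩ := exists_shift_iso (s := s) (f k).some (hx k).some
  exact ⟨φ⟩

-- Only objects and individual structure morphisms are lifted at this point; identity, cocycle and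
-- invertibility conditions may still fail at stage `i`.
omit ht in
theorem exists_family (c : Desc B) : ∃ (i : I) (x : ∀ k, A.obj (i, k))
    (β : ∀ k, (s.lo i k).obj (x k) ≅ c.obj k)
    (m : ∀ {k l : K} (_ : k ⟶ l), (⟨(i, k), x k⟩ : A.Tot) ⟶ ⟨(i, l), x l⟩),
    (∀ {k l : K} (g : k ⟶ l), (m g).base = (𝟙 i, g)) ∧
    (∀ {k l : K} (g : k ⟶ l), s.sn (m g) ≫ vert (β l).hom = vert (β k).hom ≫ c.mor g) := by
  obtain ⟨i, x, β⟩ := exists_obj_common hs c.obj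
  have β k := (β k).some
  obtain ⟨j, f, hf⟩ := exists_common (T := Σ k l : K, k ⟶ l)
    (fun g {j} f => ∃ p : (⟨(j, g.1), (A.htr f g.1).obj (x g.1)⟩ : A.Tot) ⟶
        ⟨(j, g.2.1), (A.htr f g.2.1).obj (x g.2.1)⟩, p.base = (𝟙 j, g.2.2) ∧
        s.sn (hcart f _) ≫ s.sn p =
          (vert (β g.1).hom ≫ c.mor g.2.2 ≫ vert (β g.2.1).inv) ≫ s.sn (hcart f _))
    (fun g {j m} f f' h => by
      obtain ⟨p, hp, hp'⟩ := h
      obtain ⟨q, hq, -, hq'⟩ := exists_push_comp f f' g.2.2 p hp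
      refine ⟨q, hq, ?_⟩
      rw [← s.sn_comp, hq', s.sn_comp, s.sn_comp, reassoc_of% hp', ← s.sn_comp, hcart_hmul_inv]
      simp only [Category.assoc])
    (fun g => hs.exists_hom g.2.2 _ (by
      rw [base_comp, base_comp, base_vert, base_vert]
      exact (Category.id_comp _).trans (Category.comp_id _)))
  choose m hm hm' using hf
  choose γ hγ using fun k => exists_shift_iso (s := s) f (β k)
  refine ⟨j, _, γ, fun {k l} g => m ⟨k, l, g⟩, fun {k l} g => hm ⟨k, l, g⟩,
    fun {k l} g => ?_⟩
  refine W_cancel (s.W_sn (W_cart (k := (i, k)) (l := (j, k)) (f, 𝟙 k) (x k))) ?_ ?_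
  · rw [base_comp, base_comp, base_vert, base_vert, s.sn_base, hm]
    exact (Category.comp_id _).trans (Category.id_comp _).symm
  · have h1 := reassoc_of% hm' ⟨k, l, g⟩
    rw [reassoc_of% hγ]
    refine (h1 _).trans ?_
    rw [hγ, ← vert_comp, Iso.inv_hom_id, vert_id, Category.comp_id]

/-- The family lifted by `exists_family` satisfies the axioms of a descent datum after applying `s`.
These are finitely many conditions, so they hold at a later stage `j`, where the limit property
converts the family into an object of `E`. -/
theorem exists_obj (c : Desc B) : ∃ (i : I) (x : E.obj i)
    (γ : ∀ k, (s.lo i k).obj ((t.fr i k).obj x) ≅ c.obj k),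
    ∀ {k l : K} (g : k ⟶ l), s.sn (t.mor x g) ≫ vert (γ l).hom = vert (γ k).hom ≫ c.mor g := by
  obtain ⟨i, x, β, m, hm, hm'⟩ := exists_family hs c
  have hmW {k l : K} (g : k ⟶ l) : B.W (s.sn (m g)) := by
    have h : s.sn (m g) = vert (β k).hom ≫ c.mor g ≫ vert (β l).inv := by
      rw [← reassoc_of% hm', ← vert_comp, Iso.hom_inv_id, vert_id, Category.comp_id]
    rw [h]
    exact MorphismProperty.comp_mem _ _ _ (W_vert _)
      (MorphismProperty.comp_mem _ _ _ (W_homMk _ _) (W_vert _))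
  have hmono {X : B.Tot} {k : K} {p q : X ⟶ ⟨k, (s.lo i k).obj (x k)⟩}
      (h : p ≫ vert (β k).hom = q ≫ vert (β k).hom) : p = q := (cancel_mono _).1 h
  obtain ⟨j, f, hf⟩ := exists_common
    -- One condition for each arrow (a cocartesian transport exists), each object (identity law) and
    -- each composable pair (cocycle law).
    (T := (Σ k l : K, k ⟶ l) ⊕ K ⊕ (Σ k l n : K, (k ⟶ l) × (l ⟶ n)))
    (fun t {j} f => match t with
      | .inl g => ∃ p : (⟨(j, g.1), (A.htr f g.1).obj (x g.1)⟩ : A.Tot) ⟶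
        ⟨(j, g.2.1), (A.htr f g.2.1).obj (x g.2.1)⟩, p.base = (𝟙 j, g.2.2) ∧ A.W p ∧
        hcart f _ ≫ p = m g.2.2 ≫ hcart f _
      | .inr (.inl k) => m (𝟙 k) ≫ hcart f (x k) = 𝟙 _ ≫ hcart f (x k)
      | .inr (.inr g) => m (g.2.2.2.1 ≫ g.2.2.2.2) ≫ hcart f (x g.2.2.1) =
          (m g.2.2.2.1 ≫ m g.2.2.2.2) ≫ hcart f (x g.2.2.1))
    (by
      rintro (g | k | g) j n f f' h
      · obtain ⟨p, hp, hW, hp'⟩ := h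
        obtain ⟨q, hq, hqW, hq'⟩ := exists_push_comp f f' g.2.2 p hp
        refine ⟨q, hq, hqW hW, ?_⟩
        rw [hq', reassoc_of% hp', hcart_hmul_inv]
      · exact hcart_eq_comp f f' h
      · exact hcart_eq_comp f f' h)
    (by
      rintro (g | k | g)
      · exact hs.exists_W g.2.2 _ (hm g.2.2) (hmW g.2.2)
      · exact hs.exists_eq (hm _) (hmono (by
          rw [hm', c.mor_id, s.sn_id, Category.comp_id, Category.id_comp]))
      · exact hs.exists_eq (by
          rw [base_comp, hm, hm, hm]
          exact Prod.ext (Category.comp_id _).symm rfl) (hmono (by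
          rw [hm', c.mor_comp, s.sn_comp, Category.assoc, hm', reassoc_of% hm'])))
  choose p hp hpW hp' using fun g => hf (.inl g)
  have hid (k : K) : m (𝟙 k) ≫ hcart f (x k) = 𝟙 _ ≫ hcart f (x k) := hf (.inr (.inl k))
  have hcomp {k l n : K} (g : k ⟶ l) (h : l ⟶ n) :
    m (g ≫ h) ≫ hcart f (x n) = (m g ≫ m h) ≫ hcart f (x n) := hf (.inr (.inr ⟨k, l, n, g, h⟩))
  have hp₁ {k l : K} (g : k ⟶ l) : hcart f (x k) ≫ p ⟨k, l, g⟩ = m g ≫ hcart f (x l) := hp' _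
  -- The laws for the transported morphisms `p` follow from `hid` and `hcomp` by cancelling the
  -- cocartesian `hcart f`.
  obtain ⟨e, γ, hγ⟩ := ht.surj (fun k => (A.htr f k).obj (x k)) (fun {k l} g => p ⟨k, l, g⟩)
    (fun g => hp _) (fun g => hpW _)
    (fun k => W_cancel (s := hcart f (x k)) (W_cart _ _) (hp _) (by
      rw [hp₁, hid, Category.comp_id, Category.id_comp]))
    (fun {k l n} g h => W_cancel (s := hcart f (x k)) (W_cart _ _) (by
      rw [base_comp, hp, hp, hp]
      exact Prod.ext (Category.comp_id _).symm rfl) (by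
      rw [hp₁, hcomp, Category.assoc, ← hp₁ h, ← Category.assoc, ← hp₁ g, Category.assoc]))
  choose β' hβ' using fun k => exists_shift_iso (s := s) f (β k)
  have hβ'' {k l : K} (g : k ⟶ l) : s.sn (p ⟨k, l, g⟩) ≫ vert (β' l).hom =
      vert (β' k).hom ≫ c.mor g := by
    refine W_cancel (s.W_sn (W_cart (k := (i, k)) (l := (j, k)) (f, 𝟙 k) (x k))) ?_ ?_
    · rw [base_comp, base_comp, base_vert, base_vert, s.sn_base, hp]
      exact (Category.comp_id _).trans (Category.id_comp _).symm
    · rw [reassoc_of% hβ', ← hm', ← Category.assoc, ← s.sn_comp, hp₁, s.sn_comp, Category.assoc, hβ']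
  refine ⟨j, e, fun k => (s.lo j k).mapIso (γ k) ≪≫ β' k, fun {k l} g => ?_⟩
  simp only [Iso.trans_hom, Functor.mapIso_hom, vert_comp]
  rw [← s.sn_vert, ← s.sn_vert, ← Category.assoc, ← s.sn_comp, hγ, s.sn_comp, Category.assoc, Category.assoc,
    hβ'']

omit [IsFiltered I] [FinCategory K] ht hs in
theorem Trans.comp_pair (t : (pull (pr1 I K) E).Trans A) (s : A.Trans (pull (pr2 I K) B)) {i j : I}
    {x : E.obj i} {y : E.obj j} (p : (⟨i, x⟩ : E.Tot) ⟶ ⟨j, y⟩) {k l : K} (g : k ⟶ l) :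
    (t.comp s).pair p g = s.sn (t.pr p g) :=
  congrArg (pullTot (pr2 I K) B).map (t.comp_tot_map s (prodHom p g))

/-- The comparison functor from the family of limits to the limit of the colimits presents its
target as the filtered colimit of the limits. -/
theorem isColim_toDesc : Fam.IsColim (t.comp s).toDesc where
  isIso f x := (t.comp s).isIso_toDesc_map (W_cart f x)
  surj c := by
    obtain ⟨i, x, γ, hγ⟩ := exists_obj ht hs c
    exact ⟨⟨i, x⟩, ⟨Desc.isoMk γ fun g =>
      (congrArg (· ≫ _) (t.comp_pair s (𝟙 (⟨i, x⟩ : E.Tot)) g)).trans (hγ g)⟩⟩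
  full {i x y} w := by
    obtain ⟨j, f, v, hv⟩ := exists_full ht hs (x := x) (y := y) (fun k => w.app k) (fun g =>
      (congrArg (· ≫ _) (t.comp_pair s (𝟙 (⟨i, x⟩ : E.Tot)) g)).symm.trans ((w.comm g).trans
        (congrArg (_ ≫ ·) (t.comp_pair s (𝟙 (⟨i, y⟩ : E.Tot)) g))))
    refine ⟨j, f, v, Desc.hom_ext fun k => vert_injective ?_⟩
    refine (vert_comp _ _).trans (Eq.trans ?_ (vert_comp _ _).symm)
    refine Eq.trans (congrArg₂ (· ≫ ·) (((t.comp s).vert_comp₁ (cart f x) k).trans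
      (t.comp_pair s (cart f x) (𝟙 k))) (congrArg vert ((t.comp s).toDesc_map_vert_app v k))) ?_
    exact (hv k).trans (congrArg (_ ≫ ·) (((t.comp s).vert_comp₁ (cart f y) k).trans
      (t.comp_pair s (cart f y) (𝟙 k))).symm)
  faithful {i x y v w} h := exists_map_eq ht hs fun k =>
    ((t.comp s).toDesc_map_vert_app v k).symm.trans
      ((congrArg (fun z => Desc.Hom.app z k) h).trans ((t.comp s).toDesc_map_vert_app w k))

end

end Fam

end TwoLim

/-! ### Translation of the 2-natural data -/

namespace TwoLim

open Fam

variable {I K : Type u} [SmallCategory I] [SmallCategory K] {a : Diagram (I × K)}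
  {D : Diagram I} {C : Diagram K}

/-- A transformation to a diagram on the second factor, in terms of objects and morphisms. -/
def transSnd (ι : a ⟶ ofSnd C) : (fam a).Trans (Fam.pull (pr2 I K) (fam C)) where
  ap := (trans ι).ap
  nat := (trans ι).nat
  naturality := (trans ι).naturality
  nat_unit e he x := by
    refine Eq.trans ?_ ((trans ι).nat_unit e he x)
    exact congrArg (fun z => _ ≫ Iso.hom z) (fam_pull_unit (CategoryTheory.Prod.snd I K) C e he _).symm
  nat_mul f g h e x := by
    refine Eq.trans ?_ ((trans ι).nat_mul f g h e x)
    exact congrArg (fun z => _ ≫ Iso.hom z)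
      (fam_pull_mul (CategoryTheory.Prod.snd I K) C f g h e _).symm

/-- A transformation from a diagram on the first factor, in terms of objects and morphisms. -/
def transFst (π : ofFst D ⟶ a) : (Fam.pull (pr1 I K) (fam D)).Trans (fam a) where
  ap := (trans π).ap
  nat := (trans π).nat
  naturality := (trans π).naturality
  nat_unit {k} e he x := by
    refine ((trans π).nat_unit e he x).trans ?_
    exact congrArg (fun z => ((trans π).ap k).map (Iso.hom z))
      (fam_pull_unit (CategoryTheory.Prod.fst I K) D e he _)
  nat_mul {k l m} f g h e x := by
    refine ((trans π).nat_mul f g h e x).trans ?_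
    exact congrArg (fun z => ((trans π).ap m).map (Iso.hom z) ≫ _)
      (fam_pull_mul (CategoryTheory.Prod.fst I K) D f g h e _)

/-- A transformation from a diagram on the first factor to a diagram on the second factor, in terms
of objects and morphisms. -/
def transPair (τ : ofFst (J := K) D ⟶ ofSnd (I := I) C) :
    (Fam.pull (pr1 I K) (fam D)).Trans (Fam.pull (pr2 I K) (fam C)) where
  ap := (trans τ).ap
  nat := (trans τ).nat
  naturality := (trans τ).naturality
  nat_unit {k} e he x := by
    have h := (transSnd τ).nat_unit e he x
    refine h.trans ?_
    exact congrArg (fun z => ((trans τ).ap k).map (Iso.hom z))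
      (fam_pull_unit (CategoryTheory.Prod.fst I K) D e he _)
  nat_mul {k l m} f g h e x := by
    refine ((transSnd τ).nat_mul f g h e x).trans ?_
    exact congrArg (fun z => ((trans τ).ap m).map (Iso.hom z) ≫ _)
      (fam_pull_mul (CategoryTheory.Prod.fst I K) D f g h e _)

/-- Only the constraints carry data beyond the component functors, and an isomorphism is determined
by its forward map. This identifies the two descriptions of `π ≫ ι`. -/
theorem Fam.Trans.mk_congr {A B : Fam K} {ap : ∀ k, A.obj k ⥤ B.obj k}
    {nat nat' : ∀ {k l : K} (f : k ⟶ l) (x : A.obj k),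
      (ap l).obj ((A.tr f).obj x) ≅ (B.tr f).obj ((ap k).obj x)} (h1 h1' h2 h2' h3 h3')
    (h : ∀ {k l : K} (f : k ⟶ l) (x : A.obj k), (nat f x).hom = (nat' f x).hom) :
    (Trans.mk ap nat h1 h2 h3 : A.Trans B) = Trans.mk ap nat' h1' h2' h3' := by
  obtain rfl : @nat = @nat' := by
    funext k l f x
    exact Iso.ext (h f x)
  rfl

theorem transPair_comp (π : ofFst D ⟶ a) (ι : a ⟶ ofSnd C) :
    transPair (π ≫ ι) = (transFst π).comp (transSnd ι) :=
  Trans.mk_congr _ _ _ _ _ _ (fun f x => trans_comp_nat_hom π ι f x)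

/-- Isomorphic transformations induce isomorphic functors. -/
theorem toDesc_iso_of_iso {τ τ' : ofFst (J := K) D ⟶ ofSnd (I := I) C} (e : τ ≅ τ') :
    Nonempty ((transPair τ).toDesc ≅ (transPair τ').toDesc) := by
  have hom {τ τ' : ofFst (J := K) D ⟶ ofSnd (I := I) C} (Γ : τ ⟶ τ') :
    ∃ η : (transPair τ).toDesc ⟶ (transPair τ').toDesc, ∀ i k x, (η.app ⟨i, x⟩).app k =
      mapp Γ (k := (i, k)) x := by
    refine ⟨Trans.toDescHom (τ := transPair τ) (τ' := transPair τ')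
      (fun i k x => mapp Γ (k := (i, k)) x) (fun i k _ _ φ => mapp_naturality Γ (k := (i, k)) φ)
      (fun {i j k l} f g x => ((transPair τ).pair_comm_iff (transPair τ') f g x _ _).2
        (mapp_nat Γ (k := (i, k)) (l := (j, l)) (f, g) x)), fun _ _ _ => rfl⟩
  obtain ⟨η, hη⟩ := hom e.hom
  obtain ⟨θ, hθ⟩ := hom e.inv
  refine ⟨⟨η, θ, ?_, ?_⟩⟩
  · ext ⟨i, x⟩ k
    refine (congrArg₂ (· ≫ ·) (hη i k x) (hθ i k x)).trans ?_
    exact congrArg (fun Γ => mapp Γ (k := (i, k)) x) e.hom_inv_id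
  · ext ⟨i, x⟩ k
    refine (congrArg₂ (· ≫ ·) (hθ i k x) (hη i k x)).trans ?_
    exact congrArg (fun Γ => mapp Γ (k := (i, k)) x) e.inv_hom_id

/-- Transformations inducing isomorphic functors are isomorphic. -/
theorem iso_of_toDesc_iso {τ τ' : ofFst (J := K) D ⟶ ofSnd (I := I) C}
    (e : (transPair τ).toDesc ≅ (transPair τ').toDesc) : Nonempty (τ ≅ τ') := by
  have hom {τ τ' : ofFst (J := K) D ⟶ ofSnd (I := I) C}
      (η : (transPair τ).toDesc ⟶ (transPair τ').toDesc) :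
      ∃ Γ : τ ⟶ τ', ∀ i k x, mapp Γ (k := (i, k)) x = (η.app ⟨i, x⟩).app k := by
    refine ⟨mkMod (fun {ik} x => (η.app ⟨ik.1, x⟩).app ik.2) ?_ ?_, fun _ _ _ => rfl⟩
    · intro ik x y φ
      have h := congrArg (fun z => Desc.Hom.app z ik.2) (η.naturality (vert φ))
      exact (congrArg (· ≫ _) ((transPair τ).toDesc_map_vert_app φ ik.2)).symm.trans
        (h.trans (congrArg (_ ≫ ·) ((transPair τ').toDesc_map_vert_app φ ik.2)))
    · intro ik jl f x
      exact ((transPair τ).pair_comm_iff (transPair τ') f.1 f.2 x _ _).1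
        (Trans.toDesc_comm η f.1 f.2 x (fun i k x => (η.app ⟨i, x⟩).app k) (fun _ _ _ => rfl))
  obtain ⟨Γ, hΓ⟩ := hom e.hom
  obtain ⟨Θ, hΘ⟩ := hom e.inv
  refine ⟨⟨Γ, Θ, ?_, ?_⟩⟩
  · refine mapp_injective fun {ik} x => ?_
    refine (congrArg₂ (· ≫ ·) (hΓ ik.1 ik.2 x) (hΘ ik.1 ik.2 x)).trans ?_
    exact congrArg (fun z => Desc.Hom.app (NatTrans.app z ⟨ik.1, x⟩) ik.2) e.hom_inv_id
  · refine mapp_injective fun {ik} x => ?_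
    refine (congrArg₂ (· ≫ ·) (hΘ ik.1 ik.2 x) (hΓ ik.1 ik.2 x)).trans ?_
    exact congrArg (fun z => Desc.Hom.app (NatTrans.app z ⟨ik.1, x⟩) ik.2) e.inv_hom_id

/-- The restrictions of a transformation to cocones, in terms of total categories. -/
theorem vert_conat_colCocone (ι : a ⟶ ofSnd C) {i j : I} (f : i ⟶ j) (k : K)
    (x : (fam a).obj (i, k)) :
    vert (A := fam C) (k := k) (conat (colCocone ι k) f x).inv = (transSnd ι).sn (hcart f x) := by
  let N := (transSnd ι).nat (k := (i, k)) (l := (j, k)) (f, 𝟙 k) x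
  let u := (fam C).unit (𝟙 k) rfl (((transSnd ι).lo i k).obj x)
  have h : conat (colCocone ι k) f x = N ≪≫ u :=
    Iso.ext (congrArg (N.hom ≫ ·) (fam_unit_hom C (((transSnd ι).lo i k).obj x)).symm)
  have h1 : (conat (colCocone ι k) f x).inv = u.inv ≫ N.inv := congrArg Iso.inv h
  refine (congrArg (vert (A := fam C) (k := k)) h1).trans ?_
  refine Eq.trans ?_ ((transSnd ι).hom_cart (k := (i, k)) (l := (j, k)) (f, 𝟙 k) x).symm
  exact congrArg (homMk (A := fam C) (𝟙 k)) (Iso.hom_inv_id_assoc u N.inv)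

/-- For each `k` the universal cocone is a localization of the total category of `a(·, k)`, hence
satisfies `Fam.IsColim`. Only the images of cocartesian morphisms need translation, which is
`vert_conat_colCocone`. -/
theorem isColim_transSnd [IsFiltered I] (ι : a ⟶ ofSnd C)
    (h : ∀ k, IsTwoColimit (colCocone ι k)) : (transSnd ι).IsColim := by
  have hc (k : K) : Fam.IsColim (toTot (colCocone ι k)) :=
    have := (h k).isLocalization
    isColim_of_isLocalization _
  have hcart' {i j : I} (f : i ⟶ j) (k : K) (x : (fam a).obj (i, k)) :
      vert (A := fam C) (k := k) ((toTot (colCocone ι k)).map (cart f x)) =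
        (transSnd ι).sn (hcart f x) :=
    (congrArg (vert (A := fam C) (k := k)) (toTot_map_cart (colCocone ι k) f x)).trans
      (vert_conat_colCocone ι f k x)
  have hvert {i : I} {k : K} {x y : (fam a).obj (i, k)} (φ : x ⟶ y) :
      (toTot (colCocone ι k)).map (vert (A := fam (col a k)) φ) = ((transSnd ι).lo i k).map φ :=
    toTot_map_vert (colCocone ι k) φ
  constructor
  · intro k z
    obtain ⟨⟨i, x⟩, ⟨α⟩⟩ := (hc k).surj z
    exact ⟨i, x, ⟨α⟩⟩
  · intro i k x y w
    obtain ⟨j, f, v, hv⟩ := (hc k).full w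
    refine ⟨j, f, v, ?_⟩
    have h' := congrArg (vert (A := fam C) (k := k)) hv
    refine Eq.trans ?_ (h'.trans ?_)
    · refine Eq.trans ?_ (vert_comp _ _).symm
      exact (congrArg₂ (· ≫ ·) (hcart' f k x) (congrArg vert (hvert v))).symm
    · refine (vert_comp _ _).trans ?_
      exact congrArg (_ ≫ ·) (hcart' f k y)
  · intro i k x y v w h
    obtain ⟨j, f, hf⟩ := (hc k).faithful (v := v) (w := w) ((hvert v).trans (h.trans (hvert w).symm))
    exact ⟨j, f, hf⟩

/-- The restrictions of a transformation to cones, in terms of total categories. -/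
theorem homMk_cnat_rowCone (π : ofFst D ⟶ a) (i : I) {k l : K} (g : k ⟶ l) (x : (fam D).obj i) :
    homMk (A := fam a) (k := (i, k)) (l := (i, l)) (𝟙 i, g) (cnat (rowCone π i) g x).inv =
      (transFst π).mor x g := by
  let N := (transFst π).nat (k := (i, k)) (l := (i, l)) (𝟙 i, g) x
  let u := ((transFst π).fr i l).mapIso ((fam D).unit (𝟙 i) rfl x)
  let u₀ := (Cat.Hom.toNatIso (D.mapId ⟨i⟩)).app x
  have hu : u₀ = (fam D).unit (𝟙 i) rfl x := Iso.ext (fam_unit_hom D x).symm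
  have h : cnat (rowCone π i) g x = u.symm ≪≫ N :=
    Iso.ext (congrArg (fun z => ((transFst π).fr i l).map (Iso.inv z) ≫ N.hom) hu)
  have h1 : (cnat (rowCone π i) g x).inv = N.inv ≫ u.hom := congrArg Iso.inv h
  exact congrArg (homMk (A := fam a) (k := (i, k)) (l := (i, l)) (𝟙 i, g)) h1

section

variable {L M : Type u} [SmallCategory L] [SmallCategory M] (S : L ⥤ M) (b : Diagram M)

/-- The projection of total categories for a restriction along a functor. -/
def famPullTot : (fam (pull S b)).Tot ⥤ (fam b).Tot where
  obj X := ⟨S.obj X.base, X.fib⟩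
  map p := homMk (A := fam b) (S.map p.base) p.fib
  map_id X := (congrArg (fun z => homMk (A := fam b) (S.map (𝟙 X.base)) (Iso.hom z))
    (fam_pull_unit S b (𝟙 X.base) rfl X.fib)).trans (id_eq (A := fam b) _ _ (S.map_id _)).symm
  map_comp {X _ _} p q := (congrArg (fun z => homMk (A := fam b) (S.map (p.base ≫ q.base))
      (Iso.hom z ≫ ((fam b).tr (S.map q.base)).map p.fib ≫ q.fib))
    (fam_pull_mul S b p.base q.base _ rfl X.fib)).trans
      (homMk_comp (A := fam b) _ _ _ _ _ (S.map_comp _ _).symm).symm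

theorem famPullTot_map_vert {l : L} {x y : (fam b).obj (S.obj l)} (φ : x ⟶ y) :
    (famPullTot S b).map (vert (A := fam (pull S b)) (k := l) φ) = vert (A := fam b) φ := by
  refine (congrArg (fun z => homMk (A := fam b) (S.map (𝟙 l)) (Iso.hom z ≫ φ))
    (fam_pull_unit S b (𝟙 l) rfl x)).trans ?_
  rw [homMk_eq, vert_comp, cart_unit_assoc]

-- Since `S` may identify arrows, equality of the bases before applying `S` has to be assumed.
variable {S b} in
theorem famPullTot_map_injective {X Y : (fam (pull S b)).Tot}
    {p q : X ⟶ Y} (hb : p.base = q.base) (h : (famPullTot S b).map p = (famPullTot S b).map q) :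
    p = q := by
  obtain ⟨l, y⟩ := Y
  obtain ⟨g, φ⟩ := p
  obtain ⟨g', ψ⟩ := q
  obtain rfl : g = g' := hb
  exact congrArg (homMk (A := fam (pull S b)) g) (homMk_injective (A := fam b) h)

end

theorem Fam.exists_eq_homMk {A : Fam K} {k l : K} {x : A.obj k} {y : A.obj l}
    (p : (⟨k, x⟩ : A.Tot) ⟶ ⟨l, y⟩) (f : k ⟶ l) (h : p.base = f) : ∃ φ, p = homMk f φ := by
  subst h
  exact ⟨p.fib, rfl⟩

theorem famPullTot_map_mor (π : ofFst D ⟶ a) (i : I) {k l : K} (g : k ⟶ l) (x : (fam D).obj i) :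
    (famPullTot (CategoryTheory.Prod.sectR i K) a).map (((toDesc (rowCone π i)).obj x).mor g) =
      (transFst π).mor x g := homMk_cnat_rowCone π i g x

/-- The three conditions are faithfulness, fullness and essential surjectivity of `toDesc (rowCone π
i)`, with descent data of the row rewritten in the total category of `a`. -/
theorem isLim_transFst (π : ofFst D ⟶ a)
    (h : ∀ i, IsTwoLimit (rowCone π i)) : (transFst π).IsLim := by
  have hd (i : I) : (toDesc (rowCone π i)).IsEquivalence :=
    (isTwoLimit_iff_isEquivalence _).1 (h i)
  constructor
  · intro i x y v w hvw
    exact (hd i).faithful.map_injective (Desc.hom_ext hvw)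
  · intro i x y v hv
    obtain ⟨w, hw⟩ := (hd i).full.map_surjective (X := x) (Y := y)
      ⟨fun k => v k, fun {k l} g => famPullTot_map_injective
        ((Category.comp_id g).trans (Category.id_comp g).symm) (by
        refine (Functor.map_comp _ _ _).trans (Eq.trans ?_ (Functor.map_comp _ _ _).symm)
        exact (congrArg₂ (· ≫ ·) (famPullTot_map_mor π i g x) (famPullTot_map_vert _ _ _)).trans
          ((hv g).trans (congrArg₂ (· ≫ ·) (famPullTot_map_vert _ _ _)
            (famPullTot_map_mor π i g y)).symm))⟩
    exact ⟨w, fun k => congrArg (fun z => Desc.Hom.app z k) hw⟩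
  · intro i y m hb hW hid hcomp
    -- The base of `m g` is only propositionally `(𝟙 i, g)`, so its fibre part must be extracted
    -- before it can serve as a structure map of the row.
    choose φ hφ using fun (g : Σ k l : K, k ⟶ l) => exists_eq_homMk (A := fam a) (m g.2.2) _ (hb g.2.2)
    let c : Desc (fam (row a i)) :=
      { obj := y
        θ := fun {k l} g => φ ⟨k, l, g⟩
        isIso := fun {k l} g => by
          have h := hW g
          rw [hφ ⟨k, l, g⟩] at h
          exact h
        id := fun k => famPullTot_map_injective (S := CategoryTheory.Prod.sectR i K) (b := a) rfl
          ((hφ ⟨k, k, 𝟙 k⟩).symm.trans ((hid k).trans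
            ((famPullTot (CategoryTheory.Prod.sectR i K) a).map_id ⟨k, y k⟩).symm))
        comp := fun {k l n} g h => famPullTot_map_injective (S := CategoryTheory.Prod.sectR i K)
          (b := a) rfl ((hφ ⟨k, n, g ≫ h⟩).symm.trans ((hcomp g h).trans
            ((congrArg₂ (· ≫ ·) (hφ ⟨k, l, g⟩) (hφ ⟨l, n, h⟩)).trans
              ((famPullTot (CategoryTheory.Prod.sectR i K) a).map_comp
                (X := ⟨k, y k⟩) (Y := ⟨l, y l⟩) (Z := ⟨n, y n⟩)
                (homMk (A := fam (row a i)) g (φ ⟨k, l, g⟩))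
                (homMk (A := fam (row a i)) h (φ ⟨l, n, h⟩))).symm))) }
    obtain ⟨x, ⟨γ⟩⟩ := (hd i).essSurj.mem_essImage c
    refine ⟨x, fun k => (Desc.ev k).mapIso γ, fun {k l} g => ?_⟩
    have h := congrArg (famPullTot (CategoryTheory.Prod.sectR i K) a).map (γ.hom.comm g)
    have h' := (Functor.map_comp _ _ _).symm.trans (h.trans (Functor.map_comp _ _ _))
    have h1 := famPullTot_map_mor π i g x
    have h2 : (famPullTot (CategoryTheory.Prod.sectR i K) a).map (c.mor g) = m g :=
      (hφ ⟨k, l, g⟩).symm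
    exact (congrArg₂ (· ≫ ·) h1 (famPullTot_map_vert _ _ _)).symm.trans (h'.trans
      (congrArg₂ (· ≫ ·) (famPullTot_map_vert _ _ _) h2))

section Through

variable {P Q : Cat.{u, u}} (p : D ⟶ const I P) (q : const K Q ⟶ C) (Ψ : P ⟶ Q)

/-- The composite of a cocone, a functor and a cone. -/
abbrev throughTrans : ofFst (J := K) D ⟶ ofSnd (I := I) C :=
  pullCocone (CategoryTheory.Prod.fst I K) p ≫ constMap (I × K) Ψ ≫
    pullCone (CategoryTheory.Prod.snd I K) q

theorem throughTrans_nat {i j : I} {k l : K} (f : i ⟶ j) (g : k ⟶ l) (x : (fam D).obj i) :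
    ((transPair (throughTrans p q Ψ)).nat (k := (i, k)) (l := (j, l)) (f, g) x).inv =
      (cnat q g (Ψ.toFunctor.obj ((coapp p i).obj x))).inv ≫
        (capp q l).map (Ψ.toFunctor.map (conat p f x).inv) := by
  let u := ((Ψ.toFunctor ⋙ capp q l).mapIso (conat p f x))
  let v := cnat q g (Ψ.toFunctor.obj ((coapp p i).obj x))
  have h : (transPair (throughTrans p q Ψ)).nat (k := (i, k)) (l := (j, l)) (f, g) x = u ≪≫ v := by
    refine Iso.ext ((trans_comp_nat_hom (pullCocone (CategoryTheory.Prod.fst I K) p)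
      (constMap (I × K) Ψ ≫ pullCone (CategoryTheory.Prod.snd I K) q) (k := (i, k)) (l := (j, l))
      (f, g) x).trans ?_)
    refine congrArg (u.hom ≫ ·) ?_
    refine (trans_comp_nat_hom (constMap (I × K) Ψ) (pullCone (CategoryTheory.Prod.snd I K) q)
      (k := (i, k)) (l := (j, l)) (f, g) _).trans ?_
    refine Eq.trans (congrArg (· ≫ v.hom) ?_) (Category.id_comp v.hom)
    exact (congrArg (capp q l).map (trans_constMap_nat_hom Ψ (k := (i, k)) (l := (j, l)) (f, g) _)).trans
      ((capp q l).map_id _)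
  exact congrArg Iso.inv h

/-- The two variables do not interact: the arrow of `K` acts through the cone `q`, and the morphism
`r` acts through the cocone `p` followed by `Ψ`. -/
theorem pair_throughTrans {X Y : (fam D).Tot} (r : X ⟶ Y) {k l : K} (g : k ⟶ l) :
    (transPair (throughTrans p q Ψ)).pair r g =
      cN q g (Ψ.toFunctor.obj ((toTot p).obj X)) ≫
        vert ((capp q l).map (Ψ.toFunctor.map ((toTot p).map r))) := by
  have h1 := (transPair (throughTrans p q Ψ)).hom_cart (k := (X.base, k)) (l := (Y.base, l))
    (r.base, g) X.fib
  have h2 := h1.trans (congrArg (homMk (A := fam C) g) (throughTrans_nat p q Ψ r.base g X.fib))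
  have h3 := h2.trans (homMk_vert (A := fam C) g _ _).symm
  refine ((transPair (throughTrans p q Ψ)).pair_eq' r g).trans
    ((congrArg (· ≫ _) h3).trans ((Category.assoc _ _ _).trans (congrArg (_ ≫ ·) ?_)))
  refine (vert_comp _ _).symm.trans (congrArg vert ?_)
  exact ((Ψ.toFunctor ⋙ capp q l).map_comp (conat p r.base X.fib).inv
    ((coapp p Y.base).map r.fib)).symm

/-- The functor induced by the composite of a cocone, a functor and a cone. -/
def toDescThrough : (transPair (throughTrans p q Ψ)).toDesc ≅
    toTot p ⋙ Ψ.toFunctor ⋙ toDesc q := by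
  refine NatIso.ofComponents (fun X => Desc.isoMk (fun k => Iso.refl _) ?_) ?_
  · intro k l g
    refine (congrArg (_ ≫ ·) (vert_id _)).trans ?_
    refine Eq.trans ?_ (congrArg (· ≫ _) (vert_id _)).symm
    refine (Category.comp_id _).trans (Eq.trans ?_ (Category.id_comp _).symm)
    refine (pair_throughTrans p q Ψ (𝟙 X) g).trans ?_
    refine (congrArg (_ ≫ ·) ?_).trans (Category.comp_id _)
    refine (congrArg vert ?_).trans (vert_id _)
    exact (toTot p ⋙ Ψ.toFunctor ⋙ capp q l).map_id X
  · intro X Y r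
    ext k
    refine (Category.comp_id _).trans (Eq.trans ?_ (Category.id_comp _).symm)
    refine vert_injective (((transPair (throughTrans p q Ψ)).vert_comp₁ r k).trans ?_)
    refine (pair_throughTrans p q Ψ r (𝟙 k)).trans ?_
    exact (congrArg (· ≫ _) (cN_id q k _)).trans (Category.id_comp _)

end Through

end TwoLim

/-! ### The comparison functor: existence, uniqueness, equivalence -/

namespace TwoLim

open Fam

namespace IteratedLimits

variable {I K : Type u} [SmallCategory I] [SmallCategory K] {a : Diagram (I × K)}
  (L : IteratedLimits a)

instance : (toDesc L.q).IsEquivalence := (isTwoLimit_iff_isEquivalence _).1 L.isTwoLimit_q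

variable {L} in
theorem IsComparison.nonempty_iso {Ψ : L.colimLim ⟶ L.limColim} (h : L.IsComparison Ψ) :
    Nonempty (toTot L.p ⋙ Ψ.toFunctor ⋙ toDesc L.q ≅ (transPair L.canonical).toDesc) := by
  obtain ⟨e⟩ := h
  obtain ⟨e'⟩ := toDesc_iso_of_iso e
  exact ⟨(toDescThrough L.p L.q Ψ).symm ≪≫ e'.symm⟩

/-- The functor of the canonical composites inverts `W`, hence factors through the 2-colimit.
Composing the factor with a quasi-inverse of `toDesc L.q` gives `Ψ`. -/
theorem exists_isComparison : ∃ Ψ : L.colimLim ⟶ L.limColim, L.IsComparison Ψ := by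
  obtain ⟨F, ⟨e⟩⟩ := L.isTwoColimit_p.exists_fac (X := Cat.of (Desc (fam L.colim)))
    (transPair L.canonical).toDesc (transPair L.canonical).toDesc_inverts
  let Ψ : L.colimLim ⟶ L.limColim := ⟨F ⋙ (toDesc L.q).inv⟩
  let e' : Ψ.toFunctor ⋙ toDesc L.q ≅ F :=
    Functor.associator _ _ _ ≪≫ Functor.isoWhiskerLeft F (toDesc L.q).asEquivalence.counitIso ≪≫
      Functor.rightUnitor F
  obtain ⟨e₁⟩ := iso_of_toDesc_iso
    (toDescThrough L.p L.q Ψ ≪≫ Functor.isoWhiskerLeft (toTot L.p) e' ≪≫ e)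
  exact ⟨Ψ, ⟨e₁.symm⟩⟩

-- Both composites with `toDesc L.q` factor the same functor through `toTot L.p`, so they are
-- isomorphic; full faithfulness of `toDesc L.q` then removes the last factor.
variable {L} in
theorem IsComparison.unique {Ψ Ψ' : L.colimLim ⟶ L.limColim} (h : L.IsComparison Ψ)
    (h' : L.IsComparison Ψ') : Nonempty (Ψ ≅ Ψ') := by
  obtain ⟨e⟩ := h.nonempty_iso
  obtain ⟨e'⟩ := h'.nonempty_iso
  obtain ⟨e₁⟩ := L.isTwoColimit_p.exists_iso (X := Cat.of (Desc (fam L.colim)))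
    (F := Ψ.toFunctor ⋙ toDesc L.q) (G := Ψ'.toFunctor ⋙ toDesc L.q) (e ≪≫ e'.symm)
  exact ⟨(catHomFunctor _ _).preimageIso
    (((Functor.whiskeringRight _ _ _).obj (toDesc L.q)).preimageIso e₁)⟩

-- Both `toTot L.p` and the functor of the canonical composites present a filtered colimit of the
-- same family `i ↦ 2-lim_j a(i, j)`, and `Ψ ⋙ toDesc L.q` compares them.
variable {L} in
theorem IsComparison.isEquivalence [IsFiltered I] [FinCategory K]
    {Ψ : L.colimLim ⟶ L.limColim} (h : L.IsComparison Ψ) : Ψ.toFunctor.IsEquivalence := by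
  obtain ⟨e⟩ := h.nonempty_iso
  have := L.isTwoColimit_p.isLocalization
  have h1 : IsColim (toTot L.p) := isColim_of_isLocalization _
  have h2 : IsColim (transPair L.canonical).toDesc := by
    rw [transPair_comp]
    exact isColim_toDesc (isLim_transFst L.π L.isTwoLimit_π)
      (isColim_transSnd L.ι L.isTwoColimit_ι)
  have := h1.isEquivalence h2 (Ψ.toFunctor ⋙ toDesc L.q) e
  exact Functor.isEquivalence_of_comp_right Ψ.toFunctor (toDesc L.q)

end IteratedLimits

end TwoLim

/-! ### Families from cloven opfibrations, and fibrewise localization -/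

namespace TwoLim

variable {K : Type u} [SmallCategory K]

/-- A cloven opfibration over `K`, given by its fibres, the category in which they are embedded, and
the morphisms of this category over the morphisms of `K`. -/
structure Opfibration (K : Type u) [SmallCategory K] (E : Type*) [Category* E] where
  fib : K → Type u
  [cat : ∀ k, SmallCategory (fib k)]
  incl (k : K) : fib k ⥤ E
  -- A predicate on morphisms replaces a projection to `K`: the ambient category may be larger than
  -- the total category, as is the functor category used for descent data.
  IsOver {k l : K} (g : k ⟶ l) {x : fib k} {y : fib l} (q : (incl k).obj x ⟶ (incl l).obj y) : Prop
  isOver_map {k : K} {x y : fib k} (p : x ⟶ y) : IsOver (𝟙 k) ((incl k).map p)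
  isOver_comp {k l m : K} {g : k ⟶ l} {h : l ⟶ m} {e : k ⟶ m} (he : g ≫ h = e) {x : fib k}
    {y : fib l} {z : fib m} {p : (incl k).obj x ⟶ (incl l).obj y}
    {q : (incl l).obj y ⟶ (incl m).obj z} (hp : IsOver g p) (hq : IsOver h q) : IsOver e (p ≫ q)
  incl_injective {k : K} {x y : fib k} {p q : x ⟶ y} (h : (incl k).map p = (incl k).map q) : p = q
  exists_map_eq {k : K} {x y : fib k} {q : (incl k).obj x ⟶ (incl k).obj y} (hq : IsOver (𝟙 k) q) :
    ∃ p, (incl k).map p = q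
  push {k l : K} (g : k ⟶ l) (x : fib k) : fib l
  cart {k l : K} (g : k ⟶ l) (x : fib k) : (incl k).obj x ⟶ (incl l).obj (push g x)
  isOver_cart {k l : K} (g : k ⟶ l) (x : fib k) : IsOver g (cart g x)
  exists_fac {k l m : K} (g : k ⟶ l) (h : l ⟶ m) {e : k ⟶ m} (he : g ≫ h = e) {x : fib k}
    {z : fib m} {q : (incl k).obj x ⟶ (incl m).obj z} (hq : IsOver e q) :
    ∃ q' : (incl l).obj (push g x) ⟶ (incl m).obj z, IsOver h q' ∧ cart g x ≫ q' = q
  cart_cancel {k l m : K} (g : k ⟶ l) (h : l ⟶ m) {x : fib k} {z : fib m}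
    {p q : (incl l).obj (push g x) ⟶ (incl m).obj z} (hp : IsOver h p) (hq : IsOver h q)
    (e : cart g x ≫ p = cart g x ≫ q) : p = q

attribute [instance] Opfibration.cat

namespace Opfibration

variable {E : Type*} [Category* E] (F : Opfibration K E)

theorem hom_ext {k l : K} (g : k ⟶ l) {x : F.fib k} {y : F.fib l} {p q : F.push g x ⟶ y}
    (h : F.cart g x ≫ (F.incl l).map p = F.cart g x ≫ (F.incl l).map q) : p = q :=
  F.incl_injective (F.cart_cancel g (𝟙 l) (F.isOver_map p) (F.isOver_map q) h)

theorem exists_desc {k l : K} (g : k ⟶ l) {x : F.fib k} {y : F.fib l}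
    {q : (F.incl k).obj x ⟶ (F.incl l).obj y} (hq : F.IsOver g q) :
    ∃ p : F.push g x ⟶ y, F.cart g x ≫ (F.incl l).map p = q := by
  obtain ⟨q', h, h'⟩ := F.exists_fac g (𝟙 l) (Category.comp_id g) hq
  obtain ⟨p, rfl⟩ := F.exists_map_eq h
  exact ⟨p, h'⟩

/-- The morphism induced by the universal property of a cocartesian morphism. -/
noncomputable def desc {k l : K} (g : k ⟶ l) {x : F.fib k} {y : F.fib l}
    {q : (F.incl k).obj x ⟶ (F.incl l).obj y} (hq : F.IsOver g q) : F.push g x ⟶ y :=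
  (F.exists_desc g hq).choose

theorem cart_desc {k l : K} (g : k ⟶ l) {x : F.fib k} {y : F.fib l}
    {q : (F.incl k).obj x ⟶ (F.incl l).obj y} (hq : F.IsOver g q) :
    F.cart g x ≫ (F.incl l).map (F.desc g hq) = q := (F.exists_desc g hq).choose_spec

theorem cart_desc_assoc {k l : K} (g : k ⟶ l) {x : F.fib k} {y : F.fib l}
    {q : (F.incl k).obj x ⟶ (F.incl l).obj y} (hq : F.IsOver g q) {Z : E}
    (r : (F.incl l).obj y ⟶ Z) :
    F.cart g x ≫ (F.incl l).map (F.desc g hq) ≫ r = q ≫ r := by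
  rw [← Category.assoc, cart_desc]

/-- The action of the transition functors on morphisms. -/
noncomputable def trMap {k l : K} (g : k ⟶ l) {x y : F.fib k} (p : x ⟶ y) :
    F.push g x ⟶ F.push g y :=
  F.desc g (F.isOver_comp (Category.id_comp g) (F.isOver_map p) (F.isOver_cart g y))

theorem cart_trMap {k l : K} (g : k ⟶ l) {x y : F.fib k} (p : x ⟶ y) :
    F.cart g x ≫ (F.incl l).map (F.trMap g p) = (F.incl k).map p ≫ F.cart g y :=
  F.cart_desc g (F.isOver_comp (Category.id_comp g) (F.isOver_map p) (F.isOver_cart g y))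

theorem cart_trMap_assoc {k l : K} (g : k ⟶ l) {x y : F.fib k} (p : x ⟶ y) {Z : E}
    (r : (F.incl l).obj (F.push g y) ⟶ Z) :
    F.cart g x ≫ (F.incl l).map (F.trMap g p) ≫ r = (F.incl k).map p ≫ F.cart g y ≫ r := by
  rw [← Category.assoc, cart_trMap, Category.assoc]

/-- The transition functors. -/
noncomputable def tr {k l : K} (g : k ⟶ l) : F.fib k ⥤ F.fib l where
  obj := F.push g
  map p := F.trMap g p
  map_id x := F.hom_ext g (by
    rw [cart_trMap, CategoryTheory.Functor.map_id, CategoryTheory.Functor.map_id, Category.id_comp,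
      Category.comp_id])
  map_comp p q := F.hom_ext g (by
    rw [cart_trMap, Functor.map_comp, Functor.map_comp, cart_trMap_assoc, Category.assoc,
      cart_trMap])

theorem isOver_id {k : K} (x : F.fib k) (e : k ⟶ k) (he : e = 𝟙 k) :
    F.IsOver e (𝟙 ((F.incl k).obj x)) := by
  subst he
  rw [← CategoryTheory.Functor.map_id]
  exact F.isOver_map _

/-- The cocartesian lift of an identity is itself the image of a morphism of the fibre, and that
morphism is the inverse. -/
theorem exists_unit {k : K} (e : k ⟶ k) (he : e = 𝟙 k) (x : F.fib k) :
    ∃ u : F.push e x ≅ x, F.cart e x ≫ (F.incl k).map u.hom = 𝟙 _ := by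
  have h := F.cart_desc e (F.isOver_id x e he)
  obtain ⟨v, hv⟩ := F.exists_map_eq (q := F.cart e x) (by
    have h1 := F.isOver_cart e x
    rwa [he] at h1 ⊢)
  refine ⟨⟨F.desc e (F.isOver_id x e he), v, F.hom_ext e ?_, F.incl_injective ?_⟩, h⟩
  · rw [Functor.map_comp, cart_desc_assoc, hv, Category.id_comp, CategoryTheory.Functor.map_id,
      Category.comp_id]
  · rw [Functor.map_comp, hv, h, CategoryTheory.Functor.map_id]

/-- The transition functors along identities are isomorphic to identities. -/
noncomputable def unit {k : K} (e : k ⟶ k) (he : e = 𝟙 k) (x : F.fib k) : F.push e x ≅ x :=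
  (F.exists_unit e he x).choose

theorem cart_unit {k : K} (e : k ⟶ k) (he : e = 𝟙 k) (x : F.fib k) :
    F.cart e x ≫ (F.incl k).map (F.unit e he x).hom = 𝟙 _ := (F.exists_unit e he x).choose_spec

theorem cart_unit_assoc {k : K} (e : k ⟶ k) (he : e = 𝟙 k) (x : F.fib k) {Z : E}
    (r : (F.incl k).obj x ⟶ Z) :
    F.cart e x ≫ (F.incl k).map (F.unit e he x).hom ≫ r = r := by
  rw [← Category.assoc, cart_unit, Category.id_comp]

/-- The lift of `h` and the composite of the lifts of `f` and `g` factor uniquely through each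
other. -/
theorem exists_mul {k l m : K} (f : k ⟶ l) (g : l ⟶ m) (h : k ⟶ m) (e : f ≫ g = h)
    (x : F.fib k) : ∃ u : F.push h x ≅ F.push g (F.push f x),
      F.cart h x ≫ (F.incl m).map u.hom = F.cart f x ≫ F.cart g _ := by
  have h0 := F.isOver_comp e (F.isOver_cart f x) (F.isOver_cart g (F.push f x))
  obtain ⟨q, hq, hq'⟩ := F.exists_fac f g e (F.isOver_cart h x)
  refine ⟨⟨F.desc h h0, F.desc g hq, F.hom_ext h ?_, F.hom_ext g ?_⟩, F.cart_desc h h0⟩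
  · rw [Functor.map_comp, cart_desc_assoc, Category.assoc, cart_desc, hq',
      CategoryTheory.Functor.map_id, Category.comp_id]
  · rw [Functor.map_comp, cart_desc_assoc, CategoryTheory.Functor.map_id, Category.comp_id]
    refine F.cart_cancel f g (F.isOver_comp (Category.comp_id g) hq (F.isOver_map _))
      (F.isOver_cart g _) ?_
    rw [← Category.assoc, hq', cart_desc]

/-- The transition functors along composites are isomorphic to composites. -/
noncomputable def mul {k l m : K} (f : k ⟶ l) (g : l ⟶ m) (h : k ⟶ m) (e : f ≫ g = h)
    (x : F.fib k) : F.push h x ≅ F.push g (F.push f x) := (F.exists_mul f g h e x).choose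

theorem cart_mul {k l m : K} (f : k ⟶ l) (g : l ⟶ m) (h : k ⟶ m) (e : f ≫ g = h) (x : F.fib k) :
    F.cart h x ≫ (F.incl m).map (F.mul f g h e x).hom = F.cart f x ≫ F.cart g _ :=
  (F.exists_mul f g h e x).choose_spec

theorem cart_mul_assoc {k l m : K} (f : k ⟶ l) (g : l ⟶ m) (h : k ⟶ m) (e : f ≫ g = h)
    (x : F.fib k) {Z : E} (r : (F.incl m).obj (F.push g (F.push f x)) ⟶ Z) :
    F.cart h x ≫ (F.incl m).map (F.mul f g h e x).hom ≫ r = F.cart f x ≫ F.cart g _ ≫ r := by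
  rw [← Category.assoc, cart_mul, Category.assoc]

/-- This and the following coherence laws hold because both sides agree after precomposition with a
cocartesian morphism, which determines a morphism of the fibre. -/
theorem trMap_unit {k : K} (f : k ⟶ k) (hf : f = 𝟙 k) {x y : F.fib k} (φ : x ⟶ y) :
    F.trMap f φ ≫ (F.unit f hf y).hom = (F.unit f hf x).hom ≫ φ := F.hom_ext f (by
  rw [Functor.map_comp, cart_trMap_assoc, cart_unit, Category.comp_id, Functor.map_comp,
    cart_unit_assoc])

theorem trMap_mul {k l m : K} (f : k ⟶ l) (g : l ⟶ m) (h : k ⟶ m) (e : f ≫ g = h) {x y : F.fib k}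
    (φ : x ⟶ y) : F.trMap h φ ≫ (F.mul f g h e y).hom =
      (F.mul f g h e x).hom ≫ F.trMap g (F.trMap f φ) := F.hom_ext h (by
  rw [Functor.map_comp, cart_trMap_assoc, cart_mul, Functor.map_comp, cart_mul_assoc, cart_trMap,
    ← Category.assoc, ← Category.assoc, cart_trMap])

theorem mul_trMap_unit {k l : K} (e : k ⟶ k) (he : e = 𝟙 k) (f : k ⟶ l) (h : e ≫ f = f)
    (x : F.fib k) : (F.mul e f f h x).hom ≫ F.trMap f (F.unit e he x).hom = 𝟙 _ := F.hom_ext f (by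
  rw [Functor.map_comp, cart_mul_assoc, cart_trMap, cart_unit_assoc,
    CategoryTheory.Functor.map_id, Category.comp_id])

theorem mul_unit {k l : K} (f : k ⟶ l) (e : l ⟶ l) (he : e = 𝟙 l) (h : f ≫ e = f)
    (x : F.fib k) : (F.mul f e f h x).hom ≫ (F.unit e he (F.push f x)).hom = 𝟙 _ := F.hom_ext f (by
  rw [Functor.map_comp, cart_mul_assoc, cart_unit, CategoryTheory.Functor.map_id])

theorem mul_assoc {k l m n : K} (f : k ⟶ l) (g : l ⟶ m) (h : m ⟶ n) (fg : k ⟶ m) (gh : l ⟶ n)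
    (fgh : k ⟶ n) (e : f ≫ g = fg) (e' : g ≫ h = gh) (e₁ : fg ≫ h = fgh) (e₂ : f ≫ gh = fgh)
    (x : F.fib k) : (F.mul fg h fgh e₁ x).hom ≫ F.trMap h (F.mul f g fg e x).hom =
      (F.mul f gh fgh e₂ x).hom ≫ (F.mul g h gh e' (F.push f x)).hom := F.hom_ext fgh (by
  rw [Functor.map_comp, Functor.map_comp, cart_mul_assoc, cart_mul_assoc, cart_trMap, cart_mul,
    ← Category.assoc, cart_mul, Category.assoc])

/-- The `2`-functor given by the fibres of a cloven opfibration. -/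
noncomputable def fam : Fam K where
  obj := F.fib
  tr := F.tr
  unit := F.unit
  mul := F.mul
  unit_naturality := F.trMap_unit
  mul_naturality := F.trMap_mul
  unit_mul := F.mul_trMap_unit
  mul_unit := F.mul_unit
  mul_assoc := F.mul_assoc

end Opfibration

section Localize

variable {C : Type*} [Category* C] {D : Type*} [Category* D] {W : MorphismProperty C}

/-- Naturality can be checked before localization. -/
theorem localization_naturality {F G : W.Localization ⥤ D} (η : ∀ x, F.obj x ⟶ G.obj x)
    (h : ∀ {X Y : C} (p : X ⟶ Y),
      F.map (W.Q.map p) ≫ η (W.Q.obj Y) = η (W.Q.obj X) ≫ G.map (W.Q.map p))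
    {x y : W.Localization} (p : x ⟶ y) : F.map p ≫ η y = η x ≫ G.map p := by
  have : MorphismProperty.naturalityProperty η = ⊤ :=
    Localization.Construction.morphismProperty_eq_top' _ (fun _ _ f => h f)
      (MorphismProperty.naturalityProperty.stableUnderInverse _)
  have h' : MorphismProperty.naturalityProperty η p := by
    rw [this]
    exact MorphismProperty.top_apply p
  exact h'

theorem lift_map_Q (G : C ⥤ D) (hG : W.IsInvertedBy G) {X Y : C} (p : X ⟶ Y) :
    (Localization.Construction.lift G hG).map (W.Q.map p) = G.map p := by
  refine (Functor.congr_hom (Localization.Construction.fac G hG) p).trans ?_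
  exact (Category.id_comp _).trans (Category.comp_id _)

variable (A : Fam K) (V : ∀ k, MorphismProperty (A.obj k))
  (hV : ∀ {k l : K} (g : k ⟶ l) {x y : A.obj k} (p : x ⟶ y), V k p → V l ((A.tr g).map p))

/-- The transition functors of the localization of a family. -/
noncomputable def Fam.locTr {k l : K} (g : k ⟶ l) : (V k).Localization ⥤ (V l).Localization :=
  Localization.Construction.lift (A.tr g ⋙ (V l).Q) fun _ _ p hp => (V l).Q_inverts _ (hV g p hp)

variable {A V} in
theorem Fam.locTr_map {k l : K} (g : k ⟶ l) {x y : A.obj k} (p : x ⟶ y) :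
    (A.locTr V hV g).map ((V k).Q.map p) = (V l).Q.map ((A.tr g).map p) := lift_map_Q _ _ p

/-- The localization of a family of categories. -/
noncomputable def Fam.localize : Fam K where
  obj k := (V k).Localization
  tr := A.locTr V hV
  -- Objects of the localization are those of the original category, so the old constraints can be
  -- reused. Their naturality extends to formal inverses by `localization_naturality`.
  unit {k} f hf x := (V k).Q.mapIso (A.unit f hf x.as.obj)
  mul {k l m} f g h e x := (V m).Q.mapIso (A.mul f g h e x.as.obj)
  unit_naturality {k} f hf _ _ φ := localization_naturality (F := A.locTr V hV f) (G := 𝟭 _)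
    (fun x => (V k).Q.map (A.unit f hf x.as.obj).hom) (fun p => by
      refine (congrArg (· ≫ _) (locTr_map hV f p)).trans ?_
      exact ((V k).Q.map_comp _ _).symm.trans ((congrArg (V k).Q.map (A.unit_naturality f hf p)).trans
        ((V k).Q.map_comp _ _))) φ
  mul_naturality {k l m} f g h e _ _ φ := localization_naturality (F := A.locTr V hV h)
    (G := A.locTr V hV f ⋙ A.locTr V hV g)
    (fun x => (V m).Q.map (A.mul f g h e x.as.obj).hom) (fun p => by
      refine (congrArg (· ≫ _) (locTr_map hV h p)).trans ?_
      refine Eq.trans ?_ (congrArg (_ ≫ ·) ((congrArg (A.locTr V hV g).map (locTr_map hV f p)).trans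
        (locTr_map hV g _))).symm
      exact ((V m).Q.map_comp _ _).symm.trans ((congrArg (V m).Q.map (A.mul_naturality f g h e p)).trans
        ((V m).Q.map_comp _ _))) φ
  unit_mul {k l} e he f h x := by
    refine (congrArg (_ ≫ ·) (locTr_map hV f _)).trans ?_
    exact ((V l).Q.map_comp _ _).symm.trans ((congrArg (V l).Q.map (A.unit_mul e he f h _)).trans
      ((V l).Q.map_id _))
  mul_unit {k l} f e he h x :=
    ((V l).Q.map_comp _ _).symm.trans ((congrArg (V l).Q.map (A.mul_unit f e he h _)).trans
      ((V l).Q.map_id _))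
  mul_assoc {k l m n} f g h fg gh fgh e e' e₁ e₂ x := by
    refine (congrArg (_ ≫ ·) (locTr_map hV h _)).trans ?_
    exact ((V n).Q.map_comp _ _).symm.trans ((congrArg (V n).Q.map
      (A.mul_assoc f g h fg gh fgh e e' e₁ e₂ _)).trans ((V n).Q.map_comp _ _))

end Localize

end TwoLim

/-! ### Existence of the 2-colimits, functorially in the second variable -/

namespace TwoLim

open Fam

section

variable {K : Type u} [SmallCategory K]

/-- A transformation from the inverses of its comparison isomorphisms. -/
noncomputable def Fam.Trans.ofInv {A B : Fam K} (ap : ∀ k, A.obj k ⥤ B.obj k)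
    (n : ∀ {k l : K} (f : k ⟶ l) (x : A.obj k),
      (B.tr f).obj ((ap k).obj x) ⟶ (ap l).obj ((A.tr f).obj x))
    (hn : ∀ {k l : K} (f : k ⟶ l) (x : A.obj k), IsIso (n f x))
    (h1 : ∀ {k l : K} (f : k ⟶ l) {x y : A.obj k} (φ : x ⟶ y),
      (B.tr f).map ((ap k).map φ) ≫ n f y = n f x ≫ (ap l).map ((A.tr f).map φ))
    (h2 : ∀ {k : K} (e : k ⟶ k) (he : e = 𝟙 k) (x : A.obj k),
      n e x ≫ (ap k).map (A.unit e he x).hom = (B.unit e he ((ap k).obj x)).hom)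
    (h3 : ∀ {k l m : K} (f : k ⟶ l) (g : l ⟶ m) (h : k ⟶ m) (e : f ≫ g = h) (x : A.obj k),
      (B.mul f g h e ((ap k).obj x)).hom ≫ (B.tr g).map (n f x) ≫ n g ((A.tr f).obj x) =
        n h x ≫ (ap m).map (A.mul f g h e x).hom) : A.Trans B where
  ap := ap
  nat f x := (asIso (n f x)).symm
  naturality f x y φ := by
    rw [Iso.symm_hom, Iso.symm_hom, asIso_inv, asIso_inv, IsIso.eq_inv_comp, ← Category.assoc,
      IsIso.comp_inv_eq, h1]
  nat_unit e he x := by rw [Iso.symm_hom, asIso_inv, IsIso.inv_comp_eq, h2]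
  nat_mul f g h e x := by
    rw [Iso.symm_hom, Iso.symm_hom, Iso.symm_hom, asIso_inv, asIso_inv, asIso_inv,
      IsIso.inv_comp_eq, ← Category.assoc, ← h3, Category.assoc, Category.assoc,
      IsIso.hom_inv_id_assoc, ← Functor.map_comp, IsIso.hom_inv_id, CategoryTheory.Functor.map_id,
      Category.comp_id]

end

variable {I K : Type u} [SmallCategory I] [SmallCategory K] (a : Diagram (I × K))

/-- Precomposition with `vcart` changes the first component of the base only by an identity of `I`.
-/
theorem Fam.fst_base_eq_of_vcart_comp {A : Fam (I × K)} {i : I} {k l : K} (g : k ⟶ l)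
    {x : A.obj (i, k)} {Z : A.Tot} {p q : (⟨(i, l), (A.vtr i g).obj x⟩ : A.Tot) ⟶ Z}
    (e : vcart g x ≫ p = vcart g x ≫ q) : p.base.1 = q.base.1 := by
  have h : (vcart g x ≫ p).base.1 = (vcart g x ≫ q).base.1 := by rw [e]
  exact (Category.id_comp _).symm.trans (h.trans (Category.id_comp _))

/-- The opfibration whose fibres are the total categories of the restrictions to the first
factor. -/
noncomputable def colOpfibration : Opfibration K (fam a).Tot where
  fib k := (fam (col a k)).Tot
  incl k := famPullTot (CategoryTheory.Prod.sectL I k) a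
  IsOver g _ _ q := q.base.2 = g
  isOver_map _ := rfl
  isOver_comp := by
    rintro k l m g h e rfl x y z p q hp hq
    exact congrArg₂ (· ≫ ·) hp hq
  incl_injective {k X Y p q} h := famPullTot_map_injective
    (congrArg (fun z => Prod.fst (TotHom.base z)) h) h
  exists_map_eq {k X Y q} hq := by
    obtain ⟨φ, hφ⟩ := exists_eq_homMk (A := fam a) q (q.base.1, 𝟙 k) (Prod.ext rfl hq)
    exact ⟨homMk (A := fam (col a k)) q.base.1 φ, hφ.symm⟩
  push g X := ⟨X.base, ((fam a).vtr X.base g).obj X.fib⟩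
  cart {k l} g X := vcart (A := fam a) (i := X.base) (k := k) (l := l) g X.fib
  isOver_cart _ _ := rfl
  exists_fac {k l m} g h e he X Z q hq := by
    obtain ⟨φ, hφ⟩ := W_fac (A := fam a) (X := ⟨(X.base, k), X.fib⟩)
      (Y := ⟨(X.base, l), ((fam a).vtr X.base g).obj X.fib⟩) (Z := ⟨(Z.base, m), Z.fib⟩)
      (s := vcart (A := fam a) (i := X.base) g X.fib) (W_cart _ _) q (q.base.1, h)
      (Prod.ext (Category.id_comp _) (he.trans hq.symm))
    exact ⟨homMk (A := fam a) (k := (X.base, l)) (l := (Z.base, m)) (q.base.1, h) φ, rfl, hφ⟩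
  cart_cancel {k l m} g h X Z p q hp hq e :=
    W_cancel (A := fam a) (s := vcart (A := fam a) (i := X.base) g X.fib) (W_cart _ _) (Prod.ext (fst_base_eq_of_vcart_comp (A := fam a) (i := X.base) (x := X.fib) g e) (hp.trans hq.symm)) e

/-- The inclusion of the total category of the restriction to the first factor. -/
abbrev colIncl (k : K) : (fam (col a k)).Tot ⥤ (fam a).Tot :=
  famPullTot (CategoryTheory.Prod.sectL I k) a

/-- The action of the transition functors on morphisms of total categories. -/
noncomputable abbrev colTr {i j : I} {k l : K} (g : k ⟶ l) {x : (fam a).obj (i, k)}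
    {y : (fam a).obj (j, k)} (p : (⟨i, x⟩ : (fam (col a k)).Tot) ⟶ ⟨j, y⟩) :
    (⟨i, ((fam a).vtr i g).obj x⟩ : (fam (col a l)).Tot) ⟶ ⟨j, ((fam a).vtr j g).obj y⟩ :=
  (colOpfibration a).trMap (x := ⟨i, x⟩) (y := ⟨j, y⟩) g p

theorem vcart_colTr {i j : I} {k l : K} (g : k ⟶ l) {x : (fam a).obj (i, k)}
    {y : (fam a).obj (j, k)} (p : (⟨i, x⟩ : (fam (col a k)).Tot) ⟶ ⟨j, y⟩) :
    vcart g x ≫ (colIncl a l).map (colTr a g p) = (colIncl a k).map p ≫ vcart g y :=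
  (colOpfibration a).cart_trMap g p

theorem vcart_map_comp {i j m : I} {k l : K} (g : k ⟶ l) {x : (fam a).obj (i, k)}
    {y : (fam a).obj (j, l)} {z : (fam a).obj (m, l)}
    (p : (⟨i, ((fam a).vtr i g).obj x⟩ : (fam (col a l)).Tot) ⟶ ⟨j, y⟩)
    (q : (⟨j, y⟩ : (fam (col a l)).Tot) ⟶ ⟨m, z⟩) :
    vcart g x ≫ (colIncl a l).map (p ≫ q) =
      (vcart g x ≫ (colIncl a l).map p) ≫ (colIncl a l).map q :=
  (congrArg (_ ≫ ·) ((colIncl a l).map_comp p q)).trans (Category.assoc _ _ _).symm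

/-- The transition functors of the columns preserve cocartesian morphisms, hence descend to the
localizations. -/
theorem W_colTr {i j : I} {k l : K} (g : k ⟶ l) {x : (fam a).obj (i, k)}
    {y : (fam a).obj (j, k)} (p : (⟨i, x⟩ : (fam (col a k)).Tot) ⟶ ⟨j, y⟩)
    (hp : (fam (col a k)).W p) : (fam (col a l)).W (colTr a g p) := by
  have h : (fam a).W (vcart g x ≫ (colIncl a l).map (colTr a g p)) := by
    rw [vcart_colTr]
    exact MorphismProperty.comp_mem _ _ _ hp (W_cart _ _)
  exact W_of_W_comp (A := fam a) (s := vcart g x) (p := (colIncl a l).map (colTr a g p))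
    (W_cart _ _) h

/-- The localizations of the total categories of the restrictions to the first factor. -/
noncomputable def colFam : Fam K :=
  (colOpfibration a).fam.localize (fun k => (fam (col a k)).W) fun g _ _ p hp =>
    W_colTr a g p hp

/-- The comparison morphism for the universal cocones. -/
noncomputable def colN {i j : I} {k l : K} (f : i ⟶ j) (g : k ⟶ l) (x : (fam a).obj (i, k)) :
    (⟨i, ((fam a).vtr i g).obj x⟩ : (fam (col a l)).Tot) ⟶
      ⟨j, ((fam a).tr (k := (i, k)) (l := (j, l)) (f, g)).obj x⟩ :=
  (colOpfibration a).desc (x := ⟨i, x⟩) (y := ⟨j, ((fam a).tr (k := (i, k)) (l := (j, l)) (f, g)).obj x⟩)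
    (q := cart (A := fam a) (k := (i, k)) (l := (j, l)) (f, g) x) g rfl

theorem vcart_colN {i j : I} {k l : K} (f : i ⟶ j) (g : k ⟶ l) (x : (fam a).obj (i, k)) :
    vcart g x ≫ (colIncl a l).map (colN a f g x) =
      cart (A := fam a) (k := (i, k)) (l := (j, l)) (f, g) x :=
  (colOpfibration a).cart_desc (x := ⟨i, x⟩)
    (y := ⟨j, ((fam a).tr (k := (i, k)) (l := (j, l)) (f, g)).obj x⟩)
    (q := cart (A := fam a) (k := (i, k)) (l := (j, l)) (f, g) x) g rfl

theorem W_colN {i j : I} {k l : K} (f : i ⟶ j) (g : k ⟶ l) (x : (fam a).obj (i, k)) :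
    (fam (col a l)).W (colN a f g x) := by
  have h : (fam a).W (vcart g x ≫ (colIncl a l).map (colN a f g x)) := by
    rw [vcart_colN]
    exact W_cart _ _
  exact W_of_W_comp (A := fam a) (s := vcart g x) (p := (colIncl a l).map (colN a f g x))
    (W_cart _ _) h

theorem col_hom_ext {i j : I} {k l : K} (g : k ⟶ l) {x : (fam a).obj (i, k)}
    {y : (fam a).obj (j, l)}
    {p q : (⟨i, ((fam a).vtr i g).obj x⟩ : (fam (col a l)).Tot) ⟶ ⟨j, y⟩}
    (h : vcart g x ≫ (colIncl a l).map p =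
      vcart g x ≫ (colIncl a l).map q) : p = q :=
  (colOpfibration a).hom_ext g (x := ⟨i, x⟩) (y := ⟨j, y⟩) h

/-- As with the unit and composition laws below, the identity is checked in the total category of
`a` after precomposing with `vcart`, where both sides reduce to cocartesian morphisms of `a`. -/
theorem colN_naturality {i j : I} {k l : K} (f : i ⟶ j) (g : k ⟶ l) {x y : (fam a).obj (i, k)}
    (φ : x ⟶ y) :
    colTr a g (vert (A := fam (col a k)) (k := i) φ) ≫ colN a f g y =
      colN a f g x ≫ vert (A := fam (col a l)) (k := j)
        (((fam a).tr (k := (i, k)) (l := (j, l)) (f, g)).map φ) := by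
  refine col_hom_ext a g ((vcart_map_comp a g _ _).trans (Eq.trans ?_ (vcart_map_comp a g _ _).symm))
  refine (congrArg (· ≫ _) (vcart_colTr a g _)).trans ((Category.assoc _ _ _).trans ?_)
  refine (congrArg₂ (· ≫ ·) (famPullTot_map_vert _ _ _) (vcart_colN a f g y)).trans ?_
  refine (vert_cart (A := fam a) (k := (i, k)) (l := (j, l)) φ (f, g)).trans ?_
  exact (congrArg₂ (· ≫ ·) (vcart_colN a f g x) (famPullTot_map_vert _ _ _)).symm

theorem colN_unit {i : I} {k : K} (e : (i, k) ⟶ (i, k)) (he : e = 𝟙 (i, k))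
    (x : (fam a).obj (i, k)) :
    colN a e.1 e.2 x ≫ vert (A := fam (col a k)) (k := i) ((fam a).unit e he x).hom =
      ((colOpfibration a).unit e.2 (congrArg Prod.snd he) ⟨i, x⟩).hom := by
  refine col_hom_ext a e.2 ((vcart_map_comp a e.2 _ _).trans ?_)
  refine Eq.trans ?_ ((colOpfibration a).cart_unit e.2 (congrArg Prod.snd he) ⟨i, x⟩).symm
  refine (congrArg₂ (· ≫ ·) (vcart_colN a e.1 e.2 x) (famPullTot_map_vert _ _ _)).trans ?_
  exact cart_unit (A := fam a) e he x

/-- The comparison of the transition morphisms along a composite. -/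
noncomputable abbrev colMul {i : I} {k l m : K} (f : k ⟶ l) (g : l ⟶ m) (h : k ⟶ m) (e : f ≫ g = h)
    (x : (fam a).obj (i, k)) : (⟨i, ((fam a).vtr i h).obj x⟩ : (fam (col a m)).Tot) ⟶
      ⟨i, ((fam a).vtr i g).obj (((fam a).vtr i f).obj x)⟩ :=
  ((colOpfibration a).mul f g h e ⟨i, x⟩).hom

theorem vcart_colMul {i : I} {k l m : K} (f : k ⟶ l) (g : l ⟶ m) (h : k ⟶ m) (e : f ≫ g = h)
    (x : (fam a).obj (i, k)) : vcart h x ≫ (colIncl a m).map (colMul a f g h e x) =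
      vcart f x ≫ vcart g _ := (colOpfibration a).cart_mul f g h e ⟨i, x⟩

theorem colN_mul {i j m : I} {k l n : K} (f : (i, k) ⟶ (j, l)) (g : (j, l) ⟶ (m, n))
    (h : (i, k) ⟶ (m, n)) (e : f ≫ g = h) (x : (fam a).obj (i, k)) :
    colMul a f.2 g.2 h.2 (congrArg Prod.snd e) x ≫
      colTr a g.2 (colN a f.1 f.2 x) ≫ colN a g.1 g.2 (((fam a).tr f).obj x) =
    colN a h.1 h.2 x ≫ vert (A := fam (col a n)) (k := m) ((fam a).mul f g h e x).hom := by
  refine col_hom_ext a h.2 ((vcart_map_comp a h.2 _ _).trans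
    (Eq.trans ?_ (vcart_map_comp a h.2 _ _).symm))
  refine (congrArg (· ≫ _) (vcart_colMul a _ _ _ _ x)).trans ((Category.assoc _ _ _).trans ?_)
  refine (congrArg (vcart f.2 x ≫ ·) (vcart_map_comp a g.2 _ _)).trans ?_
  refine (congrArg (fun z => vcart f.2 x ≫ z ≫ _) (vcart_colTr a g.2 _)).trans ?_
  refine (congrArg (vcart f.2 x ≫ ·) (Category.assoc _ _ _)).trans ((Category.assoc _ _ _).symm.trans ?_)
  refine (congrArg₂ (· ≫ ·) (vcart_colN a f.1 f.2 x) (vcart_colN a g.1 g.2 _)).trans ?_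
  refine (cart_mul (A := fam a) f g h e x).symm.trans ?_
  exact (congrArg₂ (· ≫ ·) (vcart_colN a h.1 h.2 x) (famPullTot_map_vert _ _ _)).symm

theorem colFam_tr_map {k l : K} (g : k ⟶ l) {X Y : (fam (col a k)).Tot} (p : X ⟶ Y) :
    ((colFam a).tr g).map ((fam (col a k)).W.Q.map p) = (fam (col a l)).W.Q.map (colTr a g p) :=
  lift_map_Q _ _ p

/-- The universal cocones, in terms of objects and morphisms. -/
noncomputable def colTrans : (fam a).Trans (Fam.pull (pr2 I K) (colFam a)) :=
  Trans.ofInv (fun k => (fam (col a k.2)).fibre k.1 ⋙ (fam (col a k.2)).W.Q)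
    (fun {k l} f x => (fam (col a l.2)).W.Q.map (colN a f.1 f.2 x))
    (fun f x => (fam (col a _)).W.Q_inverts _ (W_colN a f.1 f.2 x))
    (fun {k l} f x y φ => by
      let Q := (fam (col a l.2)).W.Q
      exact (congrArg (· ≫ Q.map (colN a f.1 f.2 y)) (colFam_tr_map a f.2 _)).trans
        ((Q.map_comp _ _).symm.trans ((congrArg Q.map (colN_naturality a f.1 f.2 φ)).trans
          (Q.map_comp _ _))))
    (fun {k} e he x => ((fam (col a k.2)).W.Q.map_comp _ _).symm.trans
      (congrArg (fam (col a k.2)).W.Q.map (colN_unit a e he x)))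
    (fun {k l m} f g h e x => by
      let Q := (fam (col a m.2)).W.Q
      exact (congrArg (fun z => Q.map (colMul a f.2 g.2 h.2 (congrArg Prod.snd e) x) ≫ z ≫
          Q.map (colN a g.1 g.2 (((fam a).tr f).obj x))) (colFam_tr_map a g.2 _)).trans
        ((congrArg (_ ≫ ·) (Q.map_comp _ _).symm).trans ((Q.map_comp _ _).symm.trans
          ((congrArg Q.map (colN_mul a f g h e x)).trans (Q.map_comp _ _)))))

variable {a}

/-- A transformation to a diagram on the second factor from its description in terms of objects and
morphisms. -/
def mkSnd {B : Fam K} (t : (fam a).Trans (Fam.pull (pr2 I K) B)) : a ⟶ ofSnd (mkDiagram B) :=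
  mkTrans
    { ap := t.ap
      nat := t.nat
      naturality := t.naturality
      nat_unit := fun {k} e he x => by
        refine Eq.trans (congrArg (_ ≫ ·) ?_) (t.nat_unit e he x)
        exact (congrArg Iso.hom (fam_pull_unit (CategoryTheory.Prod.snd I K) (mkDiagram B) e he _)).trans
          (fam_mkDiagram_unit B _ _ _)
      nat_mul := fun f g h e x => by
        refine Eq.trans (congrArg (_ ≫ ·) ?_) (t.nat_mul f g h e x)
        exact (congrArg Iso.hom (fam_pull_mul (CategoryTheory.Prod.snd I K) (mkDiagram B) f g h e _)).trans
          (fam_mkDiagram_mul B _ _ _ _ _) }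

theorem conat_colCocone_mkSnd {B : Fam K} (t : (fam a).Trans (Fam.pull (pr2 I K) B)) {i j : I}
    (f : i ⟶ j) (k : K) (x : (fam a).obj (i, k)) : (conat (colCocone (mkSnd t) k) f x).hom =
      (t.nat (k := (i, k)) (l := (j, k)) (f, 𝟙 k) x).hom ≫
        (B.unit (𝟙 k) rfl ((t.ap (i, k)).obj x)).hom :=
  congrArg ((t.nat (k := (i, k)) (l := (j, k)) (f, 𝟙 k) x).hom ≫ ·)
    ((fam_unit_hom (mkDiagram B) _).symm.trans (fam_mkDiagram_unit B _ _ _))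

variable (a)

/-- Over `𝟙 k` the morphism `colN` is the unit constraint followed by the cocartesian morphism of
the column; this unit cancels the identity constraint inserted by `colCocone`. -/
theorem conat_colTrans_inv {i j : I} (f : i ⟶ j) (k : K) (x : (fam a).obj (i, k)) :
    (conat (colCocone (mkSnd (colTrans a)) k) f x).inv =
      (fam (col a k)).W.Q.map (cart (A := fam (col a k)) f x) := by
  have h : colN a f (𝟙 k) x =
      ((colOpfibration a).unit (𝟙 k) rfl ⟨i, x⟩).hom ≫ cart (A := fam (col a k)) f x := by
    refine col_hom_ext a (𝟙 k) ((vcart_colN a f (𝟙 k) x).trans ?_)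
    refine Eq.trans ?_ ((vcart_map_comp a (𝟙 k) _ _).trans (Category.assoc _ _ _)).symm
    exact ((colOpfibration a).cart_unit_assoc (𝟙 k) rfl ⟨i, x⟩ _).symm
  refine Iso.inv_ext ?_
  refine (congrArg (· ≫ _) (conat_colCocone_mkSnd (colTrans a) f k x)).trans ?_
  refine (Category.assoc _ _ _).trans ?_
  refine (congrArg (_ ≫ ·) (((fam (col a k)).W.Q.map_comp _ _).symm.trans
    (congrArg (fam (col a k)).W.Q.map h.symm))).trans ?_
  exact ((colTrans a).nat (k := (i, k)) (l := (j, k)) (f, 𝟙 k) x).hom_inv_id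

/-- The functor on the total category induced by this cocone agrees with the localization functor on
cocartesian and on vertical morphisms, hence on all morphisms. -/
theorem isTwoColimit_colCocone (k : K) : IsTwoColimit (colCocone (mkSnd (colTrans a)) k) := by
  let T := toTot (colCocone (mkSnd (colTrans a)) k)
  let Q : (fam (col a k)).Tot ⥤ (mkDiagram (colFam a)).obj ⟨k⟩ := (fam (col a k)).W.Q
  have hv {i : I} {x y : (fam (col a k)).obj i} (φ : x ⟶ y) : T.map (vert φ) = Q.map (vert φ) :=
    toTot_map_vert _ φ
  have hc {i j : I} (f : i ⟶ j) (x : (fam (col a k)).obj i) : T.map (cart f x) = Q.map (cart f x) :=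
    (toTot_map_cart _ f x).trans (conat_colTrans_inv a f k x)
  have h {Y Z : (fam (col a k)).Tot} (p : Y ⟶ Z) : T.map p = Q.map p := by
    rw [hom_eq p, Functor.map_comp, Functor.map_comp]
    exact congrArg₂ (· ≫ ·) (hc p.base Y.fib) (hv p.fib)
  have e : Q ≅ T := NatIso.ofComponents (fun Y => Iso.refl (Q.obj Y)) (fun p =>
    (Category.comp_id _).trans ((h p).symm.trans (Category.id_comp _).symm))
  have hQ : Q.IsLocalization (fam (col a k)).W :=
    inferInstanceAs ((fam (col a k)).W.Q.IsLocalization (fam (col a k)).W)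
  have : T.IsLocalization (fam (col a k)).W := Functor.IsLocalization.of_iso _ e
  exact isTwoColimit_of_isLocalization _

/-- Every diagram has a colimit. -/
theorem exists_isTwoColimit (b : Diagram K) :
    ∃ (P : Cat.{u, u}) (σ : b ⟶ const K P), IsTwoColimit σ := by
  let P : Cat.{u, u} := Cat.of (fam b).W.Localization
  let Q : (fam b).Tot ⥤ P := (fam b).W.Q
  have hQ {k l : K} (f : k ⟶ l) (x : (fam b).obj k) : IsIso (Q.map (cart f x)) :=
    (fam b).W.Q_inverts _ (W_cart f x)
  have h : Q.IsLocalization (fam b).W := inferInstanceAs ((fam b).W.Q.IsLocalization (fam b).W)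
  have := Functor.IsLocalization.of_iso (fam b).W (toTotMkCocone Q hQ).symm
  exact ⟨P, mkCocone Q hQ, isTwoColimit_of_isLocalization _⟩

end TwoLim

/-! ### The opfibration of descent data of the rows -/

namespace TwoLim

open Fam

variable {I K : Type u} [SmallCategory I] [SmallCategory K] (a : Diagram (I × K))

theorem exists_eq_vert {A : Fam K} {k : K} {x y : A.obj k} (p : (⟨k, x⟩ : A.Tot) ⟶ ⟨k, y⟩)
    (h : p.base = 𝟙 k) : ∃ φ, vert φ = p := by
  obtain ⟨φ, hφ⟩ := W_fac_vert (MorphismProperty.id_mem A.W _) p h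
  exact ⟨φ, (Category.id_comp _).symm.trans hφ⟩

/-- The inclusion of the total category of the restriction to the second factor. -/
abbrev rowIncl (i : I) : (fam (row a i)).Tot ⥤ (fam a).Tot :=
  famPullTot (CategoryTheory.Prod.sectR i K) a

theorem rowIncl_map_vert {i : I} {k : K} {x y : (fam a).obj (i, k)} (φ : x ⟶ y) :
    (rowIncl a i).map (vert (A := fam (row a i)) (k := k) φ) = vert (A := fam a) φ :=
  famPullTot_map_vert _ _ _

/-- The functor given by a descent datum. -/
@[simps]
def rowFunctor {i : I} (c : Desc (fam (row a i))) : K ⥤ (fam a).Tot where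
  obj k := ⟨(i, k), c.obj k⟩
  map g := (rowIncl a i).map (c.mor g)
  map_id k := (congrArg (rowIncl a i).map (c.mor_id k)).trans ((rowIncl a i).map_id ⟨k, c.obj k⟩)
  map_comp g h := (congrArg (rowIncl a i).map (c.mor_comp g h)).trans ((rowIncl a i).map_comp _ _)

/-- Descent data as functors. -/
@[simps obj]
def rowFunctorFunctor (i : I) : Desc (fam (row a i)) ⥤ K ⥤ (fam a).Tot where
  obj c := rowFunctor a c
  map {c d} p :=
    { app := fun k => vert (A := fam a) (k := (i, k)) (p.app k)
      naturality := fun k l g => by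
        have h := ((rowIncl a i).map_comp _ _).symm.trans
          ((congrArg (rowIncl a i).map (p.comm g)).trans ((rowIncl a i).map_comp _ _))
        exact (congrArg (_ ≫ ·) (rowIncl_map_vert a (p.app l))).symm.trans (h.trans
          (congrArg (· ≫ _) (rowIncl_map_vert a (p.app k)))) }
  map_id c := NatTrans.ext (funext fun k => vert_id _)
  map_comp p q := NatTrans.ext (funext fun k => vert_comp _ _)

section

variable {a} {i : I} (y : ∀ k, (fam a).obj (i, k))
    (m : ∀ {k l : K} (_ : k ⟶ l), (⟨(i, k), y k⟩ : (fam a).Tot) ⟶ ⟨(i, l), y l⟩)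
    (hb : ∀ {k l : K} (g : k ⟶ l), (m g).base = (𝟙 i, g))

theorem exists_rowIncl_map_eq {k l : K} {x : (fam a).obj (i, k)} {y : (fam a).obj (i, l)}
    (p : (⟨(i, k), x⟩ : (fam a).Tot) ⟶ ⟨(i, l), y⟩) (g : k ⟶ l) (h : p.base = (𝟙 i, g)) :
    ∃ φ, (rowIncl a i).map (homMk (A := fam (row a i)) (x := x) (y := y) g φ) = p := by
  obtain ⟨φ, hφ⟩ := exists_eq_homMk p _ h
  exact ⟨φ, hφ.symm⟩

/-- The base of the image is `(𝟙 i, g)`, which remembers `g`, so equality of bases comes for free.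
-/
theorem rowIncl_map_injective {k l : K} {x : (fam a).obj (i, k)} {y : (fam a).obj (i, l)}
    {p q : (⟨k, x⟩ : (fam (row a i)).Tot) ⟶ ⟨l, y⟩}
    (h : (rowIncl a i).map p = (rowIncl a i).map q) : p = q :=
  famPullTot_map_injective (congrArg (fun z => Prod.snd (TotHom.base z)) h) h

/-- A descent datum from its structure morphisms in the total category. -/
noncomputable def rowDesc (hW : ∀ {k l : K} (g : k ⟶ l), (fam a).W (m g))
    (hid : ∀ k, m (𝟙 k) = 𝟙 _)
    (hcomp : ∀ {k l n : K} (g : k ⟶ l) (h : l ⟶ n), m (g ≫ h) = m g ≫ m h) :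
    Desc (fam (row a i)) where
  obj := y
  θ g := (exists_rowIncl_map_eq (m g) g (hb g)).choose
  isIso {k l} g := by
    have h := hW g
    rw [← (exists_rowIncl_map_eq (m g) g (hb g)).choose_spec] at h
    exact h
  id k := rowIncl_map_injective ((exists_rowIncl_map_eq (m (𝟙 k)) _ (hb _)).choose_spec.trans
    ((hid k).trans ((rowIncl a i).map_id ⟨k, y k⟩).symm))
  comp {k l n} g h := rowIncl_map_injective
    ((exists_rowIncl_map_eq (m (g ≫ h)) _ (hb _)).choose_spec.trans ((hcomp g h).trans
      ((congrArg₂ (· ≫ ·) (exists_rowIncl_map_eq (m g) _ (hb _)).choose_spec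
        (exists_rowIncl_map_eq (m h) _ (hb _)).choose_spec).symm.trans
        ((rowIncl a i).map_comp (X := ⟨k, y k⟩) (Y := ⟨l, y l⟩) (Z := ⟨n, y n⟩) _ _).symm)))

theorem rowIncl_map_rowDesc_mor (hW : ∀ {k l : K} (g : k ⟶ l), (fam a).W (m g))
    (hid : ∀ k, m (𝟙 k) = 𝟙 _)
    (hcomp : ∀ {k l n : K} (g : k ⟶ l) (h : l ⟶ n), m (g ≫ h) = m g ≫ m h) {k l : K}
    (g : k ⟶ l) : (rowIncl a i).map ((rowDesc y m hb hW hid hcomp).mor g) = m g :=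
  (exists_rowIncl_map_eq (m g) g (hb g)).choose_spec

end

/-- The morphism in the total category given by a component of a transformation. -/
abbrev rowApp {i j : I} {c : Desc (fam (row a i))} {d : Desc (fam (row a j))}
    (q : rowFunctor a c ⟶ rowFunctor a d) (k : K) :
    (⟨(i, k), c.obj k⟩ : (fam a).Tot) ⟶ ⟨(j, k), d.obj k⟩ := q.app k

/-- The structure morphisms of a descent datum in the total category. -/
abbrev rowMor {i : I} (c : Desc (fam (row a i))) {k l : K} (g : k ⟶ l) :
    (⟨(i, k), c.obj k⟩ : (fam a).Tot) ⟶ ⟨(i, l), c.obj l⟩ := (rowIncl a i).map (c.mor g)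

theorem W_rowMor {i : I} (c : Desc (fam (row a i))) {k l : K} (g : k ⟶ l) :
    (fam a).W (rowMor a c g) := c.isIso g

theorem rowMor_id {i : I} (c : Desc (fam (row a i))) (k : K) : rowMor a c (𝟙 k) = 𝟙 _ :=
  (rowFunctor a c).map_id k

theorem rowMor_comp {i : I} (c : Desc (fam (row a i))) {k l m : K} (g : k ⟶ l) (h : l ⟶ m) :
    rowMor a c (g ≫ h) = rowMor a c g ≫ rowMor a c h := (rowFunctor a c).map_comp g h

theorem rowMor_app {i j : I} {c : Desc (fam (row a i))} {d : Desc (fam (row a j))}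
    (q : rowFunctor a c ⟶ rowFunctor a d) {k l : K} (g : k ⟶ l) :
    rowMor a c g ≫ rowApp a q l = rowApp a q k ≫ rowMor a d g := q.naturality g

section

variable {i j : I} (f : i ⟶ j) (c : Desc (fam (row a i)))

/-- The cocartesian morphisms from the components of a descent datum. -/
abbrev rowCart (k : K) : (⟨(i, k), c.obj k⟩ : (fam a).Tot) ⟶
    ⟨(j, k), ((fam a).htr f k).obj (c.obj k)⟩ := hcart (A := fam a) f (k := k) (c.obj k)

variable {f c} in
theorem rowCart_cancel {k : K} {Z : (fam a).Tot}
    {p q : (⟨(j, k), ((fam a).htr f k).obj (c.obj k)⟩ : (fam a).Tot) ⟶ Z} (hb : p.base = q.base)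
    (h : rowCart a f c k ≫ p = rowCart a f c k ≫ q) : p = q :=
  W_cancel (A := fam a) (W_cart _ _) hb h

theorem exists_pushMor {k l : K} (g : k ⟶ l) :
    ∃ p' : (⟨(j, k), ((fam a).htr f k).obj (c.obj k)⟩ : (fam a).Tot) ⟶
        ⟨(j, l), ((fam a).htr f l).obj (c.obj l)⟩,
      p'.base = (𝟙 j, g) ∧ rowCart a f c k ≫ p' = rowMor a c g ≫ rowCart a f c l :=
  exists_push f g (rowMor a c g) rfl

/-- Transport of the structure morphisms of a descent datum. -/
noncomputable def pushMor {k l : K} (g : k ⟶ l) :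
    (⟨(j, k), ((fam a).htr f k).obj (c.obj k)⟩ : (fam a).Tot) ⟶
      ⟨(j, l), ((fam a).htr f l).obj (c.obj l)⟩ := (exists_pushMor a f c g).choose

theorem pushMor_base {k l : K} (g : k ⟶ l) : (pushMor a f c g).base = (𝟙 j, g) :=
  (exists_pushMor a f c g).choose_spec.1

theorem rowCart_pushMor {k l : K} (g : k ⟶ l) :
    rowCart a f c k ≫ pushMor a f c g = rowMor a c g ≫ rowCart a f c l :=
  (exists_pushMor a f c g).choose_spec.2

theorem W_pushMor {k l : K} (g : k ⟶ l) : (fam a).W (pushMor a f c g) :=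
  W_push (A := fam a) (rowCart_pushMor a f c g) (W_rowMor a c g)

theorem pushMor_id (k : K) : pushMor a f c (𝟙 k) = 𝟙 _ :=
  rowCart_cancel a (pushMor_base a f c _) (by
    rw [rowCart_pushMor, rowMor_id, Category.id_comp, Category.comp_id])

theorem pushMor_comp {k l m : K} (g : k ⟶ l) (h : l ⟶ m) :
    pushMor a f c (g ≫ h) = pushMor a f c g ≫ pushMor a f c h :=
  rowCart_cancel a ((pushMor_base a f c _).trans (by
    rw [base_comp, pushMor_base, pushMor_base]
    exact Prod.ext (Category.comp_id _).symm rfl)) (by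
    rw [rowCart_pushMor, rowMor_comp, ← Category.assoc, rowCart_pushMor, Category.assoc,
      Category.assoc, rowCart_pushMor])

/-- Transport of descent data. -/
noncomputable def pushDesc : Desc (fam (row a j)) :=
  rowDesc (fun k => ((fam a).htr f k).obj (c.obj k)) (fun g => pushMor a f c g)
    (fun g => pushMor_base a f c g) (fun g => W_pushMor a f c g) (fun k => pushMor_id a f c k)
    (fun g h => pushMor_comp a f c g h)

theorem rowMor_pushDesc {k l : K} (g : k ⟶ l) : rowMor a (pushDesc a f c) g = pushMor a f c g :=
  rowIncl_map_rowDesc_mor _ _ _ (fun g => W_pushMor a f c g) (fun k => pushMor_id a f c k)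
    (fun g h => pushMor_comp a f c g h) g

/-- The cocartesian transformation from a descent datum. -/
noncomputable def pushCart : rowFunctor a c ⟶ rowFunctor a (pushDesc a f c) where
  app k := rowCart a f c k
  naturality k _ g := ((rowCart_pushMor a f c g).symm.trans
    (congrArg (rowCart a f c k ≫ ·) (rowMor_pushDesc a f c g).symm))

/-- Each component factors through its own cocartesian morphism, and naturality of the factors in
`k` follows by cancelling those morphisms. -/
theorem exists_pushCart_fac {m : I} (h : j ⟶ m) {e : i ⟶ m} (he : f ≫ h = e)
    {d : Desc (fam (row a m))} (q : rowFunctor a c ⟶ rowFunctor a d)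
    (hq : ∀ k, (rowApp a q k).base = (e, 𝟙 k)) :
    ∃ q' : rowFunctor a (pushDesc a f c) ⟶ rowFunctor a d,
      (∀ k, (rowApp a q' k).base = (h, 𝟙 k)) ∧ pushCart a f c ≫ q' = q := by
  have H (k : K) := W_fac (A := fam a) (s := rowCart a f c k) (W_cart _ _) (rowApp a q k) (h, 𝟙 k)
    ((Prod.ext he (Category.comp_id _)).trans (hq k).symm)
  choose φ hφ using H
  let r (k : K) : (⟨(j, k), ((fam a).htr f k).obj (c.obj k)⟩ : (fam a).Tot) ⟶ ⟨(m, k), d.obj k⟩ :=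
    homMk (A := fam a) (k := (j, k)) (l := (m, k)) (h, 𝟙 k) (φ k)
  have hr (k : K) : rowCart a f c k ≫ r k = rowApp a q k := hφ k
  have hn {k l : K} (g : k ⟶ l) : pushMor a f c g ≫ r l = r k ≫ rowMor a d g := by
    refine rowCart_cancel a ?_ ?_
    · rw [base_comp, base_comp, pushMor_base]
      exact Prod.ext ((Category.id_comp h).trans (Category.comp_id h).symm)
        ((Category.comp_id g).trans (Category.id_comp g).symm)
    · rw [← Category.assoc, rowCart_pushMor, Category.assoc, hr, rowMor_app, ← Category.assoc, hr]
  exact ⟨{ app := r, naturality := fun k l g =>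
    (congrArg (· ≫ r l) (rowMor_pushDesc a f c g)).trans (hn g) }, fun _ => rfl,
    NatTrans.ext (funext fun k => hr k)⟩

end

/-- The opfibration whose fibres are the categories of descent data. -/
noncomputable def rowOpfibration : Opfibration I (K ⥤ (fam a).Tot) where
  fib i := Desc (fam (row a i))
  incl i := rowFunctorFunctor a i
  IsOver f _ _ q := ∀ k, (rowApp a q k).base = (f, 𝟙 k)
  isOver_map _ _ := rfl
  isOver_comp := by
    rintro i j m f h e rfl x y z p q hp hq k
    exact (congrArg₂ (· ≫ ·) (hp k) (hq k)).trans (Prod.ext rfl (Category.comp_id _))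
  incl_injective {i c d p q} h := Desc.hom_ext fun k =>
    vert_injective (A := fam a) (congrArg (fun z => NatTrans.app z k) h)
  exists_map_eq {i c d} q hq := by
    choose φ hφ using fun k => exists_eq_vert (rowApp a q k) (hq k)
    refine ⟨⟨φ, fun {k l} g => rowIncl_map_injective ?_⟩, NatTrans.ext (funext hφ)⟩
    refine ((rowIncl a i).map_comp _ _).trans (Eq.trans ?_ ((rowIncl a i).map_comp _ _).symm)
    refine (congrArg (rowMor a c g ≫ ·) ((rowIncl_map_vert a (φ l)).trans (hφ l))).trans ?_
    refine (rowMor_app a q g).trans ?_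
    exact (congrArg (· ≫ rowMor a d g) ((rowIncl_map_vert a (φ k)).trans (hφ k))).symm
  push f c := pushDesc a f c
  cart f c := pushCart a f c
  isOver_cart _ _ _ := rfl
  exists_fac {i j m} f h e he c d q hq := exists_pushCart_fac a f c h he q hq
  cart_cancel {i j m} f h c d p q hp hq e := NatTrans.ext (funext fun k =>
    W_cancel (A := fam a) (W_cart (A := fam a) (k := (i, k)) (l := (j, k)) (f, 𝟙 k) (c.obj k))
      ((hp k).trans (hq k).symm) (congrArg (fun z => NatTrans.app z k) e))

end TwoLim

/-! ### Existence of the 2-limits, functorially in the first variable -/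

namespace TwoLim

open Fam

variable {I K : Type u} [SmallCategory I] [SmallCategory K] (a : Diagram (I × K))

/-- The categories of descent data of the restrictions to the second factor. -/
noncomputable def rowFam : Fam I := (rowOpfibration a).fam

section

variable {i j : I} (f : i ⟶ j)

/-- The components of transport of morphisms of descent data. -/
noncomputable abbrev rowTr {c d : Desc (fam (row a i))} (p : c ⟶ d) :
    pushDesc a f c ⟶ pushDesc a f d := (rowOpfibration a).trMap (x := c) (y := d) f p

theorem rowCart_rowTr {c d : Desc (fam (row a i))} (p : c ⟶ d) (k : K) :
    rowCart a f c k ≫ vert (A := fam a) ((rowTr a f p).app k) =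
      vert (A := fam a) (k := (i, k)) (p.app k) ≫ rowCart a f d k :=
  congrArg (fun z => NatTrans.app z k) ((rowOpfibration a).cart_trMap (x := c) (y := d) f p)

theorem rowCart_unit (e : i ⟶ i) (he : e = 𝟙 i) (c : Desc (fam (row a i))) (k : K) :
    rowCart a e c k ≫ vert (A := fam a) (k := (i, k))
      (Desc.Hom.app ((rowOpfibration a).unit e he c).hom k) = 𝟙 _ :=
  congrArg (fun z => NatTrans.app z k) ((rowOpfibration a).cart_unit e he c)

theorem rowCart_mul {m : I} (g : j ⟶ m) (h : i ⟶ m) (e : f ≫ g = h) (c : Desc (fam (row a i)))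
    (k : K) : rowCart a h c k ≫ vert (A := fam a) (k := (m, k))
      (Desc.Hom.app ((rowOpfibration a).mul f g h e c).hom k) =
        rowCart a f c k ≫ rowCart a g (pushDesc a f c) k :=
  congrArg (fun z => NatTrans.app z k) ((rowOpfibration a).cart_mul f g h e c)

theorem vert_app_rowMor {c d : Desc (fam (row a i))} (p : c ⟶ d) {k l : K} (g : k ⟶ l) :
    rowMor a c g ≫ vert (A := fam a) (k := (i, l)) (p.app l) =
      vert (A := fam a) (k := (i, k)) (p.app k) ≫ rowMor a d g :=
  ((rowFunctorFunctor a i).map p).naturality g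

theorem rowCart_rowMor (c : Desc (fam (row a i))) {k l : K} (g : k ⟶ l) :
    rowCart a f c k ≫ rowMor a (pushDesc a f c) g = rowMor a c g ≫ rowCart a f c l :=
  ((pushCart a f c).naturality g).symm

end

/-- The comparison morphisms of the evaluations, in the total category. -/
noncomputable def rowN {i j : I} {k l : K} (f : (i, k) ⟶ (j, l)) (c : Desc (fam (row a i))) :
    (⟨(i, k), c.obj k⟩ : (fam a).Tot) ⟶ ⟨(j, l), (pushDesc a f.1 c).obj l⟩ :=
  rowCart a f.1 c k ≫ rowMor a (pushDesc a f.1 c) f.2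

theorem rowN_base {i j : I} {k l : K} (f : (i, k) ⟶ (j, l)) (c : Desc (fam (row a i))) :
    (rowN a f c).base = f := Prod.ext (Category.comp_id _) (Category.id_comp _)

theorem W_rowN {i j : I} {k l : K} (f : (i, k) ⟶ (j, l)) (c : Desc (fam (row a i))) :
    (fam a).W (rowN a f c) :=
  MorphismProperty.comp_mem _ _ _ (W_cart (A := fam a) _ _) (W_rowMor a (pushDesc a f.1 c) f.2)

theorem rowN_naturality {i j : I} {k l : K} (f : (i, k) ⟶ (j, l)) {c d : Desc (fam (row a i))}
    (p : c ⟶ d) : vert (A := fam a) (k := (i, k)) (p.app k) ≫ rowN a f d =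
      rowN a f c ≫ vert (A := fam a) (k := (j, l)) ((rowTr a f.1 p).app l) := by
  refine (Category.assoc _ _ _).symm.trans ((congrArg (· ≫ _) (rowCart_rowTr a f.1 p k)).symm.trans ?_)
  refine (Category.assoc _ _ _).trans (Eq.trans ?_ (Category.assoc _ _ _).symm)
  exact congrArg (_ ≫ ·) (vert_app_rowMor a (rowTr a f.1 p) f.2).symm

/-- Only the first component of `e` has to be an identity. Taking both trivial gives the unit law of
`rowTrans`; taking `(𝟙 i, g)` identifies the descent structure seen by the cone at `i`. -/
theorem rowN_unit {i : I} {k l : K} (e : (i, k) ⟶ (i, l)) (he : e.1 = 𝟙 i)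
    (c : Desc (fam (row a i))) :
    rowN a e c ≫ vert (A := fam a) (k := (i, l))
      (Desc.Hom.app ((rowOpfibration a).unit e.1 he c).hom l) = rowMor a c e.2 := by
  refine (Category.assoc _ _ _).trans ((congrArg (rowCart a e.1 c k ≫ ·)
    (vert_app_rowMor a (c := pushDesc a e.1 c) (d := c)
      ((rowOpfibration a).unit e.1 he c).hom e.2)).trans ?_)
  refine (Category.assoc _ _ _).symm.trans ((congrArg (· ≫ _) (rowCart_unit a e.1 _ c k)).trans ?_)
  exact Category.id_comp _

/-- The constraint `mul` is a morphism of descent data, so it moves past the structure morphism of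
`h.2`. What remains is the interchange of transport along `g.1` with the structure morphism over
`f.2`. -/
theorem rowN_mul {i j m : I} {k l n : K} (f : (i, k) ⟶ (j, l)) (g : (j, l) ⟶ (m, n))
    (h : (i, k) ⟶ (m, n)) (e : f ≫ g = h) (c : Desc (fam (row a i))) :
    rowN a f c ≫ rowN a g (pushDesc a f.1 c) = rowN a h c ≫ vert (A := fam a) (k := (m, n))
      (Desc.Hom.app ((rowOpfibration a).mul f.1 g.1 h.1 (congrArg Prod.fst e) c).hom n) := by
  refine Eq.symm ?_
  refine (Category.assoc _ _ _).trans ((congrArg (rowCart a h.1 c k ≫ ·)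
    (vert_app_rowMor a (c := pushDesc a h.1 c) (d := pushDesc a g.1 (pushDesc a f.1 c))
      ((rowOpfibration a).mul f.1 g.1 h.1 (congrArg Prod.fst e) c).hom h.2)).trans ?_)
  refine (Category.assoc _ _ _).symm.trans ((congrArg (· ≫ _)
    (rowCart_mul a f.1 g.1 h.1 (congrArg Prod.fst e) c k)).trans ?_)
  have hm : rowMor a (pushDesc a g.1 (pushDesc a f.1 c)) h.2 =
      rowMor a (pushDesc a g.1 (pushDesc a f.1 c)) f.2 ≫
        rowMor a (pushDesc a g.1 (pushDesc a f.1 c)) g.2 := by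
    rw [← rowMor_comp, ← e]
    rfl
  refine (congrArg (_ ≫ ·) hm).trans ?_
  refine (Category.assoc _ _ _).trans (Eq.trans ?_ (Category.assoc _ _ _).symm)
  refine congrArg (rowCart a f.1 c k ≫ ·) ?_
  refine (Category.assoc _ _ _).symm.trans (Eq.trans ?_ (Category.assoc _ _ _))
  exact congrArg (· ≫ rowMor a (pushDesc a g.1 (pushDesc a f.1 c)) g.2)
    (rowCart_rowMor a g.1 (pushDesc a f.1 c) f.2)

section

variable {A : Fam K} {k l m : K} {x y : A.obj k} {z w : A.obj l} {v v' : A.obj m}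

/-- This lemma and the next two turn equations in the total category into the fibrewise conditions
required by `Trans.ofInv`. -/
theorem Fam.tr_map_comp_of_homMk {f : k ⟶ l} {φ : x ⟶ y} {n : (A.tr f).obj x ⟶ z}
    {n' : (A.tr f).obj y ⟶ w} {ψ : z ⟶ w} (h : vert φ ≫ homMk f n' = homMk f n ≫ vert ψ) :
    (A.tr f).map φ ≫ n' = n ≫ ψ := by
  rw [homMk_vert, homMk_eq f n', vert_cart_assoc, ← vert_comp, ← homMk_eq] at h
  exact homMk_injective h

theorem Fam.comp_eq_unit_of_homMk {e : k ⟶ k} (he : e = 𝟙 k) {n : (A.tr e).obj x ⟶ y} {ψ : y ⟶ x}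
    (h : homMk e n ≫ vert ψ = 𝟙 _) : n ≫ ψ = (A.unit e he x).hom := by
  rw [homMk_vert, id_eq x e he] at h
  exact homMk_injective h

theorem Fam.mul_comp_of_homMk {f : k ⟶ l} {g : l ⟶ m} {h : k ⟶ m} (e : f ≫ g = h)
    {n : (A.tr f).obj x ⟶ z} {n' : (A.tr g).obj z ⟶ v} {n'' : (A.tr h).obj x ⟶ v'} {ψ : v' ⟶ v}
    (H : homMk f n ≫ homMk g n' = homMk h n'' ≫ vert ψ) :
    (A.mul f g h e x).hom ≫ (A.tr g).map n ≫ n' = n'' ≫ ψ := by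
  rw [homMk_vert, homMk_comp f n g n' h e] at H
  exact homMk_injective H

end

/-- The comparison morphisms of the evaluations. -/
noncomputable def rown {i j : I} {k l : K} (f : (i, k) ⟶ (j, l)) (c : Desc (fam (row a i))) :
    ((fam a).tr f).obj (c.obj k) ⟶ (pushDesc a f.1 c).obj l :=
  (exists_eq_homMk (A := fam a) (rowN a f c) f (rowN_base a f c)).choose

theorem homMk_rown {i j : I} {k l : K} (f : (i, k) ⟶ (j, l)) (c : Desc (fam (row a i))) :
    homMk (A := fam a) f (rown a f c) = rowN a f c :=
  (exists_eq_homMk (A := fam a) (rowN a f c) f (rowN_base a f c)).choose_spec.symm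

theorem isIso_rown {i j : I} {k l : K} (f : (i, k) ⟶ (j, l)) (c : Desc (fam (row a i))) :
    IsIso (rown a f c) := by
  have h := W_rowN a f c
  rw [← homMk_rown] at h
  exact h

/-- The universal cones, in terms of objects and morphisms. -/
noncomputable def rowTrans : (Fam.pull (pr1 I K) (rowFam a)).Trans (fam a) :=
  Trans.ofInv (fun k => Desc.ev k.2) (fun f c => rown a f c) (fun f c => isIso_rown a f c)
    (fun f c d p => tr_map_comp_of_homMk (A := fam a) ((congrArg (_ ≫ ·) (homMk_rown a f d)).trans
      ((rowN_naturality a f p).trans (congrArg (· ≫ _) (homMk_rown a f c)).symm)))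
    (fun {k} e he c => comp_eq_unit_of_homMk (A := fam a) he
      ((congrArg (· ≫ _) (homMk_rown a e c)).trans
        ((rowN_unit a e (congrArg Prod.fst he) c).trans (by
          subst he
          exact rowMor_id a c k.2))))
    (fun f g h e c => mul_comp_of_homMk (A := fam a) e
      ((congrArg₂ (· ≫ ·) (homMk_rown a f c) (homMk_rown a g (pushDesc a f.1 c))).trans
        ((rowN_mul a f g h e c).trans (congrArg (· ≫ _) (homMk_rown a h c)).symm)))

variable {a}

/-- A transformation from a diagram on the first factor from its description in terms of objects and
morphisms. -/
def mkFst {B : Fam I} (t : (Fam.pull (pr1 I K) B).Trans (fam a)) : ofFst (mkDiagram B) ⟶ a :=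
  mkTrans
    { ap := t.ap
      nat := t.nat
      naturality := t.naturality
      nat_unit := fun {k} e he x => by
        refine (t.nat_unit e he x).trans (congrArg (t.ap k).map (Eq.symm ?_))
        exact (congrArg Iso.hom (fam_pull_unit (CategoryTheory.Prod.fst I K) (mkDiagram B) e he _)).trans
          (fam_mkDiagram_unit B _ _ _)
      nat_mul := fun {k l m} f g h e x => by
        refine (t.nat_mul f g h e x).trans (congrArg (· ≫ _) (congrArg (t.ap m).map (Eq.symm ?_)))
        exact (congrArg Iso.hom (fam_pull_mul (CategoryTheory.Prod.fst I K) (mkDiagram B) f g h e _)).trans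
          (fam_mkDiagram_mul B _ _ _ _ _) }

theorem cnat_rowCone_mkFst {B : Fam I} (t : (Fam.pull (pr1 I K) B).Trans (fam a)) (i : I) {k l : K}
    (g : k ⟶ l) (x : B.obj i) : (cnat (rowCone (mkFst t) i) g x).inv =
      (t.nat (k := (i, k)) (l := (i, l)) (𝟙 i, g) x).inv ≫
        (t.ap (i, l)).map (B.unit (𝟙 i) rfl x).hom :=
  congrArg (fun z => (t.nat (k := (i, k)) (l := (i, l)) (𝟙 i, g) x).inv ≫ (t.ap (i, l)).map z)
    ((fam_unit_hom (mkDiagram B) _).symm.trans (fam_mkDiagram_unit B _ _ _))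

variable (a)

/-- The comparison functor goes from `Desc (fam (row a i))` to itself and keeps components and
structure morphisms, so it is isomorphic to the identity. -/
theorem isTwoLimit_rowCone (i : I) : IsTwoLimit (rowCone (mkFst (rowTrans a)) i) := by
  let T : Desc (fam (row a i)) ⥤ Desc (fam (row a i)) := toDesc (rowCone (mkFst (rowTrans a)) i)
  have h (c : Desc (fam (row a i))) {k l : K} (g : k ⟶ l) : (T.obj c).mor g = c.mor g := by
    refine rowIncl_map_injective (a := a) (i := i) ?_
    refine (congrArg (homMk (A := fam a) (k := (i, k)) (l := (i, l)) (𝟙 i, g))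
      (cnat_rowCone_mkFst (rowTrans a) i g c)).trans ?_
    refine (homMk_vert (A := fam a) (k := (i, k)) (l := (i, l)) (𝟙 i, g) _ _).symm.trans ?_
    refine (congrArg (· ≫ _) (homMk_rown a (k := k) (l := l) (𝟙 i, g) c)).trans ?_
    exact rowN_unit a (k := k) (l := l) (𝟙 i, g) rfl c
  have e : 𝟭 _ ≅ T := NatIso.ofComponents (fun c => Desc.isoMk (fun k => Iso.refl (c.obj k)) (by
      intro k l g
      refine (congrArg (_ ≫ ·) (vert_id _)).trans ?_
      refine Eq.trans ?_ (congrArg (· ≫ _) (vert_id _)).symm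
      exact (Category.comp_id _).trans ((h c g).symm.trans (Category.id_comp _).symm))) (by
      intro c d p
      ext k
      exact (Category.comp_id _).trans (Category.id_comp _).symm)
  have hT : T.IsEquivalence := Functor.isEquivalence_of_iso e
  exact (isTwoLimit_iff_isEquivalence _).2 hT

/-- Every diagram has a limit. -/
theorem exists_isTwoLimit (b : Diagram K) :
    ∃ (P : Cat.{u, u}) (σ : const K P ⟶ b), IsTwoLimit σ := by
  let P : Cat.{u, u} := Cat.of (Desc (fam b))
  let F : P ⥤ Desc (fam b) := 𝟭 (Desc (fam b))
  have hF : F.IsEquivalence := inferInstanceAs (𝟭 (Desc (fam b))).IsEquivalence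
  obtain ⟨σ, ⟨e⟩⟩ := (inferInstance : (coneFunctor b P).EssSurj).mem_essImage F
  have h : (toDesc σ).IsEquivalence := Functor.isEquivalence_of_iso e.symm
  exact ⟨P, σ, (isTwoLimit_iff_isEquivalence σ).2 h⟩

theorem nonempty_iteratedLimits : Nonempty (IteratedLimits a) := by
  obtain ⟨P, p, hp⟩ := exists_isTwoColimit (mkDiagram (rowFam a))
  obtain ⟨Q, q, hq⟩ := exists_isTwoLimit (mkDiagram (colFam a))
  exact ⟨⟨_, _, isTwoColimit_colCocone a, _, _, isTwoLimit_rowCone a, P, p, hp, Q, q, hq⟩⟩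

end TwoLim

/-- The preceding results are applied with `K = Jᵒᵖ`, which is finite because `J` is. -/
theorem mainTheorem1 {I J : Type u} [SmallCategory I] [IsFiltered I] [SmallCategory J]
    [FinCategory J] (a : LocallyDiscrete (I × Jᵒᵖ) ⥤ᵖ Cat.{u, u}) :
    Nonempty (TwoLim.IteratedLimits a) ∧
      ∀ L : TwoLim.IteratedLimits a,
        (∃ Ψ : L.colimLim ⟶ L.limColim, L.IsComparison Ψ) ∧
        (∀ Ψ Ψ' : L.colimLim ⟶ L.limColim,
          L.IsComparison Ψ → L.IsComparison Ψ' → Nonempty (Ψ ≅ Ψ')) ∧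
        ∀ Ψ : L.colimLim ⟶ L.limColim, L.IsComparison Ψ → Ψ.toFunctor.IsEquivalence :=
  ⟨TwoLim.nonempty_iteratedLimits a, fun L => ⟨L.exists_isComparison, fun _ _ h h' => h.unique h',
    fun _ h => h.isEquivalence⟩⟩
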